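/- Let $k=\mathbb F_q$ be a finite field with $q=p^e$ elements ($p$ prime, $e\ge 1$), let $\bar k$ be an algebraic closure of $k$, let $\mathbb P^2=\operatorname{Proj} k[x_0,x_1,x_2]$, and let $Z=\mathbb P^2(\mathbb F_q)\subset\mathbb P^2$ be the finite set of $k$-rational points, regarded as a reduced closed subscheme with ideal sheaf $I_Z$. For a field $K\supseteq k$, let $H^0(\mathbb P^2_K,I_Z(q+1))$ be the $K$-vector space of forms of degree $q+1$ in $K[x_0,x_1,x_2]$ vanishing at all points of $Z$, and let $|I_Z(q+1)|$ be its projectivization, i.e. the linear system of plane curves of degree $q+1$ containing $Z$. 1. The linear system $|I_Z(q+1)|$ on $\mathbb P^2$ has (projective) dimension $2$, i.e. $\dim_k H^0(\mathbb P^2,I_Z(q+1))=3$, and its base locus is exactly $Z$, both as a set and as a closed subscheme. 2. For every basis $s_0,s_1,s_2$ of $H^0(\mathbb P^2,I_Z(q+1))$, the linear system determines a unique morphism $\psi=[s_0:s_1:s_2]:\mathbb P^2-Z\to\mathbb P^2$. This morphism is dominant, and the corresponding extension of function fields is purely inseparable of degree $q$. As a rational map $\mathbb P^2\dashrightarrow\mathbb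 P^2$ it is resolved by blowing up $Z$: the blow-up $\pi:\operatorname{Bl}_Z\mathbb P^2\to\mathbb P^2$ exists, and there is a morphism $\operatorname{Bl}_Z\mathbb P^2\to\mathbb P^2$ that agrees with $\psi\circ\pi$ on $\pi^{-1}(\mathbb P^2-Z)$. 3. The linear system $|I_Z(q+1)|$ on $\mathbb P^2_{\bar k}$ also has dimension $2$. Each curve $C\in|I_Z(q+1)|$ on $\mathbb P^2_{\bar k}$ has exactly one singular point in $\mathbb P^2(\bar k)$, where a point is singular on $F=0$ if $F$ and all its partial derivatives vanish there. Sending $C$ to its singular point is a bijection from $|I_Z(q+1)|$ to $\mathbb P^2(\bar k)$. -/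

import Mathlib

open CategoryTheory AlgebraicGeometry MvPolynomial

attribute [local instance] MvPolynomial.gradedAlgebra

universe u

noncomputable section

namespace SerrePlane

/-! ### The projective plane and its rational points -/

/-- The standard grading of the polynomial ring `K[x₀, x₁, x₂]`. -/
abbrev grading (K : Type u) [Field K] : ℕ → Submodule K (MvPolynomial (Fin 3) K) :=
  homogeneousSubmodule (Fin 3) K

/-- The projective plane `ℙ²` over `K` as a scheme, `Proj K[x₀, x₁, x₂]`. -/
abbrev plane (K : Type u) [Field K] : Scheme.{u} :=
  Proj (grading K)

/-- The closed set `ℙ²(k)` of rational points of the plane over a finite field `k`.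
The rational point `[v₀ : v₁ : v₂]` is the only point of `Proj k[x₀, x₁, x₂]` that contains all
the linear forms `vᵢ xⱼ - vⱼ xᵢ`. -/
def rationalPoints (k : Type u) [Field k] [Finite k] : TopologicalSpace.Closeds (plane k) where
  carrier := {x | ∃ v : Fin 3 → k, v ≠ 0 ∧
    ∀ i j, (C (v i) * X j - C (v j) * X i : MvPolynomial (Fin 3) k) ∈ x.asHomogeneousIdeal}
  isClosed' := by
    have h : {x : plane k | ∃ v : Fin 3 → k, v ≠ 0 ∧
        ∀ i j, (C (v i) * X j - C (v j) * X i : MvPolynomial (Fin 3) k) ∈ x.asHomogeneousIdeal} =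
        ⋃ v : {v : Fin 3 → k // v ≠ 0}, ProjectiveSpectrum.zeroLocus (grading k)
          {f | ∃ i j, f = C (v.1 i) * X j - C (v.1 j) * X i} := by
      ext x
      constructor
      · rintro ⟨v, hv, h⟩
        refine Set.mem_iUnion.2 ⟨⟨v, hv⟩, ?_⟩
        rintro f ⟨i, j, rfl⟩
        exact h i j
      · intro h
        obtain ⟨v, h⟩ := Set.mem_iUnion.1 h
        exact ⟨v.1, v.2, fun i j => h ⟨i, j, rfl⟩⟩
    rw [h]
    exact isClosed_iUnion_of_finite fun v => ProjectiveSpectrum.isClosed_zeroLocus _ _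

/-- The ideal sheaf of the closed subscheme `Z = ℙ²(k)` (with its reduced structure). -/
def idealZ (k : Type u) [Field k] [Finite k] : (plane k).IdealSheafData :=
  Scheme.IdealSheafData.vanishingIdeal (rationalPoints k)

/-- The open subscheme `ℙ² - Z`. -/
def planeMinusZ (k : Type u) [Field k] [Finite k] : (plane k).Opens :=
  (rationalPoints k).compl

/-! ### The linear system of plane curves through `Z` -/

/-- The space `H⁰(ℙ²_K, I_Z(d))` of forms of degree `d` over an extension `K` of `k` that vanish at
all the points of `Z = ℙ²(k)`. The linear system `|I_Z(d)|` on `ℙ²_K` is its projectivization. -/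
def formsThroughZ (k K : Type u) [Field k] [Field K] [Algebra k K] (d : ℕ) :
    Submodule K (MvPolynomial (Fin 3) K) where
  carrier := {F | F.IsHomogeneous d ∧
    ∀ v : Fin 3 → k, v ≠ 0 → eval (fun i => algebraMap k K (v i)) F = 0}
  add_mem' := fun hF hG =>
    ⟨hF.1.add hG.1, fun v hv => by rw [map_add, hF.2 v hv, hG.2 v hv, add_zero]⟩
  zero_mem' := ⟨isHomogeneous_zero _ _ _, fun v _ => map_zero _⟩
  smul_mem' := fun c F hF =>
    ⟨(homogeneousSubmodule (Fin 3) K d).smul_mem c hF.1, fun v hv => by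
      rw [smul_eval, hF.2 v hv, mul_zero]⟩

/-- The base locus of a linear system of curves: the points of `ℙ²` lying on all of them. -/
def baseLocus {K : Type u} [Field K] (W : Submodule K (MvPolynomial (Fin 3) K)) :
    Set (plane K) :=
  {x | ∀ F ∈ W, F ∈ x.asHomogeneousIdeal}

/-- For a form `H` of degree `e` and a form `G` of degree `n * e`, the regular function `G / Hⁿ`
on the principal open set `D₊(H)`. -/
def fraction {K : Type u} [Field K] {e : ℕ} (H : MvPolynomial (Fin 3) K) (hH : H.IsHomogeneous e)
    (n : ℕ) (G : MvPolynomial (Fin 3) K) (hG : G.IsHomogeneous (n * e)) :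
    Γ(plane K, Proj.basicOpen (grading K) H) :=
  (Proj.awayToSection (grading K) H).hom
    (HomogeneousLocalization.Away.mk (grading K) (d := e) hH n G hG)

/-- The standard affine chart `D₊(xᵢ)` of the plane. -/
def chart (K : Type u) [Field K] (i : Fin 3) : (plane K).affineOpens :=
  ⟨Proj.basicOpen (grading K) (X i),
    Proj.isAffineOpen_basicOpen (grading K) (X i) (isHomogeneous_X K i) Nat.one_pos⟩

/-- `I` is the ideal sheaf of the scheme-theoretic base locus of the linear system given by a space
`W` of forms of degree `d`: on each chart `D₊(xᵢ)` it is generated by the functions `F / xᵢᵈ`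
with `F ∈ W`. -/
def IsBaseIdeal {K : Type u} [Field K] (d : ℕ) (W : Submodule K (MvPolynomial (Fin 3) K))
    (I : (plane K).IdealSheafData) : Prop :=
  ∀ i : Fin 3, I.ideal (chart K i) = Ideal.span
    {t | ∃ F ∈ W, ∃ hF : F.IsHomogeneous (d * 1), t = fraction (X i) (isHomogeneous_X K i) d F hF}

/-! ### The morphism defined by a linear system -/

lemma isHomogeneous_comp {K : Type u} [Field K] {d n : ℕ} {s : Fin 3 → MvPolynomial (Fin 3) K}
    (hs : ∀ i, (s i).IsHomogeneous d) {G : MvPolynomial (Fin 3) K} (hG : G.IsHomogeneous (n * 1)) :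
    (aeval s G).IsHomogeneous (n * d) := by
  have h := hG.aeval s hs
  rwa [mul_one, mul_comm] at h

/-- `f` is the morphism `x ↦ [s₀(x) : s₁(x) : s₂(x)]` from the open subscheme `U` of `ℙ²` to `ℙ²`
given by three forms of the same degree `d`: the preimage of `D₊(yᵢ)` is `U ∩ D₊(sᵢ)`, and the
function `G(y₀, y₁, y₂) / yᵢⁿ` on `D₊(yᵢ)` is pulled back to `G(s₀, s₁, s₂) / sᵢⁿ`, for all `i`
and all forms `G` of all degrees `n`. (The case `n = 0` says that `f` is a morphism over `K`.) -/
def IsMorphismOfForms {K : Type u} [Field K] {d : ℕ} (s : Fin 3 → MvPolynomial (Fin 3) K)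
    (hs : ∀ i, (s i).IsHomogeneous d) (U : (plane K).Opens) (f : (U : Scheme.{u}) ⟶ plane K) :
    Prop :=
  ∀ i : Fin 3, ∃ e : U.ι ⁻¹ᵁ Proj.basicOpen (grading K) (s i) =
      f ⁻¹ᵁ Proj.basicOpen (grading K) (X i),
    ∀ (n : ℕ) (G : MvPolynomial (Fin 3) K) (hG : G.IsHomogeneous (n * 1)),
      (f.appLE _ _ e.le).hom (fraction (X i) (isHomogeneous_X K i) n G hG) =
        (U.ι.app _).hom (fraction (s i) (hs i) n (aeval s G) (isHomogeneous_comp hs hG))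

/-- For a morphism `f : S ⟶ T` of integral schemes: `f` is dominant, and the extension of function
fields `K(T) ⊆ K(S)` (the map that `f` induces on the stalks at the generic points) is purely
inseparable of degree `n`. -/
def IsPurelyInseparableOfDegree {S T : Scheme.{u}} (f : S ⟶ T) (n : ℕ) : Prop :=
  ∃ x : S, IsGenericPoint x Set.univ ∧ IsGenericPoint (f x) Set.univ ∧
    (f.stalkMap x).hom.IsPurelyInseparable ∧ (f.stalkMap x).hom.finrank = n

/-! ### Blowing up -/

/-- An ideal sheaf is invertible (that is, it defines an effective Cartier divisor) if locally it
is generated by one nonzerodivisor. -/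
def IsInvertibleIdeal {T : Scheme.{u}} (J : T.IdealSheafData) : Prop :=
  ∀ x : T, ∃ U : T.affineOpens, x ∈ U.1 ∧
    ∃ a ∈ nonZeroDivisors Γ(T, U.1), J.ideal U = Ideal.span {a}

/-- `π : B ⟶ S` is the blow-up of `S` along the closed subscheme with ideal sheaf `I`: the inverse
image ideal sheaf of `I` is invertible on `B`, and `π` is universal with this property. -/
def IsBlowup {B S : Scheme.{u}} (π : B ⟶ S) (I : S.IdealSheafData) : Prop :=
  IsInvertibleIdeal (I.comap π) ∧
    ∀ (T : Scheme.{u}) (f : T ⟶ S), IsInvertibleIdeal (I.comap f) → ∃! g : T ⟶ B, g ≫ π = f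

/-! ### Singular points -/

/-- The plane curve `F = 0` is singular at the point `P`: `F` and all its partial derivatives
vanish at `P`. -/
def IsSingularAt {K : Type u} [Field K] (F : MvPolynomial (Fin 3) K)
    (P : Projectivization K (Fin 3 → K)) : Prop :=
  eval P.rep F = 0 ∧ ∀ i, eval P.rep (pderiv i F) = 0

end SerrePlane

end

/-!
Write `q = #k` and `x^(q)` for the vector of the `q`-th powers of the coordinates of `x`.

*The linear system.* A polynomial that vanishes on `k³` is zero once all its exponents have been
made smaller than `q` by the relations `xᵢ^q = xᵢ`. In degree `q + 1` this shows that the forms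
vanishing on `ℙ²(k)` are exactly the forms `a · (x × x^(q))` for a vector `a`
(`exists_eq_crossForm`), so there is a three-dimensional space of them. On the chart `xᵢ = 1` they
include `t^q - t` for each of the coordinates `t`, hence the ideal `J` that they generate contains
`t^q - t` for every function `t`. So `J` is radical, and it is the ideal of the reduced subscheme
`Z` (`isBaseIdeal_idealZ`).

*Singular points.* The gradient of `a · (x × x^(q))` is `x^(q) × a`, because the derivative of a
`q`-th power is zero. It vanishes exactly at the points `x` with `[x^(q)] = [a]`, of which there is
one over an algebraically closed field (`exists_singularPoint_equiv`).

*The morphism.* In the basis given by `w = x × x^(q)`, the morphism `ψ` is `x ↦ w(x)`. Then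
`w × w^(q)` is `x^(q)` up to the Moore determinant `det(x, x^(q), x^(q²))`
(`frobCross_frobCross`), so that `x ↦ w × w^(q)` is the Frobenius morphism of the plane. Hence `ψ`
is dominant, and `K(ℙ²)^q ⊆ ψ^* K(ℙ²) ⊆ K(ℙ²)`. The relations `x^(q) · w = 0` and `x · w = 0` show
that each of these two extensions is generated by one `q`-th root, while the degree of the whole
is `q²`; so both have degree `q` (`finrank_eq_of_tower`, `isPurelyInseparable_and_finrank_eq`).

*The blow-up.* Let `Γ ⊆ ℙ² × ℙ²` be the scheme-theoretic closure of the graph of `ψ`. Since `I_Z`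
is generated by the basis forms, the inverse image of `I_Z` under a morphism `f` to `ℙ²` is
invertible if and only if `f⁻¹(ℙ² - Z)` is scheme-theoretically dense and the rational map `ψ ∘ f`
extends to a morphism (`exists_extension`, `isInvertibleIdeal_comap_of_extension`). This is the
universal property of `Γ`, so `Γ` is the blow-up, and its second projection extends `ψ`
(`exists_isBlowup`).
-/

noncomputable section

namespace SerrePlane

/-! ### The vector product of a vector and its Frobenius conjugate -/

/-- The vector product `x × x^(q)` of a vector `x` and the vector `x^(q)` of the `q`-th powers of
its coordinates. Indices are taken modulo `3`. -/
def frobCross {R : Type*} [CommRing R] (q : ℕ) (x : Fin 3 → R) (i : Fin 3) : R :=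
  x (i + 1) * x (i + 2) ^ q - x (i + 2) * x (i + 1) ^ q

lemma map_frobCross {R S Φ : Type*} [CommRing R] [CommRing S] [FunLike Φ R S] [RingHomClass Φ R S]
    (f : Φ) (q : ℕ) (x : Fin 3 → R) (i : Fin 3) :
    f (frobCross q x i) = frobCross q (fun j => f (x j)) i := by
  simp [frobCross]

lemma frobCross_smul {R : Type*} [CommRing R] (q : ℕ) (c : R) (x : Fin 3 → R) (i : Fin 3) :
    frobCross q (fun j => c * x j) i = c ^ (q + 1) * frobCross q x i := by
  simp only [frobCross]; ring

lemma sum_mul_frobCross {R : Type*} [CommRing R] (q : ℕ) (x : Fin 3 → R) :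
    ∑ i, x i * frobCross q x i = 0 := by
  simp only [frobCross, Fin.sum_univ_three, Fin.isValue, zero_add, Fin.reduceAdd]; ring

lemma sum_pow_mul_frobCross {R : Type*} [CommRing R] (q : ℕ) (x : Fin 3 → R) :
    ∑ i, x i ^ q * frobCross q x i = 0 := by
  simp only [frobCross, Fin.sum_univ_three, Fin.isValue, zero_add, Fin.reduceAdd]; ring

lemma sub_pow_natCard (k : Type*) [Field k] [Finite k] {R : Type*} [CommRing R] [Algebra k R]
    (a b : R) : (a - b) ^ Nat.card k = a ^ Nat.card k - b ^ Nat.card k := by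
  have := Fintype.ofFinite k
  have h := map_sub (FiniteField.frobeniusAlgHom k R) a b
  simpa [FiniteField.coe_frobeniusAlgHom] using h

lemma aeval_pow_natCard {k : Type*} [Field k] [Finite k] {R : Type*} [CommRing R] [Algebra k R]
    {σ : Type*} (a : σ → R) (G : MvPolynomial σ k) :
    aeval a G ^ Nat.card k = aeval (fun i => a i ^ Nat.card k) G := by
  have := Fintype.ofFinite k
  have h := congrArg (fun f => f G) (comp_aeval a (FiniteField.frobeniusAlgHom k R))
  simpa [FiniteField.coe_frobeniusAlgHom] using h

/-- The duality behind the theorem: applying `x ↦ x × x^(q)` twice gives the Frobenius map up to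
the Moore determinant `det(x, x^(q), x^(q²))`. -/
lemma frobCross_frobCross (k : Type*) [Field k] [Finite k] {R : Type*} [CommRing R] [Algebra k R]
    (x : Fin 3 → R) (i : Fin 3) :
    frobCross (Nat.card k) (frobCross (Nat.card k) x) i =
      (∑ j, (x j ^ Nat.card k) ^ Nat.card k * frobCross (Nat.card k) x j) * x i ^ Nat.card k := by
  simp only [frobCross, sub_pow_natCard k, Fin.sum_univ_three, mul_pow]
  fin_cases i <;> simp <;> ring

/-- In an integral domain over a field `k` with `q` elements, `a ^ q * b = a * b ^ q` only if
`(a, b)` is proportional to a vector over `k`. -/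
lemma eq_zero_or_exists_smul (k : Type*) [Field k] [Finite k] {R : Type*} [CommRing R] [IsDomain R]
    [Algebra k R] {a b : R} (h : a ^ Nat.card k * b = a * b ^ Nat.card k) :
    b = 0 ∨ ∃ c : k, a = c • b := by
  have := Fintype.ofFinite k
  refine or_iff_not_imp_left.2 fun hb => ?_
  let L := FractionRing R
  have hbL : algebraMap R L b ≠ 0 := by simpa using hb
  set t : L := algebraMap R L a / algebraMap R L b with ht
  have htq : t ^ Nat.card k = t := by
    have h' := congrArg (algebraMap R L) h
    simp only [map_mul, map_pow] at h'
    rw [ht, div_pow, div_eq_div_iff (pow_ne_zero _ hbL) hbL, h']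
  set P : Polynomial k := Polynomial.X ^ Fintype.card k - Polynomial.X with hP
  have hsplits : P.Splits := by
    rw [Polynomial.splits_iff_card_roots, FiniteField.roots_X_pow_card_sub_X, ← Finset.card_def,
      Finset.card_univ, FiniteField.X_pow_card_sub_X_natDegree_eq _ Fintype.one_lt_card]
  have hP0 : P.map (algebraMap k L) ≠ 0 :=
    (Polynomial.map_ne_zero_iff (algebraMap k L).injective).2
      (FiniteField.X_pow_card_sub_X_ne_zero k Fintype.one_lt_card)
  have hroot : t ∈ (P.map (algebraMap k L)).roots := by
    rw [Polynomial.mem_roots hP0]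
    simp [hP, ← Nat.card_eq_fintype_card, htq]
  rw [hsplits.roots_map, Multiset.mem_map] at hroot
  obtain ⟨c, -, hc⟩ := hroot
  refine ⟨c, IsFractionRing.injective R L ?_⟩
  rw [Algebra.smul_def, map_mul, ← IsScalarTower.algebraMap_apply, hc, ht, div_mul_cancel₀ _ hbL]

lemma frobCross_isHomogeneous (K : Type*) [Field K] (q : ℕ) (i : Fin 3) :
    (frobCross q (X : Fin 3 → MvPolynomial (Fin 3) K) i).IsHomogeneous (q + 1) := by
  have h (i j : Fin 3) : (X i * X j ^ q : MvPolynomial (Fin 3) K).IsHomogeneous (q + 1) := by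
    have := (isHomogeneous_X K i).mul ((isHomogeneous_X K j).pow q)
    rwa [one_mul, add_comm] at this
  exact (h _ _).sub (h _ _)

/-- The form `a · (x × x^(q))` of degree `q + 1`. -/
def crossForm {K : Type*} [Field K] (q : ℕ) (a : Fin 3 → K) : MvPolynomial (Fin 3) K :=
  ∑ i, C (a i) * frobCross q X i

lemma pderiv_crossForm {K : Type*} [Field K] {q : ℕ} (hq : (q : K) = 0) (a : Fin 3 → K)
    (j : Fin 3) : pderiv j (crossForm q a) =
      C (a (j + 2)) * X (j + 1) ^ q - C (a (j + 1)) * X (j + 2) ^ q := by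
  have hq' : (q : MvPolynomial (Fin 3) K) = 0 := by
    rw [← map_natCast (C : K →+* MvPolynomial (Fin 3) K), hq, map_zero]
  fin_cases j <;>
    simp [crossForm, frobCross, Fin.sum_univ_three, pderiv_X, hq',
      Derivation.leibniz_pow] <;> ring

/-- The values of the partial derivatives of `a · (x × x^(q))` at the unit vectors recover `a`. -/
lemma crossForm_injective {K : Type*} [Field K] {q : ℕ} (hq : (q : K) = 0) (hq0 : q ≠ 0) :
    Function.Injective (crossForm q : (Fin 3 → K) → _) := by
  intro a b h
  have key (j : Fin 3) : a (j + 2) = b (j + 2) := by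
    have h' := congrArg (eval (Pi.single (j + 1) (1 : K))) (congrArg (pderiv j) h)
    rw [pderiv_crossForm hq, pderiv_crossForm hq] at h'
    have : j + 2 ≠ j + 1 := by fin_cases j <;> decide
    simpa [this, hq0] using h'
  ext i
  have := key (i + 1)
  have e : i + 1 + 2 = i := by fin_cases i <;> rfl
  rwa [e] at this

/-! ### The forms of degree `q + 1` through the rational points -/

lemma crossForm_mem (k K : Type u) [Field k] [Finite k] [Field K] [Algebra k K] (a : Fin 3 → K) :
    crossForm (Nat.card k) a ∈ formsThroughZ k K (Nat.card k + 1) := by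
  have := Fintype.ofFinite k
  refine Submodule.sum_mem _ fun i _ => ?_
  rw [← smul_eq_C_mul]
  refine Submodule.smul_mem _ _ ⟨frobCross_isHomogeneous K _ i, fun v _ => ?_⟩
  have h (c : k) : algebraMap k K c ^ Nat.card k = algebraMap k K c := by
    rw [← map_pow, Nat.card_eq_fintype_card, FiniteField.pow_card]
  rw [map_frobCross]
  simp only [frobCross, eval_X, h]
  ring

lemma coeff_X_mul_X_pow {K : Type*} [Field K] (i j : Fin 3) (n : ℕ) (m : Fin 3 →₀ ℕ) :
    coeff m (X i * X j ^ n : MvPolynomial (Fin 3) K) =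
      if Finsupp.single i 1 + Finsupp.single j n = m then 1 else 0 := by
  classical
  rw [X_pow_eq_monomial, X, monomial_mul, coeff_monomial, one_mul]

lemma single_add_single_inj {q : ℕ} (hq : 2 ≤ q) {i j i' j' : Fin 3}
    (hij : i ≠ j) (hij' : i' ≠ j') :
    (Finsupp.single i 1 + Finsupp.single j q = Finsupp.single i' 1 + Finsupp.single j' q) ↔
      i = i' ∧ j = j' := by
  constructor
  · intro h
    have h1 := DFunLike.congr_fun h j
    have hj : j = j' := by
      by_contra hne
      simp only [Finsupp.coe_add, Pi.add_apply, Finsupp.single_apply, if_neg hij,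
        if_neg (Ne.symm hne)] at h1
      split_ifs at h1 <;> simp at h1 <;> omega
    subst hj
    refine ⟨?_, rfl⟩
    have h2 := add_right_cancel h
    exact (Finsupp.single_left_inj one_ne_zero).1 h2
  · rintro ⟨rfl, rfl⟩; rfl

lemma coeff_X_mul_X_pow_of_ne {K : Type*} [Field K] {q : ℕ} (hq : 2 ≤ q) {i j i' j' : Fin 3}
    (hij : i ≠ j) (hij' : i' ≠ j') :
    coeff (Finsupp.single i' 1 + Finsupp.single j' q) (X i * X j ^ q : MvPolynomial (Fin 3) K) =
      if i = i' ∧ j = j' then 1 else 0 := by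
  rw [coeff_X_mul_X_pow]
  exact if_congr (single_add_single_inj hq hij hij') rfl rfl

lemma coeff_single_eq_eval {K : Type*} [Field K] {n : ℕ} {G : MvPolynomial (Fin 3) K}
    (hG : G.IsHomogeneous n) (i : Fin 3) :
    coeff (Finsupp.single i n) G = eval (Pi.single i 1) G := by
  classical
  rw [eval_eq, Finset.sum_eq_single (Finsupp.single i n)]
  · rw [Finset.prod_eq_one, mul_one]
    intro j hj
    obtain ⟨rfl, -⟩ := Finsupp.mem_support_single _ _ _ |>.1 hj
    simp
  · intro m hm hne
    have hdeg := hG (mem_support_iff.1 hm)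
    obtain ⟨j, hj, hji⟩ : ∃ j ∈ m.support, j ≠ i := by
      by_contra! h
      obtain ⟨b, rfl⟩ := Finsupp.support_subset_singleton'.1
        (fun j hj => Finset.mem_singleton.2 (h j hj))
      apply hne
      simp [Finsupp.weight_apply] at hdeg
      rw [hdeg]
    rw [Finset.prod_eq_zero hj, mul_zero]
    simp [hji, Finsupp.mem_support_iff.1 hj]
  · intro h
    rw [notMem_support_iff.1 h, zero_mul]

/-- A polynomial that vanishes on `k³` is determined by the reductions of its monomials modulo
`xᵢ^q - xᵢ`. In degree `q + 1` only the monomials `xᵢ xⱼ^q` reduce. -/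
lemma exists_eq_crossForm (k K : Type u) [Field k] [Finite k] [Field K] [Algebra k K]
    {F : MvPolynomial (Fin 3) K} (hF : F ∈ formsThroughZ k K (Nat.card k + 1)) :
    ∃ a, F = crossForm (Nat.card k) a := by
  classical
  have := Fintype.ofFinite k
  set q := Nat.card k with hqdef
  have hq : 2 ≤ q := Finite.one_lt_card
  have hpow (c : k) : algebraMap k K c ^ q = algebraMap k K c := by
    rw [← map_pow, hqdef, Nat.card_eq_fintype_card, FiniteField.pow_card]
  set a : Fin 3 → K := fun i => coeff (Finsupp.single (i + 1) 1 + Finsupp.single (i + 2) q) F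
  refine ⟨a, ?_⟩
  set G := F - crossForm q a with hG
  have hGmem : G ∈ formsThroughZ k K (q + 1) := Submodule.sub_mem _ hF (crossForm_mem k K a)
  have hGa (i : Fin 3) : coeff (Finsupp.single (i + 1) 1 + Finsupp.single (i + 2) q) G = 0 := by
    have h1 (j : Fin 3) : coeff (Finsupp.single (i + 1) 1 + Finsupp.single (i + 2) q)
        (C (a j) * frobCross q X j) = if j = i then a j else 0 := by
      rw [coeff_C_mul, frobCross, coeff_sub,
        coeff_X_mul_X_pow_of_ne hq (by fin_cases j <;> decide) (by fin_cases i <;> decide),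
        coeff_X_mul_X_pow_of_ne hq (by fin_cases j <;> decide) (by fin_cases i <;> decide)]
      fin_cases i <;> fin_cases j <;> simp
    simp [hG, crossForm, coeff_sum, h1, a]
  have hGdiag (i : Fin 3) : coeff (Finsupp.single i (q + 1)) G = 0 := by
    rw [coeff_single_eq_eval hGmem.1, ← hGmem.2 (Pi.single i 1) (by simp)]
    congr 2
    ext j
    by_cases hj : j = i <;> simp [hj]
  set c : Fin 3 → K := fun i => coeff (Finsupp.single (i + 2) 1 + Finsupp.single (i + 1) q) G
  -- The subtracted polynomials vanish on `k³`, and `H` has degree less than `q` in each variable.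
  set H := G - ∑ i, C (c i) * (X (i + 2) * X (i + 1) ^ q - X (i + 2) * X (i + 1) ^ 1) with hH
  have hH0 : H = 0 := by
    refine eq_zero_of_eval_zero_at_prod_finset H
      (fun _ => Finset.univ.image (algebraMap k K)) (fun i => ?_) (fun x hx => ?_)
    · rw [Finset.card_image_of_injective _ (algebraMap k K).injective, Finset.card_univ,
        ← Nat.card_eq_fintype_card, ← hqdef, degreeOf_lt_iff (by omega)]
      intro m hm
      by_contra hlt
      push Not at hlt
      apply mem_support_iff.1 hm
      have hne (j : Fin 3) : ¬ (Finsupp.single (j + 2) 1 + Finsupp.single (j + 1) 1 = m) := by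
        rintro rfl
        revert hlt
        simp only [Finsupp.coe_add, Pi.add_apply, Finsupp.single_apply, imp_false, not_le]
        fin_cases i <;> fin_cases j <;> simp <;> omega
      simp only [hH, coeff_sub, coeff_sum, coeff_C_mul, coeff_X_mul_X_pow, hne, if_false, sub_zero]
      by_cases hdeg : m.degree = q + 1
      · obtain ⟨m', rfl⟩ := exists_add_of_le (Finsupp.single_le_iff.2 hlt)
        obtain ⟨l, rfl⟩ : ∃ l, m' = Finsupp.single l 1 := by
          have hm' : m'.degree = 1 := by
            simp only [map_add, Finsupp.degree_single] at hdeg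
            omega
          obtain ⟨l, hl⟩ : ∃ l, m' l ≠ 0 := by
            by_contra! h
            rw [show m' = 0 from Finsupp.ext h] at hm'
            simp at hm'
          obtain ⟨m'', rfl⟩ :=
            exists_add_of_le (Finsupp.single_le_iff.2 (Nat.one_le_iff_ne_zero.2 hl))
          have h0 : m'' = 0 := by
            rw [← Finsupp.degree_eq_zero_iff]
            simpa using hm'
          exact ⟨l, by simp [h0]⟩
        rw [add_comm (Finsupp.single i q)]
        by_cases hl : l = i
        · subst hl
          have hl' (j : Fin 3) :
              ¬ (Finsupp.single (j + 2) 1 + Finsupp.single (j + 1) q =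
                (Finsupp.single l 1 + Finsupp.single l q : Fin 3 →₀ ℕ)) := by
            intro h
            have h1 := DFunLike.congr_fun h l
            revert h1
            simp only [Finsupp.coe_add, Pi.add_apply, Finsupp.single_apply]
            fin_cases l <;> fin_cases j <;> simp <;> omega
          have h2 : coeff (Finsupp.single l 1 + Finsupp.single l q) G = 0 := by
            rw [← Finsupp.single_add, add_comm, hGdiag]
          simp [h2, hl']
        · have h1 (j : Fin 3) := coeff_X_mul_X_pow_of_ne (K := K) hq (i := j + 2) (j := j + 1)
            (by fin_cases j <;> decide) hl
          simp only [coeff_X_mul_X_pow] at h1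
          simp only [h1]
          have h0 := hGa (i + 1)
          fin_cases i <;> fin_cases l <;> simp_all [Fin.sum_univ_three, c]
      · have h2 (j : Fin 3) : ¬ (Finsupp.single (j + 2) 1 + Finsupp.single (j + 1) q = m) := by
          rintro rfl
          apply hdeg
          simp [add_comm]
        have h3 : coeff m G = 0 := hGmem.1.coeff_eq_zero hdeg
        simp [h2, h3]
    · have hx' : ∀ i, ∃ v : k, algebraMap k K v = x i := fun i => by simpa using hx i
      choose v hv using hx'
      obtain rfl : x = fun i => algebraMap k K (v i) := funext fun i => (hv i).symm
      have h1 : eval (fun i => algebraMap k K (v i)) G = 0 := by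
        by_cases hv0 : v = 0
        · have h0 : constantCoeff G = 0 := hGmem.1.coeff_eq_zero (by simp)
          simpa [hv0, ← Pi.zero_def, eval_zero] using h0
        · exact hGmem.2 v hv0
      simp [hH, h1, hpow]
  have hc (i : Fin 3) : c i = 0 := by
    have h1 := congrArg (coeff (Finsupp.single (i + 2) 1 + Finsupp.single (i + 1) 1)) hH0
    have hdeg : coeff (Finsupp.single (i + 2) 1 + Finsupp.single (i + 1) 1) G = 0 := by
      refine hGmem.1.coeff_eq_zero ?_
      simp only [map_add, Finsupp.degree_single]
      omega
    have h2 (j : Fin 3) : ¬ (Finsupp.single (j + 2) 1 + Finsupp.single (j + 1) q =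
        (Finsupp.single (i + 2) 1 + Finsupp.single (i + 1) 1 : Fin 3 →₀ ℕ)) := by
      intro h
      have h1 := congrArg Finsupp.degree h
      simp only [map_add, Finsupp.degree_single] at h1
      omega
    simp only [hH, coeff_sub, coeff_sum, coeff_C_mul, coeff_X_mul_X_pow, h2, hdeg] at h1
    fin_cases i <;> simpa [Fin.sum_univ_three, Finsupp.ext_iff, Fin.forall_fin_succ] using h1
  have : G = 0 := by simpa [hH, hc] using hH0
  exact sub_eq_zero.1 this

lemma natCast_natCard_eq_zero (k K : Type*) [Field k] [Finite k] [Field K] [Algebra k K] :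
    (Nat.card k : K) = 0 := by
  have := Fintype.ofFinite k
  rw [← map_natCast (algebraMap k K), Nat.card_eq_fintype_card, Nat.cast_card_eq_zero, map_zero]

/-- The coefficient vectors `a` parametrize the forms `a · (x × x^(q))` through `Z`. -/
def crossFormEquiv (k K : Type u) [Field k] [Finite k] [Field K] [Algebra k K] :
    (Fin 3 → K) ≃ₗ[K] formsThroughZ k K (Nat.card k + 1) :=
  LinearEquiv.ofBijective
    { toFun := fun a => ⟨crossForm (Nat.card k) a, crossForm_mem k K a⟩
      map_add' := fun a b => Subtype.ext <| by
        simp [crossForm, add_mul, Finset.sum_add_distrib]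
      map_smul' := fun c a => Subtype.ext <| by
        simp [crossForm, smul_eq_C_mul, Finset.mul_sum, mul_assoc] }
    ⟨fun a b h => crossForm_injective (natCast_natCard_eq_zero k K) Nat.card_pos.ne'
      (congrArg Subtype.val h), fun F => by
        obtain ⟨a, ha⟩ := exists_eq_crossForm k K F.2
        exact ⟨a, Subtype.ext ha.symm⟩⟩

@[simp] lemma coe_crossFormEquiv (k K : Type u) [Field k] [Finite k] [Field K] [Algebra k K]
    (a : Fin 3 → K) : (crossFormEquiv k K a).1 = crossForm (Nat.card k) a := rfl

lemma finrank_formsThroughZ (k K : Type u) [Field k] [Finite k] [Field K] [Algebra k K] :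
    Module.finrank K (formsThroughZ k K (Nat.card k + 1)) = 2 + 1 := by
  rw [← (crossFormEquiv k K).finrank_eq]
  simp

/-! ### Singular points of the members of the linear system -/

lemma eval_crossForm {K : Type*} [Field K] (q : ℕ) (a x : Fin 3 → K) :
    eval x (crossForm q a) = ∑ i, a i * frobCross q x i := by
  simp [crossForm, map_frobCross]

/-- The gradient of `a · (x × x^(q))` is `x^(q) × a`. -/
lemma isSingularAt_crossForm_iff (k : Type u) {K : Type u} [Field k] [Finite k] [Field K]
    [Algebra k K] (a : Fin 3 → K) (P : Projectivization K (Fin 3 → K)) :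
    IsSingularAt (crossForm (Nat.card k) a) P ↔
      ∀ j, a (j + 2) * P.rep (j + 1) ^ Nat.card k = a (j + 1) * P.rep (j + 2) ^ Nat.card k := by
  simp only [IsSingularAt, pderiv_crossForm (natCast_natCard_eq_zero k K), map_sub, map_mul,
    map_pow, eval_C, eval_X, sub_eq_zero]
  refine and_iff_right_of_imp fun h => ?_
  have h0 := h 0
  have h1 := h 1
  have h2 := h 2
  rw [eval_crossForm]
  simp only [frobCross, Fin.sum_univ_three, Fin.isValue, zero_add, Fin.reduceAdd] at h0 h1 h2 ⊢
  linear_combination P.rep 0 * h0 + P.rep 1 * h1 + P.rep 2 * h2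

lemma exists_smul_eq_of_cross_eq_zero {K : Type*} [Field K] {a b : Fin 3 → K} (ha : a ≠ 0)
    (hb : b ≠ 0) (h : ∀ j, a (j + 2) * b (j + 1) = a (j + 1) * b (j + 2)) :
    ∃ c : Kˣ, c • b = a := by
  obtain ⟨i, hi⟩ : ∃ i, b i ≠ 0 := Function.ne_iff.1 hb
  have hij (j : Fin 3) : a j * b i = a i * b j := by
    have h0 := h 0
    have h1 := h 1
    have h2 := h 2
    simp only [Fin.isValue, zero_add, Fin.reduceAdd] at h0 h1 h2
    fin_cases i <;> fin_cases j <;> simp only [Fin.zero_eta, Fin.mk_one, Fin.reduceFinMk] <;>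
      first | rfl | exact h0 | exact h1 | exact h2 | exact h0.symm | exact h1.symm | exact h2.symm
  have hai : a i ≠ 0 := by
    intro h0
    apply ha
    ext j
    have := hij j
    simpa [h0, hi] using this
  refine ⟨Units.mk0 (a i / b i) (div_ne_zero hai hi), ?_⟩
  ext j
  have := hij j
  simp only [Pi.smul_apply, Units.smul_def, Units.val_mk0, smul_eq_mul]
  field_simp
  linear_combination -this

lemma cross_eq_zero_of_smul {K : Type*} [Field K] {a b : Fin 3 → K} {c : K} (h : a = c • b)
    (j : Fin 3) : a (j + 2) * b (j + 1) = a (j + 1) * b (j + 2) := by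
  subst h
  simp only [Pi.smul_apply, smul_eq_mul]
  ring

/-- The member `a · (x × x^(q)) = 0` of the linear system has the single singular point
`[a^(1/q)]`. -/
lemma exists_singularPoint_equiv (k : Type u) (K : Type u) [Field k] [Finite k] [Field K]
    [Algebra k K] [IsAlgClosed K] :
    ∃ σ : Projectivization K (formsThroughZ k K (Nat.card k + 1)) ≃
        Projectivization K (Fin 3 → K),
      ∀ D P, IsSingularAt D.rep.1 P ↔ P = σ D := by
  set q := Nat.card k with hq
  have hq0 : q ≠ 0 := Nat.card_pos.ne'
  -- the relation in coordinates: the coefficient vector of `D` is proportional to `P^(q)`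
  have key (D : Projectivization K (formsThroughZ k K (q + 1)))
      (P : Projectivization K (Fin 3 → K)) : IsSingularAt D.rep.1 P ↔
        ∃ c : Kˣ, c • (fun i => P.rep i ^ q) = (crossFormEquiv k K).symm D.rep := by
    obtain ⟨a, ha⟩ := (crossFormEquiv k K).surjective D.rep
    have ha0 : a ≠ 0 := fun h => D.rep_nonzero (by rw [← ha, h, map_zero])
    have hP0 : (fun i => P.rep i ^ q) ≠ 0 := by
      intro h
      refine P.rep_nonzero (funext fun i => ?_)
      exact pow_eq_zero_iff hq0 |>.1 (congrFun h i)
    rw [← ha, LinearEquiv.symm_apply_apply, coe_crossFormEquiv, isSingularAt_crossForm_iff k]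
    refine ⟨fun h => exists_smul_eq_of_cross_eq_zero ha0 hP0 h, ?_⟩
    rintro ⟨c, hc⟩
    exact cross_eq_zero_of_smul hc.symm
  have hinj (c x y : K) (h : (c * x) ^ q = y ^ q) : c * x = y := by
    have := sub_pow_natCard k (c * x) y
    rw [← hq, h, sub_self] at this
    exact sub_eq_zero.1 (pow_eq_zero_iff hq0 |>.1 this)
  have hex : ∀ D, ∃! P,
      IsSingularAt (D : Projectivization K (formsThroughZ k K (q + 1))).rep.1 P := by
    intro D
    set a := (crossFormEquiv k K).symm D.rep with ha
    have ha0 : a ≠ 0 := fun h => D.rep_nonzero ((LinearEquiv.map_eq_zero_iff _).1 h)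
    choose b hb using fun i => IsAlgClosed.exists_pow_nat_eq (a i) (Nat.pos_of_ne_zero hq0)
    have hb0 : b ≠ 0 := by
      rintro rfl
      exact ha0 (funext fun i => by rw [← hb i]; simp [hq0])
    refine ⟨Projectivization.mk K b hb0, (key _ _).2 ?_, fun P hP => ?_⟩
    · obtain ⟨c, hc⟩ := Projectivization.exists_smul_eq_mk_rep K b hb0
      refine ⟨(c ^ q)⁻¹, ?_⟩
      ext i
      rw [← hc, ← ha, ← hb i]
      simp [Units.smul_def, mul_pow]
    · obtain ⟨c, hc⟩ := (key _ _).1 hP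
      obtain ⟨d, hd⟩ := IsAlgClosed.exists_pow_nat_eq (c : K) (Nat.pos_of_ne_zero hq0)
      rw [← P.mk_rep, Projectivization.mk_eq_mk_iff']
      have hd0 : d ≠ 0 := by rintro rfl; exact c.ne_zero (by rw [← hd]; simp [hq0])
      refine ⟨d⁻¹, ?_⟩
      ext i
      refine hinj _ _ _ ?_
      have := congrFun hc i
      rw [← ha, ← hb i] at this
      simp only [Pi.smul_apply, Units.smul_def, smul_eq_mul, ← hd] at this
      rw [mul_pow, ← this, ← mul_assoc, ← mul_pow, inv_mul_cancel₀ hd0, one_pow, one_mul]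
  have hex' : ∀ P, ∃! D,
      IsSingularAt (D : Projectivization K (formsThroughZ k K (q + 1))).rep.1 P := by
    intro P
    set b : Fin 3 → K := fun i => P.rep i ^ q with hb
    have hb0 : b ≠ 0 := by
      intro h
      refine P.rep_nonzero (funext fun i => ?_)
      exact pow_eq_zero_iff hq0 |>.1 (congrFun h i)
    have hF0 : crossFormEquiv k K b ≠ 0 := (LinearEquiv.map_ne_zero_iff _).2 hb0
    refine ⟨Projectivization.mk K (crossFormEquiv k K b) hF0, (key _ _).2 ?_, fun D hD => ?_⟩
    · obtain ⟨c, hc⟩ := Projectivization.exists_smul_eq_mk_rep K _ hF0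
      refine ⟨c, ?_⟩
      simp only [← hc, Units.smul_def]
      rw [map_smul, LinearEquiv.symm_apply_apply]
    · obtain ⟨c, hc⟩ := (key _ _).1 hD
      rw [← D.mk_rep, Projectivization.mk_eq_mk_iff]
      refine ⟨c, ?_⟩
      rw [Units.smul_def, ← map_smul, ← Units.smul_def, hb, hc, LinearEquiv.apply_symm_apply]
  refine ⟨Equiv.ofBijective (fun D => (hex D).choose) ⟨fun D D' h => ?_, fun P => ?_⟩, fun D P => ?_⟩
  · refine (hex' (hex D).choose).unique (hex D).choose_spec.1 ?_
    change (hex D).choose = (hex D').choose at h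
    rw [h]
    exact (hex D').choose_spec.1
  · obtain ⟨D, hD, -⟩ := hex' P
    exact ⟨D, ((hex D).choose_spec.2 P hD).symm⟩
  · refine ⟨fun h => (hex D).choose_spec.2 P h, ?_⟩
    rintro rfl
    exact (hex D).choose_spec.1

/-! ### Fractions of forms as regular functions on the plane -/

section Fractions

lemma eval₂_mul_of_isHomogeneous {σ K R : Type*} [CommRing K] [CommRing R] {n : ℕ}
    {G : MvPolynomial σ K} (hG : G.IsHomogeneous n) (f : K →+* R) (u : R) (x : σ → R) :
    eval₂ f (fun i => u * x i) G = u ^ n * eval₂ f x G := by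
  rw [eval₂_eq, eval₂_eq, Finset.mul_sum]
  refine Finset.sum_congr rfl fun m hm => ?_
  have hdeg : m.degree = n := by
    have := hG (mem_support_iff.1 hm)
    rwa [Finsupp.degree_eq_weight_one]
  simp only [mul_pow, Finset.prod_mul_distrib]
  rw [Finset.prod_pow_eq_pow_sum, ← hdeg, Finsupp.degree_apply]
  ring

variable {K : Type u} [Field K]

/-- The homogeneous prime ideal of a point of the plane. -/
def pointIdeal (p : plane K) : Ideal (MvPolynomial (Fin 3) K) :=
  p.asHomogeneousIdeal.toIdeal

instance (p : plane K) : (pointIdeal p).IsPrime := p.isPrime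

/-- The localization of `K[x₀, x₁, x₂]` at the homogeneous prime ideal of a point of the plane. -/
def LocalizationAt (p : plane K) : Type u :=
  Localization (pointIdeal p).primeCompl

instance (p : plane K) : CommRing (LocalizationAt p) :=
  inferInstanceAs (CommRing (Localization _))

/-- The localization map at a point of the plane. -/
def toLocalization (p : plane K) : MvPolynomial (Fin 3) K →+* LocalizationAt p :=
  algebraMap _ (Localization (pointIdeal p).primeCompl)

lemma isUnit_toLocalization_iff (p : plane K) (H : MvPolynomial (Fin 3) K) :
    IsUnit (toLocalization p H) ↔ p ∈ Proj.basicOpen (grading K) H :=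
  IsLocalization.AtPrime.isUnit_to_map_iff (Localization (pointIdeal p).primeCompl) (pointIdeal p) H

/-- The value of a section of the structure sheaf of the plane in the local ring at a point,
as an element of the localization of `K[x₀, x₁, x₂]`. -/
def valueAt {O : (plane K).Opens} (p : plane K) (hp : p ∈ O) :
    Γ(plane K, O) →+* LocalizationAt p :=
  (algebraMap (HomogeneousLocalization (grading K) (pointIdeal p).primeCompl)
    (Localization (pointIdeal p).primeCompl)).comp
    (((plane K).presheaf.germ O p hp ≫ (Proj.stalkIso (grading K) p).hom).hom)

lemma valueAt_ext {O : (plane K).Opens} {s t : Γ(plane K, O)}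
    (h : ∀ (p : plane K) (hp : p ∈ O), valueAt p hp s = valueAt p hp t) : s = t := by
  refine TopCat.Presheaf.section_ext (plane K).sheaf O s t fun p hp => ?_
  have h2 : Function.Injective (Proj.stalkIso (grading K) p).hom :=
    (ConcreteCategory.bijective_of_isIso (Proj.stalkIso (grading K) p).hom).1
  exact h2 (HomogeneousLocalization.val_injective (pointIdeal p).primeCompl (h p hp))

lemma valueAt_map {O O' : (plane K).Opens} (i : O' ⟶ O) (p : plane K) (hp : p ∈ O')
    (s : Γ(plane K, O)) :
    valueAt p hp ((plane K).presheaf.map i.op s) = valueAt p (i.le hp) s := by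
  exact congrArg ((algebraMap (HomogeneousLocalization (grading K) (pointIdeal p).primeCompl)
    (Localization (pointIdeal p).primeCompl)).comp (Proj.stalkIso (grading K) p).hom.hom)
    (TopCat.Presheaf.germ_res_apply (plane K).presheaf i p hp s)

lemma valueAt_fraction {e : ℕ} (H : MvPolynomial (Fin 3) K) (hH : H.IsHomogeneous e) (n : ℕ)
    (G : MvPolynomial (Fin 3) K) (hG : G.IsHomogeneous (n * e)) (p : plane K)
    (hp : p ∈ Proj.basicOpen (grading K) H) :
    valueAt p hp (fraction H hH n G hG) * toLocalization p H ^ n = toLocalization p G := by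
  have h : (Proj.stalkIso (grading K) p).hom ((plane K).presheaf.germ _ p hp
      (fraction H hH n G hG)) = HomogeneousLocalization.mapId (grading K)
        (Submonoid.powers_le.mpr hp)
        (HomogeneousLocalization.Away.mk (grading K) (d := e) hH n G hG) := by
    have h1 := congrArg (fun f => (Proj.stalkIso (grading K) p).hom.hom
      (f.hom (HomogeneousLocalization.Away.mk (grading K) (d := e) hH n G hG)))
      (ProjectiveSpectrum.Proj.awayToSection_germ (grading K) H p hp)
    refine h1.trans ?_
    change ((Proj.stalkIso (grading K) p).inv ≫ (Proj.stalkIso (grading K) p).hom).hom _ = _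
    rw [Iso.inv_hom_id]
    rfl
  have h2 : valueAt p hp (fraction H hH n G hG) = (HomogeneousLocalization.mapId (grading K)
        (Submonoid.powers_le.mpr hp)
        (HomogeneousLocalization.Away.mk (grading K) (d := e) hH n G hG)).val :=
    congrArg HomogeneousLocalization.val h
  have h3 : valueAt p hp (fraction H hH n G hG) = IsLocalization.mk'
      (Localization (pointIdeal p).primeCompl) G
      (⟨H ^ n, (pointIdeal p).primeCompl.pow_mem hp n⟩ : (pointIdeal p).primeCompl) :=
    h2.trans (Localization.mk_eq_mk'_apply _ _)
  rw [h3, ← map_pow]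
  exact IsLocalization.mk'_spec (Localization (pointIdeal p).primeCompl) _ _

lemma valueAt_fraction_eq_iff {e : ℕ} {H : MvPolynomial (Fin 3) K} {hH : H.IsHomogeneous e} {n : ℕ}
    {G : MvPolynomial (Fin 3) K} {hG : G.IsHomogeneous (n * e)} {p : plane K}
    {hp : p ∈ Proj.basicOpen (grading K) H} {z : LocalizationAt p} :
    valueAt p hp (fraction H hH n G hG) = z ↔ toLocalization p G = z * toLocalization p H ^ n := by
  rw [← valueAt_fraction H hH n G hG p hp]
  exact (((isUnit_toLocalization_iff p H).2 hp).pow n).mul_left_inj.symm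

/-- The constants, as functions on `D₊(H)`. -/
def const {e : ℕ} (H : MvPolynomial (Fin 3) K) (hH : H.IsHomogeneous e) :
    K →+* Γ(plane K, Proj.basicOpen (grading K) H) :=
  have key (c : K) (p : plane K) (hp : p ∈ Proj.basicOpen (grading K) H) :
      valueAt p hp (fraction H hH 0 (C c) (by simpa using isHomogeneous_C _ c)) =
        toLocalization p (C c) := by
    rw [valueAt_fraction_eq_iff, pow_zero, mul_one]
  { toFun := fun c => fraction H hH 0 (C c) (by simpa using isHomogeneous_C _ c)
    map_one' := valueAt_ext fun p hp => by rw [key, map_one, map_one, map_one]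
    map_mul' := fun a b => valueAt_ext fun p hp => by
      rw [key]; simp only [map_mul, key]
    map_zero' := valueAt_ext fun p hp => by rw [key, map_zero, map_zero, map_zero]
    map_add' := fun a b => valueAt_ext fun p hp => by
      rw [key]; simp only [map_add, key] }

lemma const_apply {e : ℕ} (H : MvPolynomial (Fin 3) K) (hH : H.IsHomogeneous e) (c : K) :
    const H hH c = fraction H hH 0 (C c) (by simpa using isHomogeneous_C _ c) := rfl

lemma valueAt_const {e : ℕ} (H : MvPolynomial (Fin 3) K) (hH : H.IsHomogeneous e) (c : K)
    (p : plane K) (hp : p ∈ Proj.basicOpen (grading K) H) :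
    valueAt p hp (const H hH c) = toLocalization p (C c) := by
  rw [const_apply, valueAt_fraction_eq_iff, pow_zero, mul_one]

/-- The function `G(s₀, s₁, s₂) / Hⁿ` is the polynomial `G` in the functions `sᵢ / H`. -/
lemma fraction_aeval {e : ℕ} (H : MvPolynomial (Fin 3) K) (hH : H.IsHomogeneous e)
    {s : Fin 3 → MvPolynomial (Fin 3) K} (hs : ∀ i, (s i).IsHomogeneous (1 * e)) {n : ℕ}
    {G : MvPolynomial (Fin 3) K} (hG : G.IsHomogeneous (n * 1))
    (h : (aeval s G).IsHomogeneous (n * e)) :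
    fraction H hH n (aeval s G) h =
      eval₂ (const H hH) (fun i => fraction H hH 1 (s i) (hs i)) G := by
  refine valueAt_ext fun p hp => ?_
  have e2 : (valueAt p hp).comp (const H hH) = (toLocalization p).comp C :=
    RingHom.ext fun c => valueAt_const H hH c p hp
  rw [valueAt_fraction_eq_iff, hom_eval₂, e2, mul_comm,
    ← eval₂_mul_of_isHomogeneous (by rwa [mul_one] at hG), aeval_def, hom_eval₂]
  congr 1
  ext i
  have := valueAt_fraction H hH 1 (s i) (hs i) p hp
  rw [pow_one, mul_comm] at this
  exact this.symm

/-- On `D₊(H) ∩ D₊(H')`, the functions satisfy `G / Hⁿ = (H' / Hⁿ) (G / H')`. -/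
lemma fraction_eq_mul {e e' : ℕ} {H H' : MvPolynomial (Fin 3) K} (hH : H.IsHomogeneous e)
    (hH' : H'.IsHomogeneous e') (n : ℕ) {G : MvPolynomial (Fin 3) K}
    (hG : G.IsHomogeneous (n * e)) (hG' : G.IsHomogeneous (1 * e')) (hHn : H'.IsHomogeneous (n * e))
    {O : (plane K).Opens} (h : O ≤ Proj.basicOpen (grading K) H)
    (h' : O ≤ Proj.basicOpen (grading K) H') :
    (plane K).presheaf.map (homOfLE h).op (fraction H hH n G hG) =
      (plane K).presheaf.map (homOfLE h).op (fraction H hH n H' hHn) *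
        (plane K).presheaf.map (homOfLE h').op (fraction H' hH' 1 G hG') := by
  refine valueAt_ext fun p hp => ?_
  rw [map_mul, valueAt_map, valueAt_map, valueAt_map, valueAt_fraction_eq_iff, mul_right_comm,
    valueAt_fraction, mul_comm]
  have := valueAt_fraction H' hH' 1 G hG' p (h' hp)
  rw [pow_one] at this
  exact this.symm

lemma const_map_eq {e e' : ℕ} {H H' : MvPolynomial (Fin 3) K} (hH : H.IsHomogeneous e)
    (hH' : H'.IsHomogeneous e') {O : (plane K).Opens} (h : O ≤ Proj.basicOpen (grading K) H)
    (h' : O ≤ Proj.basicOpen (grading K) H') (c : K) :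
    (plane K).presheaf.map (homOfLE h).op (const H hH c) =
      (plane K).presheaf.map (homOfLE h').op (const H' hH' c) := by
  refine valueAt_ext fun p hp => ?_
  rw [valueAt_map, valueAt_map, valueAt_const, valueAt_const]

lemma fraction_self {e : ℕ} {H : MvPolynomial (Fin 3) K} (hH : H.IsHomogeneous e) {n m : ℕ}
    (hm : n = m) (h : (H ^ m).IsHomogeneous (n * e)) : fraction H hH n (H ^ m) h = 1 := by
  refine valueAt_ext fun p hp => ?_
  rw [valueAt_fraction_eq_iff, map_one, one_mul, map_pow, hm]

/-- The function `H' / Hⁿ` is invertible exactly on `D₊(H) ∩ D₊(H')`. -/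
lemma basicOpen_fraction {e : ℕ} {H H' : MvPolynomial (Fin 3) K} (hH : H.IsHomogeneous e)
    (n : ℕ) (hH' : H'.IsHomogeneous (n * e)) :
    (plane K).basicOpen (fraction H hH n H' hH') =
      Proj.basicOpen (grading K) H ⊓ Proj.basicOpen (grading K) H' := by
  apply le_antisymm
  · refine le_inf ((plane K).basicOpen_le _) fun p hp => ?_
    have hp' := (plane K).basicOpen_le _ hp
    have hu := (RingedSpace.isUnit_res_basicOpen (plane K).toRingedSpace
      (fraction H hH n H' hH')).map (valueAt p hp)
    rw [← isUnit_toLocalization_iff, ← valueAt_fraction H hH n H' hH' p hp']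
    refine IsUnit.mul ?_ (((isUnit_toLocalization_iff p H).2 hp').pow n)
    rwa [← valueAt_map]
  · intro p hp
    have hp1 := hp.1
    rw [Scheme.mem_basicOpen _ _ _ hp.1]
    have h1 := fraction_eq_mul hH hH' n (G := H ^ n) (by simpa [mul_comm] using hH.pow n)
      (by simpa [mul_comm] using hH.pow n) hH' (O := Proj.basicOpen (grading K) H ⊓
        Proj.basicOpen (grading K) H') inf_le_left inf_le_right
    rw [fraction_self hH rfl, map_one] at h1
    have h2 := (IsUnit.of_mul_eq_one _ h1.symm).map
      ((plane K).presheaf.germ _ p hp).hom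
    have h3 := TopCat.Presheaf.germ_res_apply (plane K).presheaf
      (homOfLE (inf_le_left : Proj.basicOpen (grading K) H ⊓ Proj.basicOpen (grading K) H' ≤ _)) p hp
      (fraction H hH n H' hH')
    rw [← h3]
    exact h2

end Fractions

/-! ### The blow-up as the closure of a graph -/

section Blowup

open Limits

lemma ext_of_isSchemeTheoreticallyDominant {W X Y : Scheme.{u}} {f g : X ⟶ Y} [Y.IsSeparated]
    (ι : W ⟶ X) [IsSchemeTheoreticallyDominant ι] (hU : ι ≫ f = ι ≫ g) : f = g := by
  let X' : Over (⊤_ Scheme.{u}) := Over.mk (terminal.from X)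
  let Y' : Over (⊤_ Scheme.{u}) := Over.mk (terminal.from Y)
  let U' : Over (⊤_ Scheme.{u}) := Over.mk (terminal.from W)
  let f' : X' ⟶ Y' := Over.homMk f (terminal.hom_ext _ _)
  let g' : X' ⟶ Y' := Over.homMk g (terminal.hom_ext _ _)
  let ι' : U' ⟶ X' := Over.homMk ι (terminal.hom_ext _ _)
  have : IsSeparated Y'.hom := inferInstanceAs (IsSeparated (terminal.from Y))
  have hι : ι' ≫ f' = ι' ≫ g' := by ext1; exact hU
  have hl : (equalizer.lift ι' hι).left ≫ (equalizer.ι f' g').left = ι := by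
    rw [← Over.comp_left, equalizer.lift_ι]; rfl
  have hker : (equalizer.ι f' g').left.ker = ⊥ := by
    rw [← le_bot_iff, ← ι.ker_eq_bot]
    conv_rhs => rw [← hl]
    exact Scheme.Hom.le_ker_comp _ _
  have : IsIso (equalizer.ι f' g').left := IsClosedImmersion.isIso_iff_ker_eq_bot.2 hker
  rw [← cancel_epi (equalizer.ι f' g').left]
  exact congr($(equalizer.condition f' g').left)

lemma exists_glue {X P : Scheme.{u}} {J : Type u} (U : J → X.Opens) (hU : ⨆ j, U j = ⊤)
    (h : ∀ j, (U j : Scheme.{u}) ⟶ P)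
    (hh : ∀ i j, X.homOfLE (inf_le_left : U i ⊓ U j ≤ U i) ≫ h i =
      X.homOfLE (inf_le_right : U i ⊓ U j ≤ U j) ≫ h j) :
    ∃ f : X ⟶ P, ∀ j, (U j).ι ≫ f = h j := by
  let 𝒰 := X.openCoverOfIsOpenCover U hU
  refine ⟨𝒰.glueMorphisms h fun i j => ?_, fun j => 𝒰.ι_glueMorphisms _ _ j⟩
  have H : IsPullback (X.homOfLE (inf_le_left : U i ⊓ U j ≤ U i)) (X.homOfLE inf_le_right)
    (𝒰.f i) (𝒰.f j) := isPullback_opens_inf (U i) (U j)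
  refine (cancel_epi H.isoPullback.hom).1 ?_
  have e1 := H.isoPullback_hom_fst
  have e2 := H.isoPullback_hom_snd
  exact ((Category.assoc _ _ _).symm.trans (congrArg (· ≫ h i) e1)).trans ((hh i j).trans
    ((Category.assoc _ _ _).symm.trans (congrArg (· ≫ h j) e2)).symm)

lemma ideal_comap_of_isAffine {X Y : Scheme.{u}} [IsAffine X] [IsAffine Y]
    (I : Y.IdealSheafData) (f : X ⟶ Y) :
    (I.comap f).ideal ⟨⊤, isAffineOpen_top X⟩ =
      (I.ideal ⟨⊤, isAffineOpen_top Y⟩).map f.appTop.hom := by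
  apply le_antisymm
  · let K : X.IdealSheafData := Scheme.IdealSheafData.ofIdealTop
      ((I.ideal ⟨⊤, isAffineOpen_top Y⟩).map f.appTop.hom)
    have hK : K.ideal ⟨⊤, isAffineOpen_top X⟩ =
        (I.ideal ⟨⊤, isAffineOpen_top Y⟩).map f.appTop.hom := by
      simp [K, Scheme.IdealSheafData.ofIdealTop]
    rw [← hK]
    refine Scheme.IdealSheafData.le_map_iff_comap_le.1 ?_ _
    refine Scheme.IdealSheafData.le_of_isAffine ?_
    rw [Scheme.IdealSheafData.ideal_map_of_isAffineHom]
    refine Ideal.map_le_iff_le_comap.1 (le_of_eq hK.symm)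
  · rw [Ideal.map_le_iff_le_comap]
    have h := Scheme.IdealSheafData.le_map_comap I f ⟨⊤, isAffineOpen_top Y⟩
    rwa [Scheme.IdealSheafData.ideal_map_of_isAffineHom] at h

lemma ideal_comap_opens_ι {X : Scheme.{u}} (J : X.IdealSheafData) (V : X.affineOpens)
    [IsAffine V.1] :
    (J.comap V.1.ι).ideal ⟨⊤, isAffineOpen_top V.1.toScheme⟩ = (J.ideal V).map V.1.topIso.inv.hom := by
  rw [Scheme.IdealSheafData.ideal_comap_of_isOpenImmersion, Scheme.Opens.ι_appIso]
  have h : (⟨V.1.ι ''ᵁ ⊤, (isAffineOpen_top V.1.toScheme).image_of_isOpenImmersion V.1.ι⟩ :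
    X.affineOpens) ≤ V := by
    change V.1.ι ''ᵁ ⊤ ≤ V.1
    simp
  exact (J.map_ideal h).symm

/-- On affine opens, the inverse image ideal sheaf is the extension of the ideal. -/
lemma ideal_comap {X Y : Scheme.{u}} (I : Y.IdealSheafData) (f : X ⟶ Y) (V : X.affineOpens)
    (U : Y.affineOpens) (e : V.1 ≤ f ⁻¹ᵁ U.1) :
    (I.comap f).ideal V = (I.ideal U).map (f.appLE U V e).hom := by
  have : IsAffine V.1 := V.2
  have : IsAffine U.1 := U.2
  have h1 := ideal_comap_opens_ι (I.comap f) V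
  have h2 : f.resLE U.1 V.1 e ≫ U.1.ι = V.1.ι ≫ f := Scheme.Hom.resLE_comp_ι _ _
  rw [← Scheme.IdealSheafData.comap_comp, ← h2, Scheme.IdealSheafData.comap_comp,
    ideal_comap_of_isAffine, ideal_comap_opens_ι, Ideal.map_map] at h1
  have h3 := congrArg (Ideal.map V.1.topIso.hom.hom) h1
  rw [Ideal.map_map, Ideal.map_map, ← CommRingCat.hom_comp, ← CommRingCat.hom_comp,
    ← CommRingCat.hom_comp, Iso.inv_hom_id, CommRingCat.hom_id, Ideal.map_id] at h3
  rw [← h3]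
  congr 2
  simp only [Scheme.Hom.appTop, Scheme.Hom.resLE_app_top, Category.assoc,
    Iso.inv_hom_id_assoc, Iso.inv_hom_id, Category.comp_id]

lemma eq_zero_of_restrict_basicOpen_eq_zero {T : Scheme.{u}} {V : T.Opens} (hV : IsAffineOpen V)
    {a : Γ(T, V)} (ha : a ∈ nonZeroDivisors Γ(T, V)) {s : Γ(T, V)} {W : T.Opens}
    (hWV : W ≤ V) (hW : T.basicOpen a ≤ W)
    (hs : T.presheaf.map (homOfLE hWV).op s = 0) : s = 0 := by
  have h1 : T.presheaf.map (homOfLE (T.basicOpen_le a)).op s = 0 := by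
    have : T.presheaf.map (homOfLE hW).op (T.presheaf.map (homOfLE hWV).op s) = 0 := by
      rw [hs, map_zero]
    rwa [← CommRingCat.comp_apply, ← Functor.map_comp] at this
  have := hV.isLocalization_basicOpen a
  obtain ⟨⟨m, n, rfl⟩, hm⟩ := (IsLocalization.map_eq_zero_iff (Submonoid.powers a)
    Γ(T, T.basicOpen a) s).1 h1
  exact (mem_nonZeroDivisors_iff.1 (pow_mem ha n)).1 s hm

/-- The complement of an effective Cartier divisor is scheme-theoretically dense: a function that
vanishes on it is killed by a power of the nonzerodivisor that defines the divisor. -/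
lemma IsInvertibleIdeal.isSchemeTheoreticallyDominant {T : Scheme.{u}} {J : T.IdealSheafData}
    (hJ : IsInvertibleIdeal J) (O : T.Opens) (hO : (O : Set T) = (J.support : Set T)ᶜ) :
    IsSchemeTheoreticallyDominant O.ι := by
  choose V hxV a ha hJV using hJ
  refine ⟨le_bot_iff.1 (Scheme.IdealSheafData.le_of_iSup_eq_top V (top_le_iff.1 fun x _ => ?_)
    fun x s hs => ?_)⟩
  · exact TopologicalSpace.Opens.mem_iSup.2 ⟨x, hxV x⟩
  · have h1 := Scheme.Hom.ideal_ker_le O.ι (V x) hs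
    rw [RingHom.mem_ker, Scheme.Opens.ι_app] at h1
    refine eq_zero_of_restrict_basicOpen_eq_zero (V x).2 (ha x) _ ?_ h1
    intro y hy
    have hyV := T.basicOpen_le _ hy
    have : y ∈ O := by
      have : y ∈ (J.support : Set T)ᶜ := by
        intro h
        have := (Scheme.IdealSheafData.mem_support_iff_of_mem hyV).1 h
        rw [hJV, Scheme.zeroLocus_span, Scheme.mem_zeroLocus_iff] at this
        exact this _ rfl hy
      rwa [← hO] at this
    exact ⟨⟨y, this⟩, hyV, rfl⟩

lemma isSchemeTheoreticallyDominant_toImage {X Y : Scheme.{u}} (f : X ⟶ Y) [QuasiCompact f] :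
    IsSchemeTheoreticallyDominant f.toImage := by
  have hV (V : Y.affineOpens) : IsAffineOpen (f.imageι ⁻¹ᵁ V.1) := V.2.preimage f.imageι
  refine ⟨le_bot_iff.1 (Scheme.IdealSheafData.le_of_iSup_eq_top
    (fun V : Y.affineOpens => ⟨f.imageι ⁻¹ᵁ V.1, hV V⟩) ?_ fun V s hs => ?_)⟩
  · refine top_le_iff.1 fun x _ => ?_
    have hx : f.imageι x ∈ (⨆ V : Y.affineOpens, V.1) := by
      rw [iSup_affineOpens_eq_top]; trivial
    obtain ⟨V, hxV⟩ := TopologicalSpace.Opens.mem_iSup.1 hx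
    exact TopologicalSpace.Opens.mem_iSup.2 ⟨V, hxV⟩
  · have h1 := Scheme.Hom.ideal_ker_le f.toImage ⟨f.imageι ⁻¹ᵁ V.1, hV V⟩ hs
    exact f.toImage_app_injective V (h1.trans (map_zero _).symm)

/-- Suppose that a morphism `f : T ⟶ S` makes the inverse image of `I` invertible exactly when
`f⁻¹(U)` is scheme-theoretically dense in `T` and `ψ ∘ f` extends from `f⁻¹(U)` to `T`, where `U`
is the complement of the support of `I`. Then the scheme-theoretic closure of the graph of `ψ` in
`S × P` is the blow-up of `I`. -/
lemma exists_isBlowup {S P : Scheme.{u}} [S.IsSeparated] [P.IsSeparated] (I : S.IdealSheafData)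
    (U : S.Opens) (hU : (U : Set S) = (I.support : Set S)ᶜ) [QuasiCompact U.ι]
    (ψ : (U : Scheme.{u}) ⟶ P)
    (hext : ∀ (T : Scheme.{u}) (f : T ⟶ S), IsInvertibleIdeal (I.comap f) →
      ∃ h : T ⟶ P, (f ⁻¹ᵁ U).ι ≫ h = (f ∣_ U) ≫ ψ)
    (hinv : ∀ (T : Scheme.{u}) (f : T ⟶ S) (h : T ⟶ P),
      IsSchemeTheoreticallyDominant (f ⁻¹ᵁ U).ι → (f ⁻¹ᵁ U).ι ≫ h = (f ∣_ U) ≫ ψ →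
        IsInvertibleIdeal (I.comap f)) :
    ∃ (B : Scheme.{u}) (π : B ⟶ S), IsBlowup π I ∧
      ∃ ψB : B ⟶ P, (π ⁻¹ᵁ U).ι ≫ ψB = (π ∣_ U) ≫ ψ := by
  let SP := pullback (terminal.from S) (terminal.from P)
  let p₁ : SP ⟶ S := pullback.fst _ _
  let p₂ : SP ⟶ P := pullback.snd _ _
  let γ : (U : Scheme.{u}) ⟶ SP := pullback.lift U.ι ψ (terminal.hom_ext _ _)
  have hγ₁ : γ ≫ p₁ = U.ι := pullback.lift_fst _ _ _
  have hγ₂ : γ ≫ p₂ = ψ := pullback.lift_snd _ _ _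
  have : IsSeparated p₁ := inferInstanceAs (IsSeparated (pullback.fst _ _))
  have : QuasiCompact γ := by
    have : QuasiCompact (γ ≫ p₁) := by rw [hγ₁]; infer_instance
    exact QuasiCompact.of_comp γ p₁
  let π : γ.image ⟶ S := γ.imageι ≫ p₁
  let ψB : γ.image ⟶ P := γ.imageι ≫ p₂
  have hj : IsSchemeTheoreticallyDominant γ.toImage :=
    isSchemeTheoreticallyDominant_toImage γ
  have hπ : γ.toImage ≫ π = U.ι := by simp [π, hγ₁]
  have hψB : γ.toImage ≫ ψB = ψ := by simp [ψB, hγ₂]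
  -- The section `γ.toImage` of the projection over `U` is scheme-theoretically dominant, so it is
  -- an isomorphism onto the inverse image of `U`.
  have hsec : (π ⁻¹ᵁ U).ι = (π ∣_ U) ≫ γ.toImage := by
    have : γ.image.IsSeparated :=
      ⟨by rw [← terminal.comp_from (π)]; infer_instance⟩
    refine ext_of_isSchemeTheoreticallyDominant (pullback.snd γ.toImage (π ⁻¹ᵁ U).ι) ?_
    rw [← pullback.condition, ← Category.assoc]
    congr 1
    rw [← cancel_mono U.ι, Category.assoc, morphismRestrict_ι, ← pullback.condition_assoc, hπ]
  have hdom : IsSchemeTheoreticallyDominant (π ⁻¹ᵁ U).ι := by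
    have hr : Set.range γ.toImage ⊆ Set.range (π ⁻¹ᵁ U).ι := by
      rintro _ ⟨x, rfl⟩
      rw [Scheme.Opens.range_ι]
      change π (γ.toImage x) ∈ U
      rw [← Scheme.Hom.comp_apply, hπ]
      exact x.2
    refine ⟨le_bot_iff.1 ?_⟩
    rw [← hj.ker_eq_bot, ← IsOpenImmersion.lift_fac (π ⁻¹ᵁ U).ι γ.toImage hr]
    exact Scheme.Hom.le_ker_comp _ _
  have hagree : (π ⁻¹ᵁ U).ι ≫ ψB = (π ∣_ U) ≫ ψ := by
    rw [hsec, Category.assoc, hψB]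
  refine ⟨γ.image, π, ⟨hinv _ π ψB hdom hagree, fun T f hf => ?_⟩, ψB, hagree⟩
  obtain ⟨h, hh⟩ := hext T f hf
  have hdomT : IsSchemeTheoreticallyDominant (f ⁻¹ᵁ U).ι := by
    refine hf.isSchemeTheoreticallyDominant _ ?_
    rw [Scheme.IdealSheafData.support_comap]
    change f ⁻¹' U = _
    rw [hU]; rfl
  let l : T ⟶ SP := pullback.lift f h (terminal.hom_ext _ _)
  have hl₁ : l ≫ p₁ = f := pullback.lift_fst _ _ _
  have hl₂ : l ≫ p₂ = h := pullback.lift_snd _ _ _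
  have hl : (f ⁻¹ᵁ U).ι ≫ l = (f ∣_ U) ≫ γ := by
    apply pullback.hom_ext
    · change (_ ≫ l) ≫ p₁ = (_ ≫ γ) ≫ p₁
      rw [Category.assoc, Category.assoc, hl₁, hγ₁, morphismRestrict_ι]
    · change (_ ≫ l) ≫ p₂ = (_ ≫ γ) ≫ p₂
      rw [Category.assoc, Category.assoc, hl₂, hγ₂, hh]
  have hker : γ.imageι.ker ≤ l.ker := by
    have h1 : l.ker = ((f ⁻¹ᵁ U).ι ≫ l).ker := by
      rw [Scheme.Hom.ker_comp, hdomT.ker_eq_bot, Scheme.IdealSheafData.map_bot]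
    rw [h1, hl, Scheme.Hom.imageι, Scheme.IdealSheafData.ker_subschemeι]
    exact Scheme.Hom.le_ker_comp _ _
  refine ⟨IsClosedImmersion.lift γ.imageι l hker, ?_, fun g' hg' => ?_⟩
  · change _ ≫ γ.imageι ≫ p₁ = f
    rw [IsClosedImmersion.lift_fac_assoc, hl₁]
  · rw [← cancel_mono γ.imageι, IsClosedImmersion.lift_fac]
    apply pullback.hom_ext
    · change (_ ≫ γ.imageι) ≫ p₁ = l ≫ p₁
      rw [hl₁, Category.assoc]; exact hg'
    · change (_ ≫ γ.imageι) ≫ p₂ = l ≫ p₂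
      rw [hl₂, Category.assoc]
      refine ext_of_isSchemeTheoreticallyDominant (f ⁻¹ᵁ U).ι ?_
      rw [hh]
      change (f ⁻¹ᵁ U).ι ≫ g' ≫ ψB = _
      subst hg'
      have h1 : (g' ⁻¹ᵁ π ⁻¹ᵁ U).ι ≫ g' ≫ ψB = (g' ∣_ π ⁻¹ᵁ U) ≫ (π ∣_ U) ≫ ψ := by
        have := morphismRestrict_ι_assoc g' (π ⁻¹ᵁ U) ψB
        rw [← this, hagree]
      refine h1.trans ?_
      rw [← Category.assoc]
      exact congrArg (· ≫ ψ) (morphismRestrict_comp g' π U).symm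

end Blowup

/-! ### Morphisms to the plane in coordinates -/

section Charts

lemma ι_comp_eq_of_appLE_eq {X P : Scheme.{u}} {D : P.Opens} (hD : IsAffineOpen D) {O : X.Opens}
    {f g : X ⟶ P} (hf : O ≤ f ⁻¹ᵁ D) (hg : O ≤ g ⁻¹ᵁ D) (h : f.appLE D O hf = g.appLE D O hg) :
    O.ι ≫ f = O.ι ≫ g := by
  have : IsAffine D := hD
  rw [← Scheme.Hom.resLE_comp_ι f hf, ← Scheme.Hom.resLE_comp_ι g hg]
  congr 1
  apply ext_of_isAffine
  rw [Scheme.Hom.appTop, Scheme.Hom.appTop, Scheme.Hom.resLE_app_top, Scheme.Hom.resLE_app_top, h]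

lemma exists_hom_appLE_eq {X P : Scheme.{u}} {D : P.Opens} (hD : IsAffineOpen D) (O : X.Opens)
    (φ : Γ(P, D) →+* Γ(X, O)) :
    ∃ (h : (O : Scheme.{u}) ⟶ P) (e : ⊤ ≤ h ⁻¹ᵁ D), ∀ t,
      h.appLE D ⊤ e t = O.topIso.inv (φ t) := by
  let α : Γ(P, D) ⟶ Γ(X, O) := CommRingCat.ofHom φ
  have e0 : ⊤ ≤ hD.fromSpec ⁻¹ᵁ D := hD.fromSpec_preimage_self.ge
  have e : (⊤ : O.toScheme.Opens) ≤ ((O.toSpecΓ ≫ Spec.map α) ≫ hD.fromSpec) ⁻¹ᵁ D := by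
    rw [Scheme.Hom.comp_preimage, hD.fromSpec_preimage_self]; exact le_rfl
  refine ⟨(O.toSpecΓ ≫ Spec.map α) ≫ hD.fromSpec, e, fun t => ?_⟩
  suffices h : ((O.toSpecΓ ≫ Spec.map α) ≫ hD.fromSpec).appLE D ⊤ e = α ≫ O.topIso.inv by
    rw [h]; rfl
  have h1 : hD.fromSpec.appLE D ⊤ e0 = (Scheme.ΓSpecIso Γ(P, D)).inv := by
    rw [Scheme.Hom.appLE, hD.fromSpec_app_self, Category.assoc, ← Functor.map_comp,
      Subsingleton.elim ((eqToHom _).op ≫ (homOfLE e0).op) (𝟙 _), CategoryTheory.Functor.map_id,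
      Category.comp_id]
  rw [← Scheme.Hom.appLE_comp_appLE _ _ D ⊤ ⊤ e0 le_top, h1,
    ← Scheme.Hom.appLE_comp_appLE _ _ ⊤ ⊤ ⊤ le_top le_top]
  have h2 (A B : Scheme.{u}) (f : A ⟶ B) : f.appLE ⊤ ⊤ le_top = f.appTop := f.appLE_eq_app
  rw [h2, h2, Scheme.Opens.toSpecΓ_appTop, ← Category.assoc, ← Scheme.ΓSpecIso_inv_naturality,
    Category.assoc, Iso.inv_hom_id_assoc]

variable {K : Type u} [Field K]

/-- The morphism `f` maps the open set `O` into the chart `D₊(xᵢ)`, the functions `aₘ` on `O` are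
the pullbacks of the coordinates `xₘ / xᵢ`, and `φ` is the pullback of the constants. No structure
morphism to `Spec K` is fixed on `S`; the map `φ` takes its place. -/
def HasCoordinates {S : Scheme.{u}} (f : S ⟶ plane K) (O : S.Opens) (i : Fin 3)
    (φ : K →+* Γ(S, O)) (a : Fin 3 → Γ(S, O)) : Prop :=
  ∃ e : O ≤ f ⁻¹ᵁ Proj.basicOpen (grading K) (X i),
    (∀ c, f.appLE _ O e (const (X i) (isHomogeneous_X K i) c) = φ c) ∧
      ∀ m, f.appLE _ O e (fraction (X i) (isHomogeneous_X K i) 1 (X m) (isHomogeneous_X K m)) = a m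

lemma fraction_X_eq_eval₂ {e : ℕ} {H : MvPolynomial (Fin 3) K} (hH : H.IsHomogeneous e)
    (he : e = 1) {n : ℕ}
    {G : MvPolynomial (Fin 3) K} (hG : G.IsHomogeneous (n * e)) :
    fraction H hH n G hG = eval₂ (const H hH)
      (fun m => fraction H hH 1 (X m) (by subst he; exact isHomogeneous_X K m)) G := by
  subst he
  have h := fraction_aeval H hH (s := X) (fun m => isHomogeneous_X K m) hG
    (by rw [aeval_X_left_apply]; exact hG)
  rw [← h]
  congr
  rw [aeval_X_left_apply]

lemma HasCoordinates.appLE_fraction {S : Scheme.{u}} {f : S ⟶ plane K} {O : S.Opens} {i : Fin 3}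
    {φ : K →+* Γ(S, O)} {a : Fin 3 → Γ(S, O)} (h : HasCoordinates f O i φ a)
    (e : O ≤ f ⁻¹ᵁ Proj.basicOpen (grading K) (X i)) (n : ℕ) (G : MvPolynomial (Fin 3) K)
    (hG : G.IsHomogeneous (n * 1)) :
    (f.appLE _ O e).hom (fraction (X i) (isHomogeneous_X K i) n G hG) = eval₂ φ a G := by
  obtain ⟨_, h1, h2⟩ := h
  rw [fraction_X_eq_eval₂ _ rfl, hom_eval₂]
  congr 1
  · exact RingHom.ext h1
  · exact funext h2

lemma HasCoordinates.comp {S Y : Scheme.{u}} {f : S ⟶ plane K} {O : S.Opens} {i : Fin 3}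
    {φ : K →+* Γ(S, O)} {a : Fin 3 → Γ(S, O)} (h : HasCoordinates f O i φ a) (g : Y ⟶ S)
    {W : Y.Opens} (e : W ≤ g ⁻¹ᵁ O) :
    HasCoordinates (g ≫ f) W i ((g.appLE O W e).hom.comp φ) (fun m => g.appLE O W e (a m)) := by
  obtain ⟨e', h1, h2⟩ := h
  have e2 : W ≤ (g ≫ f) ⁻¹ᵁ Proj.basicOpen (grading K) (X i) :=
    show W ≤ g ⁻¹ᵁ (f ⁻¹ᵁ _) from e.trans (g.preimage_mono e')
  have key : (g ≫ f).appLE _ W e2 =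
    f.appLE _ O e' ≫ g.appLE O W e := (Scheme.Hom.appLE_comp_appLE _ _ _ _ _ _ _).symm
  refine ⟨e2, fun c => ?_, fun m => ?_⟩
  · rw [key, CommRingCat.comp_apply, h1]; rfl
  · rw [key, CommRingCat.comp_apply, h2]

/-- The ring homomorphism `G / xᵢⁿ ↦ G(a₀, a₁, a₂)` on the functions on the chart `D₊(xᵢ)`, for
`aᵢ = 1` and a given homomorphism `φ` on the constants. -/
def chartHom {R : Type*} [CommRing R] (φ : K →+* R) (a : Fin 3 → R) (i : Fin 3) (ha : a i = 1) :
    Γ(plane K, Proj.basicOpen (grading K) (X i)) →+* R :=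
  ((IsLocalization.Away.lift (S := Localization.Away (X i : MvPolynomial (Fin 3) K)) (X i)
    (g := eval₂Hom φ a) (by simp [ha])).comp
    (algebraMap (HomogeneousLocalization.Away (grading K) (X i)) (Localization.Away (X i)))).comp
    (Proj.basicOpenIsoAway (grading K) (X i) (isHomogeneous_X K i) Nat.one_pos).inv.hom

lemma chartHom_fraction {R : Type*} [CommRing R] (φ : K →+* R) (a : Fin 3 → R) (i : Fin 3)
    (ha : a i = 1) (n : ℕ) (G : MvPolynomial (Fin 3) K) (hG : G.IsHomogeneous (n * 1)) :
    chartHom φ a i ha (fraction (X i) (isHomogeneous_X K i) n G hG) = eval₂ φ a G := by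
  have h1 : (Proj.basicOpenIsoAway (grading K) (X i) (isHomogeneous_X K i) Nat.one_pos).inv.hom
      (fraction (X i) (isHomogeneous_X K i) n G hG) =
      HomogeneousLocalization.Away.mk (grading K) (d := 1) (isHomogeneous_X K i) n G hG :=
    congrArg (fun r => r.hom (HomogeneousLocalization.Away.mk (grading K) (d := 1)
      (isHomogeneous_X K i) n G hG))
      (Proj.basicOpenIsoAway (grading K) (X i) (isHomogeneous_X K i) Nat.one_pos).hom_inv_id
  have h2 : HomogeneousLocalization.val (HomogeneousLocalization.Away.mk (grading K) (d := 1)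
      (isHomogeneous_X K i) n G hG) = IsLocalization.mk' (Localization.Away (X i)) G
        (⟨X i ^ n, n, rfl⟩ : Submonoid.powers (X i : MvPolynomial (Fin 3) K)) := by
    rw [← Localization.mk_eq_mk']
    rfl
  rw [chartHom, RingHom.comp_apply, h1, RingHom.comp_apply, HomogeneousLocalization.algebraMap_apply]
  refine (congrArg _ h2).trans ?_
  rw [IsLocalization.Away.lift, IsLocalization.lift_mk'_spec]
  simp [ha]

lemma exists_hasCoordinates {S : Scheme.{u}} (O : S.Opens) (φ : K →+* Γ(S, O))
    (a : Fin 3 → Γ(S, O)) (i : Fin 3) (ha : a i = 1) :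
    ∃ h : (O : Scheme.{u}) ⟶ plane K,
      HasCoordinates h ⊤ i (O.topIso.inv.hom.comp φ) (fun m => O.topIso.inv (a m)) := by
  obtain ⟨h, e, he⟩ := exists_hom_appLE_eq
    (show IsAffineOpen (Proj.basicOpen (grading K) (X i)) from (chart K i).2) O
    (chartHom φ a i ha)
  refine ⟨h, e, fun c => ?_, fun m => ?_⟩
  · rw [he, const_apply, chartHom_fraction]
    simp
  · rw [he, chartHom_fraction]
    simp

lemma exists_eq_fraction (i : Fin 3) (t : Γ(plane K, Proj.basicOpen (grading K) (X i))) :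
    ∃ (n : ℕ) (G : MvPolynomial (Fin 3) K) (hG : G.IsHomogeneous (n * 1)),
      t = fraction (X i) (isHomogeneous_X K i) n G hG := by
  obtain ⟨t, rfl⟩ := (ConcreteCategory.bijective_of_isIso (Proj.basicOpenIsoAway (grading K) (X i)
    (isHomogeneous_X K i) Nat.one_pos).hom).2 t
  obtain ⟨n, G, hG, rfl⟩ := HomogeneousLocalization.Away.mk_surjective (grading K)
    (isHomogeneous_X K i) t
  exact ⟨n, G, hG, rfl⟩

lemma ringHom_ext_chart {R : Type*} [CommRing R] {i : Fin 3}
    {α β : Γ(plane K, Proj.basicOpen (grading K) (X i)) →+* R}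
    (h1 : ∀ c, α (const (X i) (isHomogeneous_X K i) c) = β (const (X i) (isHomogeneous_X K i) c))
    (h2 : ∀ m, α (fraction (X i) (isHomogeneous_X K i) 1 (X m) (isHomogeneous_X K m)) =
      β (fraction (X i) (isHomogeneous_X K i) 1 (X m) (isHomogeneous_X K m))) : α = β := by
  refine RingHom.ext fun t => ?_
  obtain ⟨n, G, hG, rfl⟩ := exists_eq_fraction i t
  rw [fraction_X_eq_eval₂ _ rfl, hom_eval₂, hom_eval₂]
  congr 1
  · exact RingHom.ext h1
  · exact funext h2

lemma ι_appLE_top {S : Scheme.{u}} (O : S.Opens) (e : ⊤ ≤ O.ι ⁻¹ᵁ O) :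
    O.ι.appLE O ⊤ e = O.topIso.inv := by
  simp only [Scheme.Hom.appLE, Scheme.Opens.ι_app, Scheme.Opens.topIso_inv]
  refine (S.presheaf.map_comp _ _).symm.trans ?_
  congr 1

lemma homOfLE_appLE_topIso_inv {S : Scheme.{u}} {W O : S.Opens} (e : W ≤ O)
    (h : ⊤ ≤ (S.homOfLE e) ⁻¹ᵁ ⊤) :
    O.topIso.inv ≫ (S.homOfLE e).appLE ⊤ ⊤ h =
      S.presheaf.map (homOfLE e).op ≫ W.topIso.inv := by
  have e1 : (⊤ : O.toScheme.Opens) ≤ O.ι ⁻¹ᵁ O := by simp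
  have e2 : (⊤ : W.toScheme.Opens) ≤ W.ι ⁻¹ᵁ W := by simp
  rw [← ι_appLE_top O e1, ← ι_appLE_top W e2, Scheme.Hom.appLE_comp_appLE, Scheme.Hom.map_appLE]
  simp only [Scheme.homOfLE_ι]

lemma fraction_one_self {e : ℕ} {H : MvPolynomial (Fin 3) K} (hH : H.IsHomogeneous e)
    (h : H.IsHomogeneous (1 * e)) : fraction H hH 1 H h = 1 :=
  valueAt_ext fun p hp => by rw [valueAt_fraction_eq_iff, map_one, one_mul, pow_one]

lemma HasCoordinates.apply_self {S : Scheme.{u}} {f : S ⟶ plane K} {O : S.Opens} {i : Fin 3}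
    {φ : K →+* Γ(S, O)} {a : Fin 3 → Γ(S, O)} (h : HasCoordinates f O i φ a) : a i = 1 := by
  obtain ⟨e, -, h2⟩ := h
  rw [← h2, fraction_one_self, map_one]

lemma le_preimage_basicOpen_of_isUnit {S T : Scheme.{u}} (f : S ⟶ T) {O : S.Opens} {V : T.Opens}
    (e : O ≤ f ⁻¹ᵁ V) (t : Γ(T, V)) (h : IsUnit (f.appLE V O e t)) : O ≤ f ⁻¹ᵁ T.basicOpen t := by
  have h1 := Scheme.basicOpen_appLE f O V e t
  rw [Scheme.basicOpen_of_isUnit _ h] at h1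
  exact inf_eq_left.1 h1.symm

lemma appLE_const_eq {S : Scheme.{u}} (f : S ⟶ plane K) {e e' : ℕ} {H H' : MvPolynomial (Fin 3) K}
    (hH : H.IsHomogeneous e) (hH' : H'.IsHomogeneous e') {W : S.Opens}
    (h : W ≤ f ⁻¹ᵁ Proj.basicOpen (grading K) H) (h' : W ≤ f ⁻¹ᵁ Proj.basicOpen (grading K) H')
    (c : K) : f.appLE _ W h (const H hH c) = f.appLE _ W h' (const H' hH' c) := by
  have hle : W ≤ f ⁻¹ᵁ (Proj.basicOpen (grading K) H ⊓ Proj.basicOpen (grading K) H') :=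
    fun x hx => ⟨h hx, h' hx⟩
  rw [← Scheme.Hom.map_appLE f hle (homOfLE inf_le_left).op,
    ← Scheme.Hom.map_appLE f hle (homOfLE inf_le_right).op, CommRingCat.comp_apply,
    CommRingCat.comp_apply]
  exact congrArg _ (const_map_eq _ _ _ _ c)

lemma appLE_fraction_eq_mul {S : Scheme.{u}} (f : S ⟶ plane K) {e e' : ℕ}
    {H H' : MvPolynomial (Fin 3) K} (hH : H.IsHomogeneous e) (hH' : H'.IsHomogeneous e') (n : ℕ)
    {G : MvPolynomial (Fin 3) K} (hG : G.IsHomogeneous (n * e)) (hG' : G.IsHomogeneous (1 * e'))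
    (hHn : H'.IsHomogeneous (n * e)) {W : S.Opens}
    (h : W ≤ f ⁻¹ᵁ Proj.basicOpen (grading K) H) (h' : W ≤ f ⁻¹ᵁ Proj.basicOpen (grading K) H') :
    f.appLE _ W h (fraction H hH n G hG) =
      f.appLE _ W h (fraction H hH n H' hHn) * f.appLE _ W h' (fraction H' hH' 1 G hG') := by
  have hle : W ≤ f ⁻¹ᵁ (Proj.basicOpen (grading K) H ⊓ Proj.basicOpen (grading K) H') :=
    fun x hx => ⟨h hx, h' hx⟩
  have h3 := congrArg (f.appLE _ W hle) (fraction_eq_mul hH hH' n hG hG' hHn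
    (O := Proj.basicOpen (grading K) H ⊓ Proj.basicOpen (grading K) H') inf_le_left inf_le_right)
  rw [map_mul, ← CommRingCat.comp_apply, ← CommRingCat.comp_apply, ← CommRingCat.comp_apply,
    Scheme.Hom.map_appLE, Scheme.Hom.map_appLE] at h3
  exact h3

lemma HasCoordinates.change {S : Scheme.{u}} {f : S ⟶ plane K} {O : S.Opens} {i j : Fin 3}
    {φ : K →+* Γ(S, O)} {a : Fin 3 → Γ(S, O)} (h : HasCoordinates f O i φ a) {u : Γ(S, O)}
    (hu : u * a j = 1) : HasCoordinates f O j φ (fun m => u * a m) := by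
  obtain ⟨e, h1, h2⟩ := h
  have hle : O ≤ f ⁻¹ᵁ (Proj.basicOpen (grading K) (X i) ⊓ Proj.basicOpen (grading K) (X j)) := by
    rw [← basicOpen_fraction (isHomogeneous_X K i) 1 (isHomogeneous_X K j)]
    refine le_preimage_basicOpen_of_isUnit f e _ ?_
    rw [h2]
    exact .of_mul_eq_one_right _ hu
  have e' : O ≤ f ⁻¹ᵁ Proj.basicOpen (grading K) (X j) :=
    hle.trans (f.preimage_mono inf_le_right)
  refine ⟨e', fun c => ?_, fun m => ?_⟩
  · rw [← h1]
    exact appLE_const_eq f _ _ e' e c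
  · have h3 := appLE_fraction_eq_mul f (isHomogeneous_X K i) (isHomogeneous_X K j) 1
      (isHomogeneous_X K m) (isHomogeneous_X K m) (isHomogeneous_X K j) e e'
    rw [h2, h2] at h3
    change _ = u * a m
    rw [h3, ← mul_assoc, hu, one_mul]

/-- Proportional homogeneous coordinates define the same morphism. -/
lemma HasCoordinates.ι_comp_eq {S : Scheme.{u}} {f g : S ⟶ plane K} {O : S.Opens} {i j : Fin 3}
    {φ : K →+* Γ(S, O)} {a b : Fin 3 → Γ(S, O)} (hf : HasCoordinates f O i φ a)
    (hg : HasCoordinates g O j φ b) (u : Γ(S, O)) (hu : ∀ m, b m = u * a m) :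
    O.ι ≫ f = O.ι ≫ g := by
  have hu1 : u * a j = 1 := by rw [← hu, hg.apply_self]
  obtain ⟨ef, hf1, hf2⟩ := hf.change hu1
  obtain ⟨eg, hg1, hg2⟩ := hg
  refine ι_comp_eq_of_appLE_eq (show IsAffineOpen (Proj.basicOpen (grading K) (X j)) from
    (chart K j).2) ef eg (CommRingCat.hom_ext (ringHom_ext_chart (fun c => ?_) fun m => ?_))
  · exact (hf1 c).trans (hg1 c).symm
  · exact (hf2 m).trans ((hu m).symm.trans (hg2 m).symm)

lemma HasCoordinates.of_ι_comp {S : Scheme.{u}} {f : S ⟶ plane K} {O : S.Opens} {i : Fin 3}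
    {φ : K →+* Γ(S, O)} {a : Fin 3 → Γ(S, O)}
    (h : HasCoordinates (O.ι ≫ f) ⊤ i (O.topIso.inv.hom.comp φ) (fun m => O.topIso.inv (a m))) :
    HasCoordinates f O i φ a := by
  obtain ⟨e, h1, h2⟩ := h
  have e' : O ≤ f ⁻¹ᵁ Proj.basicOpen (grading K) (X i) := fun x hx => e (x := ⟨x, hx⟩) trivial
  have e1 : (⊤ : O.toScheme.Opens) ≤ O.ι ⁻¹ᵁ O := by simp
  have hinj : Function.Injective O.topIso.inv :=
    (ConcreteCategory.bijective_of_isIso O.topIso.inv).1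
  have key : (O.ι ≫ f).appLE (Proj.basicOpen (grading K) (X i)) ⊤ e =
      f.appLE _ O e' ≫ O.topIso.inv := by
    rw [← ι_appLE_top O e1, Scheme.Hom.appLE_comp_appLE]
  refine ⟨e', fun c => hinj ?_, fun m => hinj ?_⟩
  · rw [← CommRingCat.comp_apply, ← key, h1]; rfl
  · rw [← CommRingCat.comp_apply, ← key, h2]

lemma HasCoordinates.homOfLE_comp {S : Scheme.{u}} {W O : S.Opens} (e : W ≤ O)
    {h : (O : Scheme.{u}) ⟶ plane K} {i : Fin 3} {φ : K →+* Γ(S, O)} {a : Fin 3 → Γ(S, O)}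
    (H : HasCoordinates h ⊤ i (O.topIso.inv.hom.comp φ) (fun m => O.topIso.inv (a m))) :
    HasCoordinates (S.homOfLE e ≫ h) ⊤ i
      (W.topIso.inv.hom.comp ((S.presheaf.map (homOfLE e).op).hom.comp φ))
      (fun m => W.topIso.inv (S.presheaf.map (homOfLE e).op (a m))) := by
  have h1 := H.comp (S.homOfLE e) (W := ⊤) le_top
  have key := homOfLE_appLE_topIso_inv e le_top
  convert h1 using 1
  · rw [← RingHom.comp_assoc, ← CommRingCat.hom_comp, ← key]; rfl
  · funext m
    rw [← CommRingCat.comp_apply, ← key]; rfl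

/-- Morphisms to the plane given by coordinates on the members of an open cover glue if the
homogeneous coordinates are proportional on the overlaps. -/
lemma exists_hasCoordinates_of_cover {S : Scheme.{u}} {J : Type u} (O : J → S.Opens)
    (hO : ⨆ j, O j = ⊤) (i : J → Fin 3) (φ : ∀ j, K →+* Γ(S, O j)) (a : ∀ j, Fin 3 → Γ(S, O j))
    (ha : ∀ j, a j (i j) = 1)
    (hφ : ∀ j l c, S.presheaf.map (homOfLE (inf_le_left : O j ⊓ O l ≤ O j)).op (φ j c) =
      S.presheaf.map (homOfLE (inf_le_right : O j ⊓ O l ≤ O l)).op (φ l c))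
    (hu : ∀ j l, ∃ u : Γ(S, O j ⊓ O l), ∀ m,
      S.presheaf.map (homOfLE (inf_le_right : O j ⊓ O l ≤ O l)).op (a l m) =
        u * S.presheaf.map (homOfLE (inf_le_left : O j ⊓ O l ≤ O j)).op (a j m)) :
    ∃ f : S ⟶ plane K, ∀ j, HasCoordinates f (O j) (i j) (φ j) (a j) := by
  choose h hh using fun j => exists_hasCoordinates (O j) (φ j) (a j) (i j) (ha j)
  obtain ⟨f, hf⟩ := exists_glue O hO h fun j l => by
    obtain ⟨u, hu⟩ := hu j l
    have : IsIso (Scheme.Opens.ι (⊤ : ((O j ⊓ O l : S.Opens) : Scheme.{u}).Opens)) :=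
      (Scheme.topIso _).isIso_hom
    refine (cancel_epi (Scheme.Opens.ι (⊤ : ((O j ⊓ O l : S.Opens) : Scheme.{u}).Opens))).1 ?_
    have h1 := (hh j).homOfLE_comp (inf_le_left : O j ⊓ O l ≤ O j)
    have h2 := (hh l).homOfLE_comp (inf_le_right : O j ⊓ O l ≤ O l)
    have h3 : (S.presheaf.map (homOfLE (inf_le_left : O j ⊓ O l ≤ O j)).op).hom.comp (φ j) =
      (S.presheaf.map (homOfLE (inf_le_right : O j ⊓ O l ≤ O l)).op).hom.comp (φ l) :=
      RingHom.ext (hφ j l)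
    rw [h3] at h1
    refine h1.ι_comp_eq h2 ((O j ⊓ O l).topIso.inv u) fun m => ?_
    rw [← map_mul, ← hu]
  refine ⟨f, fun j => .of_ι_comp ?_⟩
  rw [hf]
  exact hh j

end Charts

/-! ### The base locus -/

section BaseLocus

lemma exists_X_notMem {K : Type u} [Field K] (x : plane K) :
    ∃ m, (X m : MvPolynomial (Fin 3) K) ∉ pointIdeal x := by
  by_contra! h
  refine x.not_irrelevant_le fun F hF => ?_
  change F ∈ pointIdeal x
  rw [HomogeneousIdeal.mem_irrelevant_iff] at hF
  have hF0 : coeff 0 F = 0 := by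
    have h1 : homogeneousComponent 0 F = 0 :=
      (MvPolynomial.decomposition.decompose'_apply F 0).symm.trans hF
    rw [homogeneousComponent_zero, C_eq_zero] at h1
    exact h1
  have h2 : F ∈ Ideal.span (Set.range (X : Fin 3 → MvPolynomial (Fin 3) K)) := by
    rw [← Set.image_univ, mem_ideal_span_X_image]
    intro m hm
    by_contra! h3
    have : m = 0 := by ext i; exact h3 i trivial
    exact mem_support_iff.1 hm (this ▸ hF0)
  exact (Ideal.span_le.2 (by rintro _ ⟨i, rfl⟩; exact h i)) h2

variable {k : Type u} [Field k] [Finite k]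

lemma mem_rationalPoints_iff (x : plane k) :
    x ∈ rationalPoints k ↔ ∀ i, frobCross (Nat.card k) X i ∈ pointIdeal x := by
  have := Fintype.ofFinite k
  let ξ : Fin 3 → MvPolynomial (Fin 3) k ⧸ pointIdeal x := fun j => Ideal.Quotient.mk _ (X j)
  have h1 (i : Fin 3) : frobCross (Nat.card k) X i ∈ pointIdeal x ↔
      frobCross (Nat.card k) ξ i = 0 := by
    rw [← Ideal.Quotient.eq_zero_iff_mem, map_frobCross]
  have h2 (v : Fin 3 → k) (i j : Fin 3) : (C (v i) * X j - C (v j) * X i : MvPolynomial (Fin 3) k) ∈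
      pointIdeal x ↔ v i • ξ j = v j • ξ i := by
    rw [← Ideal.Quotient.eq_zero_iff_mem, map_sub, sub_eq_zero, ← smul_eq_C_mul, ← smul_eq_C_mul]
    rfl
  obtain ⟨m, hm⟩ := exists_X_notMem x
  have hm' : ξ m ≠ 0 := fun h => hm (Ideal.Quotient.eq_zero_iff_mem.1 h)
  change (∃ v : Fin 3 → k, v ≠ 0 ∧ ∀ i j,
    (C (v i) * X j - C (v j) * X i : MvPolynomial (Fin 3) k) ∈ pointIdeal x) ↔ _
  simp only [h1, h2]
  constructor
  · rintro ⟨v, hv, h⟩ i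
    obtain ⟨l, hl⟩ := Function.ne_iff.1 hv
    have hξ : ξ = fun j => ((v l)⁻¹ • ξ l) * algebraMap k _ (v j) := by
      funext j
      rw [mul_comm, ← Algebra.smul_def, smul_comm, ← h l j, smul_smul, inv_mul_cancel₀ hl, one_smul]
    rw [hξ, frobCross_smul]
    simp only [frobCross, ← map_pow, Nat.card_eq_fintype_card, FiniteField.pow_card]
    ring
  · intro h
    have hpair (i j : Fin 3) : ξ i ^ Nat.card k * ξ j = ξ i * ξ j ^ Nat.card k := by
      simp only [frobCross, sub_eq_zero] at h
      have e0 := h 0; have e1 := h 1; have e2 := h 2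
      simp only [Fin.isValue, zero_add, Fin.reduceAdd] at e0 e1 e2
      fin_cases i <;> fin_cases j <;> simp only [Fin.zero_eta, Fin.mk_one, Fin.reduceFinMk] <;>
        first | ring1 | linear_combination e0 | linear_combination e1 | linear_combination e2 |
          linear_combination -e0 | linear_combination -e1 | linear_combination -e2
    choose c hc using fun j => (eq_zero_or_exists_smul k (hpair j m)).resolve_left hm'
    refine ⟨c, fun h0 => hm' ?_, fun i j => ?_⟩
    · rw [hc m, h0]; simp
    · rw [hc j, hc i, smul_smul, smul_smul, mul_comm]

lemma frobCross_X_mem_formsThroughZ (i : Fin 3) :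
    frobCross (Nat.card k) X i ∈ formsThroughZ k k (Nat.card k + 1) := by
  have := crossForm_mem k k (Pi.single i 1)
  simpa [crossForm, Pi.single_apply] using this

lemma forall_mem_formsThroughZ_iff (I : Ideal (MvPolynomial (Fin 3) k)) :
    (∀ F ∈ formsThroughZ k k (Nat.card k + 1), F ∈ I) ↔ ∀ i, frobCross (Nat.card k) X i ∈ I := by
  refine ⟨fun h i => h _ (frobCross_X_mem_formsThroughZ i), fun h F hF => ?_⟩
  obtain ⟨a, rfl⟩ := exists_eq_crossForm k k hF
  exact Ideal.sum_mem _ fun i _ => Ideal.mul_mem_left _ _ (h i)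

lemma baseLocus_formsThroughZ :
    baseLocus (formsThroughZ k k (Nat.card k + 1)) = (rationalPoints k : Set (plane k)) := by
  ext x
  exact (forall_mem_formsThroughZ_iff (pointIdeal x)).trans (mem_rationalPoints_iff x).symm

lemma vanishingIdeal_ideal_eq {S : Scheme.{u}} {U : S.Opens} (hU : IsAffineOpen U)
    (Z : TopologicalSpace.Closeds S) {J : Ideal Γ(S, U)} (hJ : J.IsRadical)
    (h : ∀ x ∈ U, x ∈ Z ↔ ∀ t ∈ J, x ∉ S.basicOpen t) :
    (Scheme.IdealSheafData.vanishingIdeal Z).ideal ⟨U, hU⟩ = J := by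
  have hzero : hU.fromSpec ⁻¹' (Z : Set S) = PrimeSpectrum.zeroLocus (J : Set Γ(S, U)) := by
    ext y
    have hy : hU.fromSpec y ∈ U := by
      have : hU.fromSpec y ∈ Set.range hU.fromSpec := ⟨y, rfl⟩
      rwa [hU.range_fromSpec] at this
    rw [Set.mem_preimage, SetLike.mem_coe, h _ hy]
    refine forall₂_congr fun t _ => ?_
    have h1 : y ∈ hU.fromSpec ⁻¹ᵁ S.basicOpen t ↔ y ∈ PrimeSpectrum.basicOpen t := by
      rw [← hU.fromSpec_preimage_basicOpen]; exact Iff.rfl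
    exact not_iff_comm.1 (show ¬ t ∈ y.asIdeal ↔ hU.fromSpec y ∈ S.basicOpen t from h1.symm)
  change PrimeSpectrum.vanishingIdeal (hU.fromSpec ⁻¹' (Z : Set S)) = J
  refine (congrArg PrimeSpectrum.vanishingIdeal hzero).trans ?_
  rw [PrimeSpectrum.vanishingIdeal_zeroLocus_eq_radical, hJ.radical]

lemma pow_sub_self_mem_span (i m : Fin 3) : ∃ F ∈ formsThroughZ k k (Nat.card k + 1),
    ∃ hF : F.IsHomogeneous ((Nat.card k + 1) * 1),
      fraction (X i) (isHomogeneous_X k i) 1 (X m) (isHomogeneous_X k m) ^ Nat.card k -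
        fraction (X i) (isHomogeneous_X k i) 1 (X m) (isHomogeneous_X k m) =
      fraction (X i) (isHomogeneous_X k i) (Nat.card k + 1) F hF := by
  have := Fintype.ofFinite k
  have h (i j : Fin 3) : (X i ^ Nat.card k * X j : MvPolynomial (Fin 3) k).IsHomogeneous
      (Nat.card k + 1) := by
    have := ((isHomogeneous_X k i).pow (Nat.card k)).mul (isHomogeneous_X k j)
    rwa [one_mul] at this
  refine ⟨X m ^ Nat.card k * X i - X i ^ Nat.card k * X m,
    ⟨(homogeneousSubmodule (Fin 3) k _).sub_mem (h m i) (h i m), fun v _ => ?_⟩, ?_, ?_⟩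
  · simp [FiniteField.pow_card, mul_comm]
  · rw [mul_one]
    exact (homogeneousSubmodule (Fin 3) k _).sub_mem (h m i) (h i m)
  · refine valueAt_ext fun p hp => ?_
    have key := valueAt_fraction (X i) (isHomogeneous_X k i) 1 (X m) (isHomogeneous_X k m) p hp
    symm
    rw [valueAt_fraction_eq_iff]
    simp only [map_sub, map_mul, map_pow, ← key]
    ring

lemma isBaseIdeal_idealZ : IsBaseIdeal (Nat.card k + 1) (formsThroughZ k k (Nat.card k + 1))
    (idealZ k) := by
  have := Fintype.ofFinite k
  intro i
  set q := Nat.card k with hq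
  set W := formsThroughZ k k (q + 1)
  set J : Ideal Γ(plane k, Proj.basicOpen (grading k) (X i)) := Ideal.span
    {t | ∃ F ∈ W, ∃ hF : F.IsHomogeneous ((q + 1) * 1),
      t = fraction (X i) (isHomogeneous_X k i) (q + 1) F hF} with hJ
  -- The Frobenius map of the quotient by `J` fixes the constants and the coordinates, hence is the
  -- identity. So the quotient is reduced.
  have hpow (t : Γ(plane k, Proj.basicOpen (grading k) (X i))) : t ^ q - t ∈ J := by
    let R := Γ(plane k, Proj.basicOpen (grading k) (X i)) ⧸ J
    let φ : k →+* R := (Ideal.Quotient.mk J).comp (const (X i) (isHomogeneous_X k i))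
    let _ : Algebra k R := φ.toAlgebra
    obtain ⟨n, G, hG, rfl⟩ := exists_eq_fraction i t
    rw [← Ideal.Quotient.eq_zero_iff_mem, map_sub, sub_eq_zero, map_pow, fraction_X_eq_eval₂ _ rfl,
      hom_eval₂]
    let ξ : Fin 3 → R := fun m => Ideal.Quotient.mk J (fraction (X i) (isHomogeneous_X k i) 1 (X m)
      (isHomogeneous_X k m))
    change aeval ξ G ^ q = aeval ξ G
    rw [hq, aeval_pow_natCard]
    congr 2
    funext m
    obtain ⟨F, hFW, hF, h⟩ := pow_sub_self_mem_span (k := k) i m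
    rw [← map_pow, ← sub_eq_zero, ← map_sub, h]
    exact Ideal.Quotient.eq_zero_iff_mem.2 (Ideal.subset_span ⟨F, hFW, hF, rfl⟩)
  have hrad : J.IsRadical := by
    rw [Ideal.isRadical_iff_pow_one_lt q Finite.one_lt_card]
    intro r hr
    have := J.sub_mem hr (hpow r)
    rwa [sub_sub_cancel] at this
  refine vanishingIdeal_ideal_eq (show IsAffineOpen (Proj.basicOpen (grading k) (X i)) from
    (chart k i).2) _ hrad fun x hx => ?_
  have hb : x ∈ rationalPoints k ↔ ∀ F ∈ W, F ∈ pointIdeal x := by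
    rw [← SetLike.mem_coe, ← baseLocus_formsThroughZ]; rfl
  rw [hb]
  have key (F : MvPolynomial (Fin 3) k) (hF : F.IsHomogeneous ((q + 1) * 1)) :
      F ∈ pointIdeal x ↔
        x ∉ (plane k).basicOpen (fraction (X i) (isHomogeneous_X k i) (q + 1) F hF) := by
    rw [basicOpen_fraction, ← not_iff_not, not_not]
    exact ⟨fun h => ⟨hx, h⟩, fun h => h.2⟩
  refine ⟨fun h => (Scheme.mem_zeroLocus_iff _ _ _).1 ?_, fun h F hFW => ?_⟩
  · rw [hJ, Scheme.zeroLocus_span, Scheme.mem_zeroLocus_iff]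
    rintro _ ⟨F, hFW, hF, rfl⟩
    exact (key F hF).1 (h F hFW)
  · have hF : F.IsHomogeneous ((q + 1) * 1) := by rw [mul_one]; exact hFW.1
    exact (key F hF).2 (h _ (Ideal.subset_span ⟨F, hFW, hF, rfl⟩))

end BaseLocus

/-! ### The morphism given by forms -/

section MorphismOfForms

lemma hom_ext_of_cover {S P : Scheme.{u}} {J : Type u} (O : J → S.Opens) (hO : ⨆ j, O j = ⊤)
    {f g : S ⟶ P} (h : ∀ j, (O j).ι ≫ f = (O j).ι ≫ g) : f = g :=
  (S.openCoverOfIsOpenCover O hO).hom_ext _ _ h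

variable {K : Type u} [Field K] {d : ℕ} {s : Fin 3 → MvPolynomial (Fin 3) K}

/-- The function `sₘ / sⱼ` on `D₊(sⱼ)`. -/
def ratio (hs : ∀ i, (s i).IsHomogeneous d) (j m : Fin 3) :
    Γ(plane K, Proj.basicOpen (grading K) (s j)) :=
  fraction (s j) (hs j) 1 (s m) (by rw [one_mul]; exact hs m)

/-- The function `sₘ / xᵢᵈ` on the chart `D₊(xᵢ)`. -/
def localEquation (hs : ∀ i, (s i).IsHomogeneous d) (i m : Fin 3) :
    Γ(plane K, Proj.basicOpen (grading K) (X i)) :=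
  fraction (X i) (isHomogeneous_X K i) d (s m) (by rw [mul_one]; exact hs m)

lemma appLE_localEquation (hs : ∀ i, (s i).IsHomogeneous d) {S : Scheme.{u}} (f : S ⟶ plane K)
    {W : S.Opens} (i j m : Fin 3) (h : W ≤ f ⁻¹ᵁ Proj.basicOpen (grading K) (X i))
    (h' : W ≤ f ⁻¹ᵁ Proj.basicOpen (grading K) (s j)) :
    f.appLE _ W h (localEquation hs i m) =
      f.appLE _ W h (localEquation hs i j) * f.appLE _ W h' (ratio hs j m) :=
  appLE_fraction_eq_mul f _ _ _ _ _ _ h h'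

lemma appLE_ratio (hs : ∀ i, (s i).IsHomogeneous d) {S : Scheme.{u}} (f : S ⟶ plane K)
    {W : S.Opens} (i j m : Fin 3) (h : W ≤ f ⁻¹ᵁ Proj.basicOpen (grading K) (s i))
    (h' : W ≤ f ⁻¹ᵁ Proj.basicOpen (grading K) (s j)) :
    f.appLE _ W h (ratio hs i m) =
      f.appLE _ W h (ratio hs i j) * f.appLE _ W h' (ratio hs j m) :=
  appLE_fraction_eq_mul f _ _ _ _ _ _ h h'

lemma basicOpen_appLE_localEquation (hs : ∀ i, (s i).IsHomogeneous d) {S : Scheme.{u}}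
    (f : S ⟶ plane K) {W : S.Opens} (i m : Fin 3)
    (h : W ≤ f ⁻¹ᵁ Proj.basicOpen (grading K) (X i)) :
    S.basicOpen (f.appLE _ W h (localEquation hs i m)) =
      W ⊓ f ⁻¹ᵁ Proj.basicOpen (grading K) (s m) := by
  rw [Scheme.basicOpen_appLE, localEquation, basicOpen_fraction]
  refine le_antisymm (inf_le_inf_left _ (f.preimage_mono inf_le_right)) ?_
  exact le_inf inf_le_left fun x hx => ⟨h hx.1, hx.2⟩

lemma HasCoordinates.congr {S : Scheme.{u}} {f : S ⟶ plane K} {O : S.Opens} {i : Fin 3}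
    {φ φ' : K →+* Γ(S, O)} {a a' : Fin 3 → Γ(S, O)} (h : HasCoordinates f O i φ a)
    (hφ : ∀ c, φ c = φ' c) (ha : ∀ m, a m = a' m) : HasCoordinates f O i φ' a' := by
  rwa [← RingHom.ext hφ, ← funext ha]

lemma HasCoordinates.apply_eq {S : Scheme.{u}} {f : S ⟶ plane K} {O : S.Opens} {i : Fin 3}
    {φ φ' : K →+* Γ(S, O)} {a a' : Fin 3 → Γ(S, O)} (h : HasCoordinates f O i φ a)
    (h' : HasCoordinates f O i φ' a') (m : Fin 3) : a m = a' m := by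
  obtain ⟨_, -, h⟩ := h
  obtain ⟨_, -, h'⟩ := h'
  rw [← h, ← h']

/-- `ψ` is the morphism `x ↦ [s₀(x) : s₁(x) : s₂(x)]` on `U`, expressed by the coordinates
`sₘ / sⱼ` on the open sets `U ∩ D₊(sⱼ)`. In contrast to `IsMorphismOfForms`, only the constants and
the coordinates are required to have the right pullbacks. -/
def IsGivenBy (hs : ∀ i, (s i).IsHomogeneous d) (U : (plane K).Opens)
    (ψ : (U : Scheme.{u}) ⟶ plane K) : Prop :=
  ∀ j, HasCoordinates ψ (U.ι ⁻¹ᵁ Proj.basicOpen (grading K) (s j)) j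
    ((U.ι.app _).hom.comp (const (s j) (hs j))) fun m => U.ι.app _ (ratio hs j m)

lemma IsMorphismOfForms.isGivenBy {hs : ∀ i, (s i).IsHomogeneous d} {U : (plane K).Opens}
    {ψ : (U : Scheme.{u}) ⟶ plane K} (h : IsMorphismOfForms s hs U ψ) : IsGivenBy hs U ψ := by
  intro j
  obtain ⟨e, h⟩ := h j
  refine ⟨e.le, fun c => ?_, fun m => ?_⟩
  · have := h 0 (C c) (by simpa using isHomogeneous_C _ c)
    rw [const_apply]
    refine this.trans (congrArg (U.ι.app _).hom ?_)
    rw [const_apply]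
    congr 1
    exact aeval_C _ _
  · refine (h 1 (X m) (isHomogeneous_X K m)).trans (congrArg (U.ι.app _).hom ?_)
    rw [ratio]
    congr 1
    exact aeval_X _ _

lemma IsGivenBy.comp {hs : ∀ i, (s i).IsHomogeneous d} {U : (plane K).Opens}
    {ψ : (U : Scheme.{u}) ⟶ plane K} (h : IsGivenBy hs U ψ) {S : Scheme.{u}} (f : S ⟶ U)
    {W : S.Opens} (j : Fin 3) (e : W ≤ (f ≫ U.ι) ⁻¹ᵁ Proj.basicOpen (grading K) (s j)) :
    HasCoordinates (f ≫ ψ) W j (((f ≫ U.ι).appLE _ W e).hom.comp (const (s j) (hs j)))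
      fun m => (f ≫ U.ι).appLE _ W e (ratio hs j m) := by
  have e' : W ≤ f ⁻¹ᵁ (U.ι ⁻¹ᵁ Proj.basicOpen (grading K) (s j)) := e
  have key : (f ≫ U.ι).appLE _ W e = U.ι.app _ ≫ f.appLE _ W e' := by
    rw [Scheme.Hom.app_eq_appLE, Scheme.Hom.appLE_comp_appLE]
  refine ((h j).comp f e').congr (fun c => ?_) fun m => ?_
  · rw [key]; rfl
  · rw [key]; rfl

lemma IsGivenBy.preimage_basicOpen {hs : ∀ i, (s i).IsHomogeneous d} {U : (plane K).Opens}
    (hU : U ≤ ⨆ j, Proj.basicOpen (grading K) (s j))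
    {ψ : (U : Scheme.{u}) ⟶ plane K} (h : IsGivenBy hs U ψ) (i : Fin 3) :
    U.ι ⁻¹ᵁ Proj.basicOpen (grading K) (s i) = ψ ⁻¹ᵁ Proj.basicOpen (grading K) (X i) := by
  obtain ⟨e, -, -⟩ := h i
  refine le_antisymm e fun x hx => ?_
  obtain ⟨j, hj⟩ := TopologicalSpace.Opens.mem_iSup.1 (hU x.2)
  obtain ⟨ej, -, hj2⟩ := h j
  have h1 := congrArg (fun t => x ∈ U.toScheme.basicOpen t) (hj2 i)
  rw [Scheme.Hom.app_eq_appLE] at h1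
  simp only [Scheme.basicOpen_appLE, ratio, basicOpen_fraction] at h1
  exact ((h1.mp ⟨hj, ej hj, hx⟩).2).2

lemma IsGivenBy.isMorphismOfForms {hs : ∀ i, (s i).IsHomogeneous d} {U : (plane K).Opens}
    (hU : U ≤ ⨆ j, Proj.basicOpen (grading K) (s j))
    {ψ : (U : Scheme.{u}) ⟶ plane K} (h : IsGivenBy hs U ψ) : IsMorphismOfForms s hs U ψ := by
  intro i
  refine ⟨h.preimage_basicOpen hU i, fun n G hG => ?_⟩
  rw [(h i).appLE_fraction, fraction_aeval (s i) (hs i) (fun m => by rw [one_mul]; exact hs m) hG,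
    hom_eval₂]
  rfl

lemma IsGivenBy.eq {hs : ∀ i, (s i).IsHomogeneous d} {U : (plane K).Opens}
    (hU : U ≤ ⨆ j, Proj.basicOpen (grading K) (s j))
    {ψ ψ' : (U : Scheme.{u}) ⟶ plane K} (h : IsGivenBy hs U ψ) (h' : IsGivenBy hs U ψ') :
    ψ' = ψ := by
  refine hom_ext_of_cover (fun j : ULift.{u} (Fin 3) =>
    U.ι ⁻¹ᵁ Proj.basicOpen (grading K) (s j.down)) (top_le_iff.1 fun x _ => ?_) fun j => ?_
  · obtain ⟨j, hj⟩ := TopologicalSpace.Opens.mem_iSup.1 (hU x.2)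
    exact TopologicalSpace.Opens.mem_iSup.2 ⟨⟨j⟩, hj⟩
  · exact (h' j.down).ι_comp_eq (h j.down) 1 fun m => (one_mul _).symm

lemma exists_isGivenBy (hs : ∀ i, (s i).IsHomogeneous d) {U : (plane K).Opens}
    (hU : U ≤ ⨆ j, Proj.basicOpen (grading K) (s j)) :
    ∃ ψ : (U : Scheme.{u}) ⟶ plane K, IsGivenBy hs U ψ := by
  have hcov : ⨆ j : ULift.{u} (Fin 3), U.ι ⁻¹ᵁ Proj.basicOpen (grading K) (s j.down) = ⊤ := by
    refine top_le_iff.1 fun x _ => ?_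
    obtain ⟨j, hj⟩ := TopologicalSpace.Opens.mem_iSup.1 (hU x.2)
    exact TopologicalSpace.Opens.mem_iSup.2 ⟨⟨j⟩, hj⟩
  have key {j : Fin 3} {W : U.toScheme.Opens} (e : W ≤ U.ι ⁻¹ᵁ Proj.basicOpen (grading K) (s j))
      (t : Γ(plane K, Proj.basicOpen (grading K) (s j))) :
      U.toScheme.presheaf.map (homOfLE e).op (U.ι.app _ t) = U.ι.appLE _ W e t := by
    rw [Scheme.Hom.appLE]; rfl
  obtain ⟨ψ, hψ⟩ := exists_hasCoordinates_of_cover _ hcov (fun j => j.down)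
    (fun j => (U.ι.app _).hom.comp (const (s j.down) (hs j.down)))
    (fun j m => U.ι.app _ (ratio hs j.down m))
    (fun j => by rw [ratio, fraction_one_self, map_one])
    (fun j l c => (key inf_le_left _).trans ((appLE_const_eq U.ι _ _ inf_le_left inf_le_right c).trans
      (key inf_le_right _).symm))
    (fun j l => ⟨U.ι.appLE _ _ inf_le_right (ratio hs l.down j.down), fun m => by
      rw [key inf_le_left, key inf_le_right]
      exact appLE_ratio hs U.ι l.down j.down m inf_le_right inf_le_left⟩)
  exact ⟨ψ, fun j => hψ ⟨j⟩⟩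

end MorphismOfForms

/-! ### Extension of the morphism and invertible inverse images -/

section Extension

lemma IsInvertibleIdeal.exists_affine_le {T : Scheme.{u}} {J : T.IdealSheafData}
    (hJ : IsInvertibleIdeal J) (x : T) {W : T.Opens} (hx : x ∈ W) :
    ∃ V : T.affineOpens, x ∈ V.1 ∧ V.1 ≤ W ∧
      ∃ a ∈ nonZeroDivisors Γ(T, V.1), J.ideal V = Ideal.span {a} := by
  obtain ⟨V, hxV, a, ha, haV⟩ := hJ x
  obtain ⟨r, hr, hxr⟩ := V.2.exists_basicOpen_le ⟨x, hx⟩ hxV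
  refine ⟨T.affineBasicOpen r, hxr, hr, T.presheaf.map (homOfLE (T.basicOpen_le r)).op a, ?_, ?_⟩
  · have := V.2.isLocalization_basicOpen r
    exact IsLocalization.map_nonZeroDivisors_le (Submonoid.powers r) Γ(T, T.basicOpen r)
      ⟨a, ha, rfl⟩
  · rw [← J.map_ideal (T.affineBasicOpen_le r), haV, Ideal.map_span, Set.image_singleton]
    rfl

/-- If an invertible ideal is generated by three functions `gₘ`, then near each point one of them
divides the others. -/
lemma exists_affine_generator {T : Scheme.{u}} {J : T.IdealSheafData} (hJ : IsInvertibleIdeal J)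
    {W : T.Opens} (g : Fin 3 → Γ(T, W))
    (hg : ∀ (V : T.affineOpens) (e : V.1 ≤ W), J.ideal V =
      Ideal.span (Set.range fun m => T.presheaf.map (homOfLE e).op (g m))) (x : T) (hx : x ∈ W) :
    ∃ (V : T.Opens) (e : V ≤ W) (j : Fin 3) (a : Fin 3 → Γ(T, V)), x ∈ V ∧ a j = 1 ∧
      ∀ m, T.presheaf.map (homOfLE e).op (g m) = T.presheaf.map (homOfLE e).op (g j) * a m := by
  obtain ⟨V, hxV, hVW, a, ha, haV⟩ := hJ.exists_affine_le x hx
  have h1 := hg V hVW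
  rw [haV] at h1
  have h2 (m : Fin 3) : ∃ h, T.presheaf.map (homOfLE hVW).op (g m) = a * h := by
    have : T.presheaf.map (homOfLE hVW).op (g m) ∈ Ideal.span {a} := by
      rw [h1]; exact Ideal.subset_span ⟨m, rfl⟩
    exact Ideal.mem_span_singleton.1 this
  choose h hh using h2
  have h3 : ∃ c : Fin 3 → Γ(T, V.1), ∑ m, c m * h m = 1 := by
    have : a ∈ Ideal.span (Set.range fun m => T.presheaf.map (homOfLE hVW).op (g m)) := by
      rw [← h1]; exact Ideal.mem_span_singleton_self a
    obtain ⟨c, hc⟩ := Ideal.mem_span_range_iff_exists_fun.1 this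
    refine ⟨c, ?_⟩
    have h4 : (∑ m, c m * h m - 1) * a = 0 := by
      rw [sub_mul, one_mul, sub_eq_zero, Finset.sum_mul]
      conv_rhs => rw [← hc]
      exact Finset.sum_congr rfl fun m _ => by rw [hh]; ring
    exact sub_eq_zero.1 ((mem_nonZeroDivisors_iff.1 ha).2 _ h4)
  obtain ⟨c, hc⟩ := h3
  have h5 : ∃ j, x ∈ T.basicOpen (h j) := by
    by_contra! hcon
    have hm (m : Fin 3) : T.presheaf.germ V.1 x hxV (h m) ∈
        IsLocalRing.maximalIdeal (T.presheaf.stalk x) := by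
      rw [IsLocalRing.mem_maximalIdeal, mem_nonunits_iff, ← Scheme.mem_basicOpen]
      exact hcon m
    have h6 := congrArg (T.presheaf.germ V.1 x hxV) hc
    rw [map_sum, map_one] at h6
    refine (Ideal.ne_top_iff_one _).1
      (IsLocalRing.maximalIdeal.isMaximal (T.presheaf.stalk x)).ne_top ?_
    rw [← h6]
    refine Ideal.sum_mem _ fun m _ => ?_
    rw [map_mul]
    exact Ideal.mul_mem_left _ _ (hm m)
  obtain ⟨j, hj⟩ := h5
  have hle := T.basicOpen_le (h j)
  let r := T.presheaf.map (homOfLE hle).op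
  have hunit : IsUnit (r (h j)) := RingedSpace.isUnit_res_basicOpen T.toRingedSpace (h j)
  obtain ⟨w, hw⟩ := hunit.exists_left_inv
  refine ⟨T.basicOpen (h j), hle.trans hVW, j, fun m => w * r (h m), hj, hw, fun m => ?_⟩
  have h7 (m : Fin 3) : T.presheaf.map (homOfLE (hle.trans hVW)).op (g m) = r a * r (h m) := by
    rw [← map_mul, ← hh, ← CommRingCat.comp_apply, ← Functor.map_comp]; rfl
  rw [h7, h7]
  linear_combination (-(r a * r (h m))) * hw

lemma isUnit_appLE_of_le_preimage_basicOpen {S T : Scheme.{u}} (f : S ⟶ T) {O : S.Opens}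
    {V : T.Opens} (e : O ≤ f ⁻¹ᵁ V) (t : Γ(T, V)) (h : O ≤ f ⁻¹ᵁ T.basicOpen t) :
    IsUnit (f.appLE V O e t) := by
  rw [← Scheme.Hom.map_appLE f h (homOfLE (T.basicOpen_le t)).op, CommRingCat.comp_apply]
  exact (show IsUnit (T.presheaf.map (homOfLE (T.basicOpen_le t)).op t) from
    RingedSpace.isUnit_res_basicOpen T.toRingedSpace t).map _

variable {K : Type u} [Field K] {d : ℕ} {s : Fin 3 → MvPolynomial (Fin 3) K}

lemma isUnit_appLE_localEquation (hs : ∀ i, (s i).IsHomogeneous d) {S : Scheme.{u}}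
    (f : S ⟶ plane K) {W : S.Opens} {i j : Fin 3} (h : W ≤ f ⁻¹ᵁ Proj.basicOpen (grading K) (X i))
    (e : W ≤ f ⁻¹ᵁ Proj.basicOpen (grading K) (s j)) :
    IsUnit (f.appLE _ W h (localEquation hs i j)) := by
  refine isUnit_appLE_of_le_preimage_basicOpen f h _ ?_
  rw [localEquation, basicOpen_fraction]
  exact fun x hx => ⟨h hx, e hx⟩

/-- If `sⱼ` divides the other forms on `W` and the `sₘ` have no common zero there, then `sⱼ` is
nonzero on `W`, and the quotients are the functions `sₘ / sⱼ`. -/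
lemma eq_appLE_ratio {hs : ∀ i, (s i).IsHomogeneous d} {S : Scheme.{u}} (f : S ⟶ plane K)
    {W : S.Opens} {i j : Fin 3} (h : W ≤ f ⁻¹ᵁ Proj.basicOpen (grading K) (X i))
    {a : Fin 3 → Γ(S, W)} (ha : ∀ m, f.appLE _ W h (localEquation hs i m) =
      f.appLE _ W h (localEquation hs i j) * a m)
    (hW : W ≤ f ⁻¹ᵁ ⨆ j, Proj.basicOpen (grading K) (s j)) :
    ∃ e : W ≤ f ⁻¹ᵁ Proj.basicOpen (grading K) (s j), ∀ m, a m = f.appLE _ W e (ratio hs j m) := by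
  have e : W ≤ f ⁻¹ᵁ Proj.basicOpen (grading K) (s j) := by
    intro x hx
    obtain ⟨l, hl⟩ := TopologicalSpace.Opens.mem_iSup.1 (hW hx)
    have h1 : x ∈ S.basicOpen (f.appLE _ W h (localEquation hs i l)) := by
      rw [basicOpen_appLE_localEquation]; exact ⟨hx, hl⟩
    rw [ha, Scheme.basicOpen_mul, basicOpen_appLE_localEquation] at h1
    exact h1.1.2
  refine ⟨e, fun m => ?_⟩
  have hu := isUnit_appLE_localEquation hs f h e
  exact hu.mul_left_cancel ((ha m).symm.trans (appLE_localEquation hs f i j m h e))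

instance quasiCompact_preimage_ι {S T : Scheme.{u}} (f : T ⟶ S) (U : S.Opens) [QuasiCompact U.ι] :
    QuasiCompact (f ⁻¹ᵁ U).ι :=
  MorphismProperty.of_isPullback (isPullback_morphismRestrict f U) inferInstance

/-- The ideal sheaf `I` is generated by the forms `sₘ`: on each chart `D₊(xᵢ)` by the functions
`sₘ / xᵢᵈ`. -/
def IsGeneratedBy (hs : ∀ i, (s i).IsHomogeneous d) (I : (plane K).IdealSheafData) : Prop :=
  ∀ i, I.ideal (chart K i) = Ideal.span (Set.range (localEquation hs i))

lemma IsGeneratedBy.ideal_comap {hs : ∀ i, (s i).IsHomogeneous d} {I : (plane K).IdealSheafData}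
    (hI : IsGeneratedBy hs I) {T : Scheme.{u}} (f : T ⟶ plane K) (V : T.affineOpens) {i : Fin 3}
    (e : V.1 ≤ f ⁻¹ᵁ Proj.basicOpen (grading K) (X i)) :
    (I.comap f).ideal V = Ideal.span (Set.range fun m => f.appLE _ V.1 e (localEquation hs i m)) := by
  refine (SerrePlane.ideal_comap I f V (chart K i) e).trans
    ((congrArg (Ideal.map _) (hI i)).trans ((Ideal.map_span _ _).trans
      (congrArg Ideal.span (Set.range_comp _ _).symm)))

lemma exists_mem_basicOpen_X (x : plane K) : ∃ i, x ∈ Proj.basicOpen (grading K) (X i) :=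
  exists_X_notMem x

/-- If the inverse image of the ideal generated by the `sₘ` is invertible, it is locally generated
by one of the forms, and the quotients by this form are coordinates of an extension of `ψ`. On the
dense open set `f⁻¹(U)` the quotients are `sₘ / sⱼ`, so the local extensions glue. -/
lemma exists_extension (hs : ∀ i, (s i).IsHomogeneous d) {I : (plane K).IdealSheafData}
    (hI : IsGeneratedBy hs I) {U : (plane K).Opens} [QuasiCompact U.ι]
    (hUI : (U : Set (plane K)) = (I.support : Set (plane K))ᶜ)
    (hU : U ≤ ⨆ j, Proj.basicOpen (grading K) (s j)) {ψ : (U : Scheme.{u}) ⟶ plane K}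
    (hψ : IsGivenBy hs U ψ) (T : Scheme.{u}) (f : T ⟶ plane K)
    (hf : IsInvertibleIdeal (I.comap f)) :
    ∃ h : T ⟶ plane K, (f ⁻¹ᵁ U).ι ≫ h = (f ∣_ U) ≫ ψ := by
  have hdom : IsSchemeTheoreticallyDominant (f ⁻¹ᵁ U).ι := by
    refine hf.isSchemeTheoreticallyDominant _ ?_
    rw [Scheme.IdealSheafData.support_comap]
    change f ⁻¹' U = _
    rw [hUI]; rfl
  have hlocal (t : T) : ∃ (i : Fin 3) (V : T.Opens) (e : V ≤ f ⁻¹ᵁ Proj.basicOpen (grading K) (X i))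
      (j : Fin 3) (a : Fin 3 → Γ(T, V)), t ∈ V ∧ a j = 1 ∧
        ∀ m, f.appLE _ V e (localEquation hs i m) = f.appLE _ V e (localEquation hs i j) * a m := by
    obtain ⟨i, hi⟩ := exists_mem_basicOpen_X (f t)
    obtain ⟨V, e, j, a, htV, haj, ha⟩ := exists_affine_generator hf
      (fun m => f.appLE _ (f ⁻¹ᵁ Proj.basicOpen (grading K) (X i)) le_rfl (localEquation hs i m))
      (fun V e => by
        rw [hI.ideal_comap f V e]
        congr 2
        funext m
        rw [← CommRingCat.comp_apply, Scheme.Hom.appLE_map]) t hi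
    refine ⟨i, V, e, j, a, htV, haj, fun m => ?_⟩
    have := ha m
    rwa [← CommRingCat.comp_apply, ← CommRingCat.comp_apply, Scheme.Hom.appLE_map] at this
  choose i V e j a htV haj ha using hlocal
  have hcov : ⨆ t, V t = ⊤ :=
    top_le_iff.1 fun t _ => TopologicalSpace.Opens.mem_iSup.2 ⟨t, htV t⟩
  let ι := (f ⁻¹ᵁ U).ι
  have hFU (W : (f ⁻¹ᵁ U).toScheme.Opens) :
      W ≤ (ι ≫ f) ⁻¹ᵁ ⨆ j, Proj.basicOpen (grading K) (s j) := fun x _ => hU x.2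
  have hcoord (t : T) {W : (f ⁻¹ᵁ U).toScheme.Opens} (hW : W ≤ ι ⁻¹ᵁ V t) :
      ∃ e : W ≤ (ι ≫ f) ⁻¹ᵁ Proj.basicOpen (grading K) (s (j t)),
        ∀ m, ι.appLE _ W hW (a t m) = (ι ≫ f).appLE _ W e (ratio hs (j t) m) := by
    have h1 : W ≤ (ι ≫ f) ⁻¹ᵁ Proj.basicOpen (grading K) (X (i t)) :=
      hW.trans (ι.preimage_mono (e t))
    refine eq_appLE_ratio (ι ≫ f) h1 (fun m => ?_) (hFU W)
    rw [← Scheme.Hom.appLE_comp_appLE ι f _ _ _ (e t) hW, CommRingCat.comp_apply,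
      CommRingCat.comp_apply, ha, map_mul]
  obtain ⟨h, hh⟩ := exists_hasCoordinates_of_cover V hcov j
    (fun t => (f.appLE _ (V t) (e t)).hom.comp (const (X (i t)) (isHomogeneous_X K (i t)))) a haj
    (fun t t' c => by
      rw [RingHom.comp_apply, RingHom.comp_apply, ← CommRingCat.comp_apply,
        ← CommRingCat.comp_apply, Scheme.Hom.appLE_map, Scheme.Hom.appLE_map]
      exact appLE_const_eq f _ _ _ _ c)
    (fun t t' => by
      refine ⟨T.presheaf.map (homOfLE inf_le_right).op (a t' (j t)), fun m => ?_⟩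
      refine ι.app_injective _ ?_
      have key {V' : T.Opens} (hV' : V t ⊓ V t' ≤ V') (x : Γ(T, V')) :
          ι.app (V t ⊓ V t') (T.presheaf.map (homOfLE hV').op x) =
            ι.appLE V' (ι ⁻¹ᵁ (V t ⊓ V t')) (ι.preimage_mono hV') x := by
        rw [Scheme.Hom.app_eq_appLE, ← CommRingCat.comp_apply, Scheme.Hom.map_appLE]
      obtain ⟨e1, h1⟩ := hcoord t (W := ι ⁻¹ᵁ (V t ⊓ V t')) (ι.preimage_mono inf_le_left)
      obtain ⟨e2, h2⟩ := hcoord t' (W := ι ⁻¹ᵁ (V t ⊓ V t')) (ι.preimage_mono inf_le_right)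
      rw [map_mul, key inf_le_left, key inf_le_right, key inf_le_right, h1, h2, h2]
      exact appLE_ratio hs (ι ≫ f) _ _ _ e2 e1)
  refine ⟨h, hom_ext_of_cover (fun t => ι ⁻¹ᵁ V t) ?_ fun t => ?_⟩
  · exact top_le_iff.1 fun x _ => TopologicalSpace.Opens.mem_iSup.2 ⟨x.1, htV x.1⟩
  · have h1 := (hh t).comp ι (W := ι ⁻¹ᵁ V t) le_rfl
    obtain ⟨e', he'⟩ := hcoord t (W := ι ⁻¹ᵁ V t) le_rfl
    have hfι : (f ∣_ U) ≫ U.ι = ι ≫ f := morphismRestrict_ι f U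
    have h2 := hψ.comp (f ∣_ U) (j t) (W := ι ⁻¹ᵁ V t) (by rw [hfι]; exact e')
    simp only [hfι] at h2
    refine (h1.congr (fun c => ?_) he').ι_comp_eq h2 1 fun m => (one_mul _).symm
    rw [RingHom.comp_apply, RingHom.comp_apply]
    have h3 := Scheme.Hom.appLE_comp_appLE ι f _ _ (ι ⁻¹ᵁ V t) (e t) le_rfl
    refine (congrArg (fun r => r.hom (const (X (i t)) (isHomogeneous_X K (i t)) c)) h3).trans ?_
    exact appLE_const_eq (ι ≫ f) _ _ _ e' c

/-- Where the extension `h` lands in `D₊(yⱼ)`, the relations `sₘ = sⱼ · h^*(yₘ / yⱼ)` hold on the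
dense open set `f⁻¹(U)`, hence everywhere, and so `sⱼ` generates the inverse image ideal. -/
lemma isInvertibleIdeal_comap_of_extension (hs : ∀ i, (s i).IsHomogeneous d)
    {I : (plane K).IdealSheafData} (hI : IsGeneratedBy hs I) {U : (plane K).Opens}
    [QuasiCompact U.ι] (hU : U ≤ ⨆ j, Proj.basicOpen (grading K) (s j))
    {ψ : (U : Scheme.{u}) ⟶ plane K} (hψ : IsGivenBy hs U ψ) (T : Scheme.{u}) (f : T ⟶ plane K)
    (h : T ⟶ plane K) (hdom : IsSchemeTheoreticallyDominant (f ⁻¹ᵁ U).ι)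
    (hh : (f ⁻¹ᵁ U).ι ≫ h = (f ∣_ U) ≫ ψ) : IsInvertibleIdeal (I.comap f) := by
  intro x
  obtain ⟨i, hi⟩ := exists_mem_basicOpen_X (f x)
  obtain ⟨j, hj⟩ := exists_mem_basicOpen_X (h x)
  obtain ⟨_, ⟨V, hV, rfl⟩, hxV, hVle⟩ := T.isBasis_affineOpens.exists_subset_of_mem_open
    (show x ∈ f ⁻¹ᵁ Proj.basicOpen (grading K) (X i) ⊓ h ⁻¹ᵁ Proj.basicOpen (grading K) (X j) from
      ⟨hi, hj⟩) (TopologicalSpace.Opens.isOpen _)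
  have e1 : V ≤ f ⁻¹ᵁ Proj.basicOpen (grading K) (X i) := fun y hy => (hVle hy).1
  have e2 : V ≤ h ⁻¹ᵁ Proj.basicOpen (grading K) (X j) := fun y hy => (hVle hy).2
  let ι := (f ⁻¹ᵁ U).ι
  let W := ι ⁻¹ᵁ V
  let b : Fin 3 → Γ(T, V) := fun m =>
    h.appLE _ V e2 (fraction (X j) (isHomogeneous_X K j) 1 (X m) (isHomogeneous_X K m))
  let g : Fin 3 → Γ(T, V) := fun m => f.appLE _ V e1 (localEquation hs i m)
  have hfι : (f ∣_ U) ≫ U.ι = ι ≫ f := morphismRestrict_ι f U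
  have e3 : W ≤ ((f ∣_ U) ≫ U.ι) ⁻¹ᵁ Proj.basicOpen (grading K) (s j) := by
    have h1 : W ≤ (ι ≫ h) ⁻¹ᵁ Proj.basicOpen (grading K) (X j) := ι.preimage_mono e2
    rw [hh] at h1
    change W ≤ (f ∣_ U) ⁻¹ᵁ (U.ι ⁻¹ᵁ Proj.basicOpen (grading K) (s j))
    rw [hψ.preimage_basicOpen hU]
    exact h1
  have hb (m : Fin 3) : ι.app V (b m) = ((f ∣_ U) ≫ U.ι).appLE _ W e3 (ratio hs j m) := by
    have h1 : HasCoordinates h V j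
        ((h.appLE _ V e2).hom.comp (const (X j) (isHomogeneous_X K j))) b :=
      ⟨e2, fun c => rfl, fun m => rfl⟩
    have h2 := h1.comp ι (W := W) le_rfl
    rw [hh] at h2
    have h3 := h2.apply_eq (hψ.comp (f ∣_ U) j e3) m
    rw [← h3, Scheme.Hom.app_eq_appLE]
  have e4 : W ≤ (ι ≫ f) ⁻¹ᵁ Proj.basicOpen (grading K) (s j) := by rw [← hfι]; exact e3
  have e5 : W ≤ (ι ≫ f) ⁻¹ᵁ Proj.basicOpen (grading K) (X i) := ι.preimage_mono e1
  have hg (m : Fin 3) : ι.app V (g m) = (ι ≫ f).appLE _ W e5 (localEquation hs i m) := by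
    rw [Scheme.Hom.app_eq_appLE, ← CommRingCat.comp_apply, Scheme.Hom.appLE_comp_appLE]
  have hb' (m : Fin 3) : ι.app V (b m) = (ι ≫ f).appLE _ W e4 (ratio hs j m) := by
    rw [hb]; simp only [hfι]
  have hgb (m : Fin 3) : g m = g j * b m := by
    refine ι.app_injective V ?_
    rw [map_mul, hg, hg, hb', ← appLE_localEquation]
  refine ⟨⟨V, hV⟩, hxV, g j, ?_, ?_⟩
  · rw [mem_nonZeroDivisors_iff_right]
    intro z hz
    refine ι.app_injective V ?_
    have h1 := congrArg (ι.app V) hz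
    rw [map_mul, hg, map_zero] at h1
    rw [map_zero]
    exact (isUnit_appLE_localEquation hs (ι ≫ f) e5 e4).mul_left_eq_zero.1 h1
  · rw [hI.ideal_comap f ⟨V, hV⟩ e1]
    apply le_antisymm
    · rw [Ideal.span_le]
      rintro _ ⟨m, rfl⟩
      exact Ideal.mem_span_singleton.2 ⟨b m, hgb m⟩
    · rw [Ideal.span_singleton_le_iff_mem]
      exact Ideal.subset_span ⟨j, rfl⟩

end Extension

/-! ### Relations between the forms of a basis, and monomials modulo `q`-th powers -/

section Coordinates

variable {k : Type u} [Field k] [Finite k]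

/-- The Moore determinant `det(x, x^(q), x^(q²))`. -/
def moore (q : ℕ) {R : Type*} [CommRing R] (x : Fin 3 → R) : R :=
  ∑ j, (x j ^ q) ^ q * frobCross q x j

/-- The Moore determinant vanishes only if the coordinates of `x × x^(q)` are linearly dependent
over `k`. -/
lemma moore_ne_zero {R : Type*} [CommRing R] [IsDomain R] [Algebra k R] {x : Fin 3 → R}
    (h : ∀ c : Fin 3 → k, ∑ i, c i • frobCross (Nat.card k) x i = 0 → c = 0) :
    moore (Nat.card k) x ≠ 0 := by
  intro h0
  have h1 : frobCross (Nat.card k) (frobCross (Nat.card k) x) 2 = 0 := by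
    rw [frobCross_frobCross]
    exact mul_eq_zero_of_left h0 _
  have h2 : frobCross (Nat.card k) x 0 ^ Nat.card k * frobCross (Nat.card k) x 1 =
      frobCross (Nat.card k) x 0 * frobCross (Nat.card k) x 1 ^ Nat.card k := by
    rw [frobCross] at h1
    simp only [Fin.isValue, Fin.reduceAdd] at h1
    linear_combination -h1
  obtain h3 | ⟨c, hc⟩ := eq_zero_or_exists_smul k h2
  · have := congrFun (h ![0, 1, 0] (by simp [Fin.sum_univ_three, h3])) 1
    simp at this
  · have := congrFun (h ![1, -c, 0] (by simp [Fin.sum_univ_three, hc])) 0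
    simp at this

omit [Finite k] in
lemma sum_smul_frobCross_X (c : Fin 3 → k) :
    ∑ i, c i • frobCross (Nat.card k) (X : Fin 3 → MvPolynomial (Fin 3) k) i =
      crossForm (Nat.card k) c := by
  simp only [crossForm, smul_eq_C_mul]

omit [Finite k] in
lemma crossForm_single (m : Fin 3) :
    crossForm (Nat.card k) (Pi.single m (1 : k)) = frobCross (Nat.card k) X m := by
  rw [← sum_smul_frobCross_X,
    Finset.sum_eq_single m (fun b _ hb => by rw [Pi.single_eq_of_ne hb, zero_smul]) (by simp),
    Pi.single_eq_same, one_smul]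

lemma crossForm_eq_zero {c : Fin 3 → k} (h : crossForm (Nat.card k) c = 0) : c = 0 :=
  crossForm_injective (natCast_natCard_eq_zero k k) Nat.card_pos.ne' (h.trans (by simp [crossForm]))

/-- The matrices `A` and `N` of the base change between a basis of the linear system and the basis
formed by the coordinates of `x × x^(q)`. -/
lemma exists_changeOfBasis (s : Module.Basis (Fin 3) k (formsThroughZ k k (Nat.card k + 1))) :
    ∃ A N : Fin 3 → Fin 3 → k,
      (∀ m, (s m).1 = ∑ i, A m i • frobCross (Nat.card k) X i) ∧
      (∀ m, frobCross (Nat.card k) X m = ∑ j, N m j • (s j).1) ∧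
      ∀ m j, ∑ i, A m i * N i j = if m = j then 1 else 0 := by
  let e := crossFormEquiv k k
  let A : Fin 3 → Fin 3 → k := fun m => e.symm (s m)
  let N : Fin 3 → Fin 3 → k := fun m => s.repr (e (Pi.single m 1))
  have h1 (m) : (s m).1 = ∑ i, A m i • frobCross (Nat.card k) X i := by
    rw [sum_smul_frobCross_X, ← coe_crossFormEquiv k k, LinearEquiv.apply_symm_apply]
  have h2 (m) : frobCross (Nat.card k) X m = ∑ j, N m j • (s j).1 := by
    have := congrArg Subtype.val (s.sum_repr (e (Pi.single m 1)))
    rw [coe_crossFormEquiv, crossForm_single] at this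
    rw [← this, Submodule.coe_sum]
    rfl
  refine ⟨A, N, h1, h2, fun m j => ?_⟩
  have h3 : s m = ∑ j, (∑ i, A m i * N i j) • s j := by
    apply Subtype.ext
    rw [h1]
    simp only [h2, Finset.smul_sum, smul_smul, Submodule.coe_sum, Submodule.coe_smul,
      Finset.sum_smul]
    exact Finset.sum_comm
  have h4 := congrArg (fun t => s.repr t j) h3
  simp only [map_sum, map_smul, Module.Basis.repr_self, Finsupp.coe_finsetSum, Finset.sum_apply,
    Finsupp.smul_apply, Finsupp.single_apply, smul_eq_mul, mul_ite, mul_one, mul_zero,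
    Finset.sum_ite_eq', Finset.mem_univ, if_true] at h4
  exact h4.symm

/-- The basis forms satisfy no homogeneous relation. A relation `G` can be evaluated at
`w = x × x^(q)`, and there the basis forms become `q`-th powers of independent linear forms, up to
the Moore determinant as a common factor. -/
lemma eq_zero_of_aeval_basis_eq_zero
    (s : Module.Basis (Fin 3) k (formsThroughZ k k (Nat.card k + 1))) {n : ℕ}
    {G : MvPolynomial (Fin 3) k} (hG : G.IsHomogeneous n) (h : aeval (fun i => (s i).1) G = 0) :
    G = 0 := by
  obtain ⟨A, N, hA, -, hAN⟩ := exists_changeOfBasis s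
  let w : Fin 3 → MvPolynomial (Fin 3) k := frobCross (Nat.card k) X
  let AX : Fin 3 → MvPolynomial (Fin 3) k := fun m => ∑ i, A m i • X i
  have hmoore : moore (Nat.card k) (X : Fin 3 → MvPolynomial (Fin 3) k) ≠ 0 :=
    moore_ne_zero fun c hc => crossForm_eq_zero (by rw [← sum_smul_frobCross_X, hc])
  have h1 (m : Fin 3) : aeval w (s m).1 = moore (Nat.card k) X * AX m ^ Nat.card k := by
    have h2 : AX m ^ Nat.card k = ∑ i, A m i • X i ^ Nat.card k := by
      have := aeval_pow_natCard (k := k) (X : Fin 3 → MvPolynomial (Fin 3) k) (AX m)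
      rw [aeval_X_left_apply] at this
      rw [this]
      simp [AX]
    rw [hA, h2, map_sum, Finset.mul_sum]
    refine Finset.sum_congr rfl fun i _ => ?_
    rw [map_smul, map_frobCross]
    simp only [aeval_X]
    rw [frobCross_frobCross, mul_smul_comm]
    rfl
  have h3 : moore (Nat.card k) X ^ n * aeval AX G ^ Nat.card k = 0 := by
    have h4 := congrArg (aeval w) h
    have h5 := congrArg (fun f => f G) (comp_aeval (fun i => (s i).1) (aeval w))
    rw [map_zero] at h4
    rw [aeval_pow_natCard, aeval_def, ← eval₂_mul_of_isHomogeneous hG, ← aeval_def]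
    simp only [← h1]
    exact h5.symm.trans h4
  have h6 : aeval AX G = 0 :=
    pow_eq_zero_iff (Nat.card_pos.ne') |>.1 ((mul_eq_zero.1 h3).resolve_left (pow_ne_zero _ hmoore))
  have h7 := congrArg (fun f => f G) (comp_aeval AX
    (aeval fun i => ∑ j, N i j • (X j : MvPolynomial (Fin 3) k)))
  have h8 : (fun i => aeval (fun i => ∑ j, N i j • (X j : MvPolynomial (Fin 3) k)) (AX i)) =
      (X : Fin 3 → MvPolynomial (Fin 3) k) := by
    funext m
    simp only [AX, map_sum, map_smul, aeval_X, Finset.smul_sum, smul_smul]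
    rw [Finset.sum_comm]
    simp only [← Finset.sum_smul, hAN, ite_smul, one_smul, zero_smul, Finset.sum_ite_eq,
      Finset.mem_univ, if_true]
  simp only [h8, aeval_X_left, AlgHom.comp_apply, AlgHom.id_apply, h6, map_zero] at h7
  exact h7.symm

/-- A form is determined by its restriction to the affine chart `x₀ = 1`. -/
lemma eq_zero_of_dehomogenize_eq_zero {K : Type*} [Field K] {n : ℕ} {G : MvPolynomial (Fin 3) K}
    (hG : G.IsHomogeneous n)
    (h : aeval (![1, X 0, X 1] : Fin 3 → MvPolynomial (Fin 2) K) G = 0) : G = 0 := by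
  let Q := FractionRing (MvPolynomial (Fin 3) K)
  let x : Fin 3 → Q := fun i => algebraMap (MvPolynomial (Fin 3) K) Q (X i)
  have hx0 : x 0 ≠ 0 := by
    simp [x]
  let ρ : MvPolynomial (Fin 2) K →ₐ[K] Q := aeval ![x 1 / x 0, x 2 / x 0]
  have h1 := DFunLike.congr_fun
    (comp_aeval (R := K) (![1, X 0, X 1] : Fin 3 → MvPolynomial (Fin 2) K) ρ) G
  simp only [AlgHom.comp_apply, h, map_zero] at h1
  have h2 : (fun i => x 0 * ρ ((![1, X 0, X 1] : Fin 3 → MvPolynomial (Fin 2) K) i)) = x := by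
    funext i
    fin_cases i <;> simp [ρ, mul_div_cancel₀ _ hx0]
  have h3 : aeval x G = 0 := by
    rw [← h2, aeval_def, eval₂_mul_of_isHomogeneous hG, ← aeval_def, ← h1, mul_zero]
  have h4 : aeval x G = algebraMap _ Q G := by
    have := congrArg (fun f => f G) (comp_aeval (X : Fin 3 → MvPolynomial (Fin 3) K)
      (IsScalarTower.toAlgHom K (MvPolynomial (Fin 3) K) Q))
    simp only [aeval_X_left, AlgHom.comp_apply, AlgHom.id_apply] at this
    exact this.symm
  rw [h4] at h3
  exact (FaithfulSMul.algebraMap_injective (MvPolynomial (Fin 3) K) Q) (h3.trans (map_zero _).symm)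

lemma forall_eq_zero_of_sum_pow_mul_eq_zero (q : ℕ) (hq : q = Nat.card k)
    (p : Fin q × Fin q → MvPolynomial (Fin 2) k)
    (h : ∑ ij, p ij ^ q * (X 0 ^ (ij.1 : ℕ) * X 1 ^ (ij.2 : ℕ)) = 0) (ij : Fin q × Fin q) :
    p ij = 0 := by
  have hq0 : q ≠ 0 := by rw [hq]; exact Nat.card_pos.ne'
  ext m
  let e (ij : Fin q × Fin q) : Fin 2 →₀ ℕ := Finsupp.single 0 (ij.1 : ℕ) + Finsupp.single 1 (ij.2 : ℕ)
  have h1 (ij' : Fin q × Fin q) : p ij' ^ q * (X 0 ^ (ij'.1 : ℕ) * X 1 ^ (ij'.2 : ℕ)) =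
      expand q (p ij') * monomial (e ij') 1 := by
    have h2 := aeval_pow_natCard (k := k) (X : Fin 2 → MvPolynomial (Fin 2) k) (p ij')
    rw [aeval_X_left_apply, ← hq] at h2
    rw [h2, X_pow_eq_monomial, X_pow_eq_monomial, monomial_mul, one_mul]
    rfl
  have h3 := congrArg (coeff (q • m + e ij)) h
  simp only [h1, coeff_sum, coeff_mul_monomial', mul_one, coeff_zero] at h3
  rw [Finset.sum_eq_single ij] at h3
  · rw [if_pos (by simp), add_tsub_cancel_right, coeff_expand_smul _ hq0] at h3
    rw [h3, coeff_zero]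
  · intro ij' _ hne
    split_ifs with hle
    · have key (i : Fin 2) (r r' : Fin q) (hr : e ij i = r) (hr' : e ij' i = r') (hrr : r' ≠ r) :
          coeff (q • m + e ij - e ij') (expand q (p ij')) = 0 := by
        refine coeff_expand_of_not_dvd (R := k) (p := q) (i := i) _ ?_
        have hle' := hle i
        simp only [Finsupp.coe_tsub, Finsupp.coe_add, Finsupp.coe_smul, Pi.sub_apply, Pi.add_apply,
          Pi.smul_apply, smul_eq_mul, hr, hr'] at hle' ⊢
        intro hdvd
        apply hrr
        apply Fin.ext
        have h5 : q * m i + (r : ℕ) ≡ r' [MOD q] := ((Nat.modEq_iff_dvd' hle').2 hdvd).symm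
        have h6 : (r : ℕ) ≡ r' [MOD q] := by simpa [Nat.ModEq] using h5
        exact (Nat.ModEq.eq_of_lt_of_lt h6 r.2 r'.2).symm
      by_cases h1 : ij'.1 = ij.1
      · refine key 1 ij.2 ij'.2 (by simp [e]) (by simp [e]) fun h2 => hne (Prod.ext h1 h2)
      · exact key 0 ij.1 ij'.1 (by simp [e]) (by simp [e]) h1
    · rfl
  · simp

/-- The `q²` monomials of degree less than `q` in each variable are linearly independent over the
`q`-th powers of rational functions. -/
lemma linearIndependent_monomials {F : Type*} [Field F] [Algebra (MvPolynomial (Fin 2) k) F]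
    [IsFractionRing (MvPolynomial (Fin 2) k) F] (q : ℕ) (hq : q = Nat.card k) (E : Subfield F)
    (hE : ∀ y ∈ E, ∃ z, z ^ q = y) :
    LinearIndependent E (fun ij : Fin q × Fin q =>
      algebraMap (MvPolynomial (Fin 2) k) F (X 0 ^ (ij.1 : ℕ) * X 1 ^ (ij.2 : ℕ))) := by
  rw [Fintype.linearIndependent_iff]
  intro g hg
  choose z hz using fun ij => hE (g ij) (g ij).2
  obtain ⟨b, hb⟩ := IsLocalization.exist_integer_multiples_of_finite
    (nonZeroDivisors (MvPolynomial (Fin 2) k)) z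
  choose p hp using hb
  have hinj := FaithfulSMul.algebraMap_injective (MvPolynomial (Fin 2) k) F
  have hb0 : algebraMap (MvPolynomial (Fin 2) k) F b ≠ 0 := by
    rw [Ne, map_eq_zero_iff _ hinj]
    exact nonZeroDivisors.ne_zero b.2
  have h1 : ∑ ij, p ij ^ q * (X 0 ^ (ij.1 : ℕ) * X 1 ^ (ij.2 : ℕ)) = 0 := by
    apply hinj
    rw [map_sum, map_zero]
    have h2 := congrArg (fun t => algebraMap (MvPolynomial (Fin 2) k) F b ^ q * t) hg
    simp only [mul_zero, Finset.mul_sum] at h2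
    rw [← h2]
    refine Finset.sum_congr rfl fun ij _ => ?_
    rw [map_mul, map_pow, hp, Algebra.smul_def, mul_pow, hz, Subfield.smul_def, smul_eq_mul, mul_assoc]
  intro ij
  have h3 := forall_eq_zero_of_sum_pow_mul_eq_zero q hq p h1 ij
  have h4 := hp ij
  rw [h3, map_zero, Algebra.smul_def, eq_comm, mul_eq_zero] at h4
  apply Subtype.ext
  have hq0 : q ≠ 0 := by rw [hq]; exact Nat.card_pos.ne'
  rw [← hz, h4.resolve_left hb0, zero_pow hq0]
  rfl

end Coordinates

/-! ### The extension of function fields -/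

section FieldExtension

open IntermediateField in
lemma finrank_adjoin_simple_le {K L : Type*} [Field K] [Field L] [Algebra K L] {q : ℕ} (hq : 0 < q)
    {x : L} {c : K} (hx : x ^ q = algebraMap K L c) :
    FiniteDimensional K K⟮x⟯ ∧ Module.finrank K K⟮x⟯ ≤ q := by
  have hmonic : (Polynomial.X ^ q - Polynomial.C c : Polynomial K).Monic :=
    Polynomial.monic_X_pow_sub_C c hq.ne'
  have hroot : Polynomial.aeval x (Polynomial.X ^ q - Polynomial.C c : Polynomial K) = 0 := by
    simp [hx]
  have hint : IsIntegral K x := ⟨_, hmonic, hroot⟩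
  refine ⟨adjoin.finiteDimensional hint, ?_⟩
  rw [adjoin.finrank hint]
  refine (Polynomial.natDegree_le_natDegree (minpoly.min K x hmonic hroot)).trans ?_
  rw [Polynomial.natDegree_X_pow_sub_C]

open IntermediateField in
/-- Both steps of the tower `E₀ ⊆ E₁ ⊆ F` are generated by one `q`-th root, hence of degree at
most `q`; if the whole tower has degree at least `q ^ 2`, both have degree exactly `q`. -/
lemma finrank_eq_of_tower {F : Type*} [Field F] {q : ℕ} (hq : 0 < q) {E₀ E₁ : Subfield F}
    (h01 : E₀ ≤ E₁) (hpow : ∀ y : F, y ^ q ∈ E₀) {t a : F}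
    (hE₁ : ∀ E : Subfield F, E₀ ≤ E → t ∈ E → E₁ ≤ E) (ht : t ∈ E₁)
    (hF : ∀ E : Subfield F, E₁ ≤ E → a ∈ E → E = ⊤)
    {f : Fin q × Fin q → F} (hf : LinearIndependent E₀ f) : Module.finrank E₁ F = q := by
  let E : IntermediateField E₀ F := Subfield.extendScalars h01
  have hE : E = E₀⟮t⟯ := by
    apply le_antisymm
    · intro y hy
      exact hE₁ E₀⟮t⟯.toSubfield (fun z hz => E₀⟮t⟯.algebraMap_mem ⟨z, hz⟩)
        (mem_adjoin_simple_self E₀ t) hy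
    · rw [adjoin_simple_le_iff]
      exact ht
  have h1 := finrank_adjoin_simple_le (K := E₀) hq (x := t) (c := ⟨t ^ q, hpow t⟩) rfl
  have h2 := finrank_adjoin_simple_le (K := E) hq (x := a) (c := ⟨a ^ q, h01 (hpow a)⟩) rfl
  have htop : E⟮a⟯ = ⊤ := by
    have := hF E⟮a⟯.toSubfield (fun z hz => E⟮a⟯.algebraMap_mem ⟨z, hz⟩)
      (mem_adjoin_simple_self E a)
    rw [eq_top_iff]
    intro y _
    have hy : y ∈ E⟮a⟯.toSubfield := by rw [this]; trivial
    exact hy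
  rw [← hE] at h1
  rw [htop, finrank_top'] at h2
  have := h1.1
  have : FiniteDimensional E F := by
    have h3 := h2.1
    exact Module.Finite.equiv (topEquiv (F := E) (E := F)).toLinearEquiv
  have : FiniteDimensional E₀ F := FiniteDimensional.trans E₀ E F
  have h4 := hf.fintype_card_le_finrank
  rw [Fintype.card_prod, Fintype.card_fin, ← Module.finrank_mul_finrank E₀ E F] at h4
  have h5 : q ≤ Module.finrank E F := by
    by_contra! h5
    have := Nat.mul_le_mul_right (Module.finrank E F) h1.2
    have := Nat.mul_lt_mul_of_pos_left h5 hq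
    omega
  exact le_antisymm h2.2 h5

variable {k : Type u} [Field k] [Finite k]

lemma isPurelyInseparable_of_pow_natCard_mem {F L : Type*} [Field F] [Field L] [Algebra k L]
    (φ : L →+* F) (h : ∀ y : F, y ^ Nat.card k ∈ φ.range) : φ.IsPurelyInseparable := by
  let _ := φ.toAlgebra
  have := Fintype.ofFinite k
  obtain ⟨p, hchar⟩ := CharP.exists k
  obtain ⟨n, hp, hcard⟩ := FiniteField.card k p
  have : Fact p.Prime := ⟨hp⟩
  have : CharP L p := charP_of_injective_algebraMap (algebraMap k L).injective p
  have : ExpChar L p := .prime hp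
  refine (isPurelyInseparable_iff_pow_mem L (E := F) p).2 fun x => ⟨n, ?_⟩
  rw [← hcard, ← Nat.card_eq_fintype_card]
  exact h x

lemma finrank_eq_finrank_fieldRange {F L : Type*} [Field F] [Field L] (φ : L →+* F) {n : ℕ}
    (h : Module.finrank φ.fieldRange F = n) : φ.finrank = n := by
  let _ := φ.toAlgebra
  have h1 : Module.finrank L F = n := by
    rw [← h]
    exact Algebra.finrank_eq_of_equiv_equiv φ.rangeRestrictFieldEquiv (RingEquiv.refl F) rfl
  have h2 := Module.rankAtStalk_eq_finrank_of_free (R := L) (M := F)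
  rw [h1] at h2
  exact h2

omit [Finite k] in
lemma subfield_eq_top {F : Type*} [Field F] [Algebra k F] [Algebra (MvPolynomial (Fin 2) k) F]
    [IsScalarTower k (MvPolynomial (Fin 2) k) F] [IsFractionRing (MvPolynomial (Fin 2) k) F]
    (E : Subfield F) (hk : ∀ c : k, algebraMap k F c ∈ E)
    (hX : ∀ i, algebraMap (MvPolynomial (Fin 2) k) F (X i) ∈ E) : E = ⊤ := by
  have h1 (p : MvPolynomial (Fin 2) k) : algebraMap (MvPolynomial (Fin 2) k) F p ∈ E := by
    induction p using MvPolynomial.induction_on with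
    | C c => rw [← algebraMap_eq, ← IsScalarTower.algebraMap_apply]; exact hk c
    | add p q hp hq => rw [map_add]; exact add_mem hp hq
    | mul_X p i hp => rw [map_mul]; exact mul_mem hp (hX i)
  rw [eq_top_iff]
  intro y _
  obtain ⟨p, r, -, rfl⟩ := IsFractionRing.div_surjective (A := MvPolynomial (Fin 2) k) y
  exact div_mem (h1 p) (h1 r)

/-- `F` is the field of rational functions of the plane, with affine coordinates `a₁, a₂`, and the
field `L` is generated by the coordinates `uₘ` that `φ` maps to `sₘ(a) / s₀(a)`. -/
theorem isPurelyInseparable_and_finrank_eq {F L : Type*} [Field F] [Field L] [Algebra k F]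
    [Algebra k L] [Algebra (MvPolynomial (Fin 2) k) F]
    [IsScalarTower k (MvPolynomial (Fin 2) k) F] [IsFractionRing (MvPolynomial (Fin 2) k) F]
    (s : Module.Basis (Fin 3) k (formsThroughZ k k (Nat.card k + 1))) {u : Fin 3 → L}
    (hu : ∀ E : Subfield L, (∀ c : k, algebraMap k L c ∈ E) → (∀ m, u m ∈ E) → E = ⊤)
    {φ : L →+* F} (hφk : ∀ c : k, φ (algebraMap k L c) = algebraMap k F c) {a : Fin 3 → F}
    (ha : ∀ i, a i = algebraMap _ F ((![1, X 0, X 1] : Fin 3 → MvPolynomial (Fin 2) k) i))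
    (hφ : ∀ m, φ (u m) * aeval a (s 0).1 = aeval a (s m).1) :
    φ.IsPurelyInseparable ∧ φ.finrank = Nat.card k := by
  have := Fintype.ofFinite k
  obtain ⟨A, N, hA, hN, -⟩ := exists_changeOfBasis s
  have hpos : 0 < Nat.card k := Nat.card_pos
  have haeval (G : MvPolynomial (Fin 3) k) : aeval a G = algebraMap (MvPolynomial (Fin 2) k) F
      (aeval (![1, X 0, X 1] : Fin 3 → MvPolynomial (Fin 2) k) G) := by
    have h1 := DFunLike.congr_fun (comp_aeval (R := k)
      (![1, X 0, X 1] : Fin 3 → MvPolynomial (Fin 2) k)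
      (IsScalarTower.toAlgHom k (MvPolynomial (Fin 2) k) F)) G
    rw [funext ha]
    exact h1.symm
  have hinj {n : ℕ} {G : MvPolynomial (Fin 3) k} (hG : G.IsHomogeneous n) (h : aeval a G = 0) :
      G = 0 := by
    rw [haeval, map_eq_zero_iff _ (FaithfulSMul.algebraMap_injective _ F)] at h
    exact eq_zero_of_dehomogenize_eq_zero hG h
  let w : Fin 3 → F := frobCross (Nat.card k) a
  have hw (i) : aeval a (frobCross (Nat.card k) (X : Fin 3 → MvPolynomial (Fin 3) k) i) = w i := by
    rw [map_frobCross]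
    simp only [aeval_X]
    rfl
  have hw0 (c : Fin 3 → k) (h : ∑ i, c i • w i = 0) : c = 0 := by
    apply crossForm_eq_zero
    rw [← sum_smul_frobCross_X]
    refine hinj (n := Nat.card k + 1) ?_ ?_
    · rw [sum_smul_frobCross_X]
      exact (crossForm_mem k k c).1
    · rw [map_sum, ← h]
      simp only [map_smul, hw]
  have hwi (i) : w i ≠ 0 := fun h => by
    have := congrFun (hw0 (Pi.single i 1) (Finset.sum_eq_zero fun j _ => by
      by_cases hj : j = i
      · rw [hj, h, smul_zero]
      · rw [Pi.single_eq_of_ne hj, zero_smul])) i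
    simp at this
  -- `c • φ(v)` is the vector `w`, so `φ(L)` contains the quotients of the coordinates of `w`.
  let c : F := aeval a (s 0).1
  have hc : c ≠ 0 := fun h => s.ne_zero 0 (Subtype.ext (hinj (s 0).2.1 h))
  have hs (m) : aeval a (s m).1 = ∑ i, A m i • w i := by
    rw [hA, map_sum]
    simp only [map_smul, hw]
  let v : Fin 3 → L := fun m => ∑ j, algebraMap k L (N m j) * u j
  have hv (m) : w m = c * φ (v m) := by
    rw [← hw, hN, map_sum, map_sum, Finset.mul_sum]
    refine Finset.sum_congr rfl fun j _ => ?_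
    rw [map_smul, ← hφ, map_mul, hφk, Algebra.smul_def]
    ring
  have ha0 : a 0 = 1 := by rw [ha]; simp
  have hmoore : moore (Nat.card k) a ≠ 0 := moore_ne_zero hw0
  have hfc (i) : moore (Nat.card k) a * a i ^ Nat.card k =
      c ^ (Nat.card k + 1) * φ (frobCross (Nat.card k) v i) := by
    rw [map_frobCross, ← frobCross_smul]
    refine (frobCross_frobCross k a i).symm.trans ?_
    exact congrArg (fun x => frobCross (Nat.card k) x i) (funext hv)
  have hapow (i) : a i ^ Nat.card k ∈ φ.fieldRange := by
    refine ⟨frobCross (Nat.card k) v i / frobCross (Nat.card k) v 0, ?_⟩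
    have h0 := hfc 0
    rw [ha0, one_pow, mul_one] at h0
    have h1 : φ (frobCross (Nat.card k) v 0) ≠ 0 := fun h => hmoore (by rw [h0, h, mul_zero])
    have h2 := hfc i
    rw [h0] at h2
    rw [map_div₀, div_eq_iff h1]
    apply mul_left_cancel₀ (pow_ne_zero (Nat.card k + 1) hc)
    rw [← h2]
    ring
  have hkmem (x : k) : algebraMap k F x ∈ φ.fieldRange := ⟨_, hφk x⟩
  let fr : F →+* F := (FiniteField.frobeniusAlgHom k F).toRingHom
  have hfr (y : F) : fr y = y ^ Nat.card k := by
    rw [Nat.card_eq_fintype_card]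
    rfl
  have hfrk (x : k) : fr (algebraMap k F x) = algebraMap k F x :=
    (FiniteField.frobeniusAlgHom k F).commutes x
  have h01 : fr.fieldRange ≤ φ.fieldRange := by
    have htop : φ.fieldRange.comap fr = ⊤ := by
      apply subfield_eq_top (k := k)
      · intro x
        rw [Subfield.mem_comap, hfrk]
        exact hkmem x
      · intro i
        rw [Subfield.mem_comap, hfr]
        have h1 := hapow i.succ
        rw [ha] at h1
        fin_cases i <;> exact h1
    rintro _ ⟨y, rfl⟩
    have hy : y ∈ φ.fieldRange.comap fr := by rw [htop]; trivial
    exact hy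
  have hpow (y : F) : y ^ Nat.card k ∈ fr.fieldRange := ⟨y, hfr y⟩
  have hwdiv (i) : w i / w 2 ∈ φ.fieldRange := by
    refine ⟨v i / v 2, ?_⟩
    rw [map_div₀, hv, hv, mul_div_mul_left _ _ hc]
  refine ⟨isPurelyInseparable_of_pow_natCard_mem φ fun y => h01 (hpow y),
    finrank_eq_finrank_fieldRange φ ?_⟩
  refine finrank_eq_of_tower hpos h01 hpow (t := w 1 / w 2) (a := a 1) ?_ (hwdiv 1) ?_
    (linearIndependent_monomials (Nat.card k) rfl fr.fieldRange ?_)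
  -- `φ(L)` is generated by `w₁ / w₂` over the `q`-th powers, by the relation `a^(q) · w = 0`.
  · intro E hE ht
    have hkE (x : k) : algebraMap k F x ∈ E := hE ⟨_, hfrk x⟩
    have hr (i) : w i / w 2 ∈ E := by
      fin_cases i
      · have h1 := sum_pow_mul_frobCross (Nat.card k) a
        rw [Fin.sum_univ_three, ha0, one_pow, one_mul] at h1
        have h2 : w 0 / w 2 = -(a 1 ^ Nat.card k * (w 1 / w 2) + a 2 ^ Nat.card k) := by
          have := hwi 2
          field_simp
          linear_combination h1
        change w 0 / w 2 ∈ E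
        rw [h2]
        exact neg_mem (add_mem (mul_mem (hE (hpow _)) ht) (hE (hpow _)))
      · exact ht
      · change w 2 / w 2 ∈ E
        rw [div_self (hwi 2)]
        exact one_mem E
    have hsE (m) : aeval a (s m).1 / w 2 ∈ E := by
      rw [hs, Finset.sum_div]
      refine sum_mem fun i _ => ?_
      rw [Algebra.smul_def, mul_div_assoc]
      exact mul_mem (hkE _) (hr i)
    have htop : E.comap φ = ⊤ := by
      apply hu
      · intro x
        rw [Subfield.mem_comap, hφk]
        exact hkE x
      · intro m
        rw [Subfield.mem_comap, eq_div_of_mul_eq hc (hφ m),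
          ← div_div_div_cancel_right₀ (hwi 2)]
        exact div_mem (hsE m) (hsE 0)
    rintro _ ⟨y, rfl⟩
    have hy : y ∈ E.comap φ := by rw [htop]; trivial
    exact hy
  -- `F` is generated by `a₁` over `φ(L)`, by the relation `a · w = 0`.
  · intro E hE ha1
    have ha2 : a 2 ∈ E := by
      have h1 := sum_mul_frobCross (Nat.card k) a
      rw [Fin.sum_univ_three, ha0, one_mul] at h1
      have h2 : a 2 = -(w 0 / w 2 + a 1 * (w 1 / w 2)) := by
        have := hwi 2
        field_simp
        linear_combination h1
      rw [h2]
      exact neg_mem (add_mem (hE (hwdiv 0)) (mul_mem ha1 (hE (hwdiv 1))))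
    refine subfield_eq_top (k := k) E (fun x => hE (hkmem x)) fun i => ?_
    fin_cases i
    · rw [ha] at ha1; exact ha1
    · rw [ha] at ha2; exact ha2
  · rintro _ ⟨z, rfl⟩
    exact ⟨z, (hfr z).symm⟩

end FieldExtension

/-! ### The generic point of the plane -/

section GenericPoint

variable {K : Type u} [Field K]

/-- The ideal of a point is zero if it contains no nonzero form, since it is homogeneous. -/
lemma pointIdeal_eq_bot {x : plane K}
    (h : ∀ (n : ℕ) (G : MvPolynomial (Fin 3) K), G.IsHomogeneous n → G ∈ pointIdeal x → G = 0) :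
    pointIdeal x = ⊥ := by
  rw [eq_bot_iff]
  intro G hG
  rw [Ideal.mem_bot, ← sum_homogeneousComponent G]
  refine Finset.sum_eq_zero fun n _ => h n _ (homogeneousComponent_isHomogeneous n G) ?_
  have h1 := x.asHomogeneousIdeal.isHomogeneous n hG
  have h2 : (DirectSum.decompose (grading K) G n : MvPolynomial (Fin 3) K) =
      homogeneousComponent n G := by
    exact decomposition.decompose'_apply G n
  rw [← h2]
  exact h1

variable (K) in
lemma exists_pointIdeal_eq_bot : ∃ x : plane K, pointIdeal x = ⊥ := by
  refine ⟨⟨⊥, ?_, fun h => ?_⟩, rfl⟩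
  · exact Ideal.isPrime_bot
  · have h1 : (X 0 : MvPolynomial (Fin 3) K) ∈ HomogeneousIdeal.irrelevant (grading K) :=
      (HomogeneousIdeal.mem_irrelevant_of_mem (grading K) (i := 1) Nat.one_pos
        ((mem_homogeneousSubmodule _ _).2 (isHomogeneous_X K 0)))
    have h2 : (X 0 : MvPolynomial (Fin 3) K) = 0 := h h1
    exact X_ne_zero 0 h2

lemma isGenericPoint_of_pointIdeal_eq_bot {x : plane K} (hx : pointIdeal x = ⊥) :
    IsGenericPoint x Set.univ := by
  refine Set.eq_univ_of_forall fun y => ?_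
  refine (ProjectiveSpectrum.le_iff_mem_closure (grading K) x y).1 ?_
  change pointIdeal x ≤ pointIdeal y
  rw [hx]
  exact bot_le

lemma mem_basicOpen_of_pointIdeal_eq_bot {x : plane K} (hx : pointIdeal x = ⊥)
    {G : MvPolynomial (Fin 3) K} (hG : G ≠ 0) : x ∈ Proj.basicOpen (grading K) G := by
  change G ∉ pointIdeal x
  rwa [hx, Ideal.mem_bot]

/-- A nonzero function `G / x₀ⁿ` is invertible on `D₊(x₀) ∩ D₊(G)`, which contains the generic
point. -/
lemma isUnit_germ {x : plane K} (hx : pointIdeal x = ⊥)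
    (hxD : x ∈ Proj.basicOpen (grading K) (X 0))
    {t : Γ(plane K, Proj.basicOpen (grading K) (X 0))} (ht : t ≠ 0) :
    IsUnit ((plane K).presheaf.germ _ x hxD t) := by
  obtain ⟨n, G, hG, rfl⟩ := exists_eq_fraction 0 t
  have hG0 : G ≠ 0 := by
    rintro rfl
    rw [fraction_X_eq_eval₂ _ rfl, eval₂_zero] at ht
    exact ht rfl
  have h1 : x ∈ (plane K).basicOpen (fraction (X 0) (isHomogeneous_X K 0) n G hG) := by
    rw [basicOpen_fraction]
    exact ⟨hxD, mem_basicOpen_of_pointIdeal_eq_bot hx hG0⟩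
  exact (Scheme.mem_basicOpen _ _ _ hxD).1 h1

lemma exists_mul_germ_eq {x : plane K} (hxD : x ∈ Proj.basicOpen (grading K) (X 0))
    (y : (plane K).presheaf.stalk x) : ∃ t r : Γ(plane K, Proj.basicOpen (grading K) (X 0)),
      IsUnit ((plane K).presheaf.germ _ x hxD r) ∧
      y * (plane K).presheaf.germ _ x hxD r = (plane K).presheaf.germ _ x hxD t := by
  have hD : IsAffineOpen (Proj.basicOpen (grading K) (X 0)) := (chart K 0).2
  let _ := (plane K).presheaf.algebra_section_stalk (⟨x, hxD⟩ : Proj.basicOpen (grading K) (X 0))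
  have h1 := hD.isLocalization_stalk ⟨x, hxD⟩
  obtain ⟨⟨t, r⟩, h⟩ := IsLocalization.surj
    (hD.primeIdealOf ⟨x, hxD⟩).asIdeal.primeCompl y
  exact ⟨t, r, IsLocalization.map_units _ r, h⟩

lemma isField_stalk {x : plane K} (hx : pointIdeal x = ⊥) :
    IsField ((plane K).presheaf.stalk x) := by
  have hxD : x ∈ Proj.basicOpen (grading K) (X 0) :=
    mem_basicOpen_of_pointIdeal_eq_bot hx (X_ne_zero 0)
  refine ⟨⟨0, 1, zero_ne_one⟩, mul_comm, fun {y} hy => ?_⟩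
  obtain ⟨t, r, hr, h⟩ := exists_mul_germ_eq hxD y
  have ht : t ≠ 0 := by
    rintro rfl
    rw [map_zero, hr.mul_left_eq_zero] at h
    exact hy h
  have hy1 : IsUnit y := isUnit_of_mul_isUnit_left (h ▸ isUnit_germ hx hxD ht)
  exact hy1.exists_right_inv

end GenericPoint

section

variable {k : Type u} [Field k] [Finite k]

/-- The same statement for rings that are fields, as it applies to local rings at generic points. -/
theorem isPurelyInseparable_and_finrank_eq_of_isField {F L : Type*} [CommRing F]
    [CommRing L] (hF : IsField F) (hL : IsField L)
    (s : Module.Basis (Fin 3) k (formsThroughZ k k (Nat.card k + 1))) {κ : k →+* L} {u : Fin 3 → L}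
    (hu : ∀ y : L, ∃ G H : MvPolynomial (Fin 3) k, IsUnit (eval₂ κ u H) ∧
      y * eval₂ κ u H = eval₂ κ u G)
    {φ : L →+* F} {a : Fin 3 → F} (ha0 : a 0 = 1)
    (ha : ∀ y : F, ∃ G H : MvPolynomial (Fin 3) k, IsUnit (eval₂ (φ.comp κ) a H) ∧
      y * eval₂ (φ.comp κ) a H = eval₂ (φ.comp κ) a G)
    (ha' : ∀ G : MvPolynomial (Fin 2) k, eval₂ (φ.comp κ) (fun i => a i.succ) G = 0 → G = 0)
    (hφ : ∀ m, φ (u m) * eval₂ (φ.comp κ) a (s 0).1 = eval₂ (φ.comp κ) a (s m).1) :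
    φ.IsPurelyInseparable ∧ φ.finrank = Nat.card k := by
  let _ := hF.toField
  let _ := hL.toField
  let _ : Algebra k L := κ.toAlgebra
  let _ : Algebra k F := (φ.comp κ).toAlgebra
  let β : MvPolynomial (Fin 2) k →ₐ[k] F := aeval fun i => a i.succ
  let _ : Algebra (MvPolynomial (Fin 2) k) F := β.toRingHom.toAlgebra
  have : IsScalarTower k (MvPolynomial (Fin 2) k) F := .of_algebraMap_eq fun c => (β.commutes c).symm
  have haβ (i : Fin 3) : a i = β ((![1, X 0, X 1] : Fin 3 → MvPolynomial (Fin 2) k) i) := by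
    fin_cases i
    · simp [ha0]
    · simp [β]
    · simp [β]
  have hinj : Function.Injective β := (injective_iff_map_eq_zero β).2 ha'
  have heval (G : MvPolynomial (Fin 3) k) : eval₂ (φ.comp κ) a G =
      β (aeval (![1, X 0, X 1] : Fin 3 → MvPolynomial (Fin 2) k) G) := by
    have h1 := DFunLike.congr_fun (comp_aeval (R := k)
      (![1, X 0, X 1] : Fin 3 → MvPolynomial (Fin 2) k) β) G
    rw [funext haβ]
    exact h1.symm
  have : FaithfulSMul (MvPolynomial (Fin 2) k) F := (faithfulSMul_iff_algebraMap_injective _ _).2 hinj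
  have : IsFractionRing (MvPolynomial (Fin 2) k) F := by
    refine IsFractionRing.of_field _ _ fun y => ?_
    obtain ⟨G, H, hH, h⟩ := ha y
    rw [heval] at hH
    rw [heval, heval] at h
    exact ⟨_, _, eq_div_of_mul_eq hH.ne_zero h⟩
  refine isPurelyInseparable_and_finrank_eq s (u := u) (fun E hk hE => ?_) (fun c => rfl)
    (a := a) haβ hφ
  have hmem (G : MvPolynomial (Fin 3) k) : eval₂ κ u G ∈ E := by
    induction G using MvPolynomial.induction_on with
    | C c => rw [eval₂_C]; exact hk c
    | add p q hp hq => rw [eval₂_add]; exact add_mem hp hq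
    | mul_X p i hp => rw [eval₂_mul, eval₂_X]; exact mul_mem hp (hE i)
  rw [eq_top_iff]
  intro y _
  obtain ⟨G, H, hH, h⟩ := hu y
  rw [← eq_div_iff hH.ne_zero] at h
  rw [h]
  exact div_mem (hmem G) (hmem H)

end

/-! ### The local ring at the generic point in coordinates -/

section StalkMap

lemma germ_appLE {S T : Scheme.{u}} (f : S ⟶ T) {V : T.Opens} {O : S.Opens} (e : O ≤ f ⁻¹ᵁ V)
    {x : S} (hx : x ∈ O) (t : Γ(T, V)) :
    S.presheaf.germ O x hx (f.appLE V O e t) =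
      f.stalkMap x (T.presheaf.germ V (f x) (show f x ∈ V from e hx) t) := by
  refine Eq.trans ?_ (Scheme.Hom.germ_stalkMap_apply f V x _ t).symm
  rw [Scheme.Hom.appLE, CommRingCat.comp_apply]
  exact TopCat.Presheaf.germ_res_apply _ _ _ _ _

lemma bijective_stalkMap {S T : Scheme.{u}} (f : S ⟶ T) [IsOpenImmersion f] (x : S) :
    Function.Bijective (f.stalkMap x) :=
  ConcreteCategory.bijective_of_isIso (f.stalkMap x)

variable {K : Type u} [Field K]

/-- The constants, as elements of the local ring at a point `x` of the chart `D₊(x₀)`. -/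
def stalkConst {x : plane K} (hx : x ∈ Proj.basicOpen (grading K) (X 0)) :
    K →+* (plane K).presheaf.stalk x :=
  ((plane K).presheaf.germ _ x hx).hom.comp (const (X 0) (isHomogeneous_X K 0))

/-- The affine coordinates `xₘ / x₀`, as elements of the local ring at a point of the chart
`D₊(x₀)`. -/
def stalkCoord {x : plane K} (hx : x ∈ Proj.basicOpen (grading K) (X 0)) (m : Fin 3) :
    (plane K).presheaf.stalk x :=
  (plane K).presheaf.germ _ x hx (fraction (X 0) (isHomogeneous_X K 0) 1 (X m) (isHomogeneous_X K m))

lemma germ_fraction {x : plane K} (hx : x ∈ Proj.basicOpen (grading K) (X 0)) (n : ℕ)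
    (G : MvPolynomial (Fin 3) K) (hG : G.IsHomogeneous (n * 1)) :
    (plane K).presheaf.germ _ x hx (fraction (X 0) (isHomogeneous_X K 0) n G hG) =
      eval₂ (stalkConst hx) (stalkCoord hx) G :=
  (congrArg _ (fraction_X_eq_eval₂ _ rfl hG)).trans (hom_eval₂ _ _ _ _)

lemma stalkCoord_zero {x : plane K} (hx : x ∈ Proj.basicOpen (grading K) (X 0)) :
    stalkCoord hx 0 = 1 :=
  (congrArg _ (fraction_one_self _ _)).trans (map_one _)

lemma exists_mul_eval₂_eq {x : plane K} (hx : x ∈ Proj.basicOpen (grading K) (X 0))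
    (y : (plane K).presheaf.stalk x) : ∃ G H : MvPolynomial (Fin 3) K,
      IsUnit (eval₂ (stalkConst hx) (stalkCoord hx) H) ∧
      y * eval₂ (stalkConst hx) (stalkCoord hx) H = eval₂ (stalkConst hx) (stalkCoord hx) G := by
  obtain ⟨t, r, hr, h⟩ := exists_mul_germ_eq hx y
  obtain ⟨n, G, hG, rfl⟩ := exists_eq_fraction 0 t
  obtain ⟨n', H, hH, rfl⟩ := exists_eq_fraction 0 r
  rw [germ_fraction] at hr
  rw [germ_fraction, germ_fraction] at h
  exact ⟨G, H, hr, h⟩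

lemma eq_zero_of_eval₂_stalkCoord_eq_zero {x : plane K} (hx : pointIdeal x = ⊥)
    (hxD : x ∈ Proj.basicOpen (grading K) (X 0)) {G : MvPolynomial (Fin 2) K}
    (h : eval₂ (stalkConst hxD) (fun i => stalkCoord hxD i.succ) G = 0) : G = 0 := by
  let t : Γ(plane K, Proj.basicOpen (grading K) (X 0)) :=
    eval₂ (const (X 0) (isHomogeneous_X K 0))
      (fun i : Fin 2 => fraction (X 0) (isHomogeneous_X K 0) 1 (X i.succ) (isHomogeneous_X K _)) G
  have h1 : (plane K).presheaf.germ _ x hxD t = 0 := (hom_eval₂ _ _ _ _).trans h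
  have h2 : t = 0 := by
    by_contra ht
    have h3 := isUnit_germ hx hxD ht
    rw [h1] at h3
    exact not_isUnit_zero h3
  have hone : (![1, X 0, X 1] : Fin 3 → MvPolynomial (Fin 2) K) 0 = 1 := by simp
  have h3 := congrArg (chartHom (C : K →+* MvPolynomial (Fin 2) K)
    (![1, X 0, X 1] : Fin 3 → MvPolynomial (Fin 2) K) 0 hone) h2
  simp only [t] at h3
  rw [hom_eval₂, map_zero] at h3
  rw [← h3]
  conv_lhs => rw [← eval₂_eta G]
  congr 1
  · ext c : 1
    rw [RingHom.comp_apply, const_apply, chartHom_fraction, eval₂_C]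
  · funext i
    rw [chartHom_fraction, eval₂_X]
    fin_cases i <;> rfl

end StalkMap

section GenericPoint

variable {k : Type u} [Field k] [Finite k]
  {s : Module.Basis (Fin 3) k (formsThroughZ k k (Nat.card k + 1))} {U : (plane k).Opens}
  {ψ : (U : Scheme.{u}) ⟶ plane k}

/-- A form in the ideal of the image of the generic point vanishes after the substitution of the
basis forms, hence is zero. So the image of the generic point is the generic point. -/
lemma pointIdeal_apply_eq_bot
    (hψ : IsGivenBy (fun i => (s i).2.1) U ψ) {x : U}
    (hx : pointIdeal (U.ι x) = ⊥) : pointIdeal (ψ x) = ⊥ := by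
  refine pointIdeal_eq_bot fun n G hG hmem => ?_
  obtain ⟨e, -⟩ := id (hψ 0)
  have hs0 : (s 0).1 ≠ 0 := fun h => s.ne_zero 0 (Subtype.ext h)
  have hx0 : x ∈ U.ι ⁻¹ᵁ Proj.basicOpen (grading k) (s 0).1 :=
    mem_basicOpen_of_pointIdeal_eq_bot hx hs0
  by_contra hG0
  have hG1 : G.IsHomogeneous (n * 1) := by rwa [mul_one]
  have hne : aeval (fun i => (s i).1) G ≠ 0 := fun h => hG0 (eq_zero_of_aeval_basis_eq_zero s hG h)
  have h1 := (hψ 0).appLE_fraction e n G hG1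
  have h2 := fraction_aeval (s 0).1 (s 0).2.1 (s := fun i => (s i).1)
    (fun m => by rw [one_mul]; exact (s m).2.1) hG1 (isHomogeneous_comp (fun i => (s i).2.1) hG1)
  have h3 : (ψ.appLE _ _ e).hom (fraction (X 0) (isHomogeneous_X k 0) n G hG1) =
      (U.ι.app _).hom (fraction (s 0).1 (s 0).2.1 n (aeval (fun i => (s i).1) G)
        (isHomogeneous_comp (fun i => (s i).2.1) hG1)) := by
    rw [h1, h2, hom_eval₂]
    rfl
  have h4 : ψ x ∈ (plane k).basicOpen (fraction (X 0) (isHomogeneous_X k 0) n G hG1) := by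
    have h5 : x ∈ (U : Scheme.{u}).basicOpen ((U.ι.app _).hom (fraction (s 0).1 (s 0).2.1 n
        (aeval (fun i => (s i).1) G) (isHomogeneous_comp (fun i => (s i).2.1) hG1))) := by
      refine (Scheme.preimage_basicOpen U.ι _).le (show U.ι x ∈ (plane k).basicOpen _ from ?_)
      rw [basicOpen_fraction]
      exact ⟨hx0, mem_basicOpen_of_pointIdeal_eq_bot hx hne⟩
    rw [← h3] at h5
    exact ((Scheme.basicOpen_appLE ψ _ _ e _).le h5).2
  rw [basicOpen_fraction] at h4
  exact h4.2 hmem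

lemma isPurelyInseparable_stalkMap (hψ : IsGivenBy (fun i => (s i).2.1) U ψ) {x : U}
    (hx : pointIdeal (U.ι x) = ⊥) :
    (ψ.stalkMap x).hom.IsPurelyInseparable ∧ (ψ.stalkMap x).hom.finrank = Nat.card k := by
  have hz := pointIdeal_apply_eq_bot hψ hx
  have hxD : U.ι x ∈ Proj.basicOpen (grading k) (X 0) :=
    mem_basicOpen_of_pointIdeal_eq_bot hx (X_ne_zero 0)
  have hzD : ψ x ∈ Proj.basicOpen (grading k) (X 0) :=
    mem_basicOpen_of_pointIdeal_eq_bot hz (X_ne_zero 0)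
  have hs0 : (s 0).1 ≠ 0 := fun h => s.ne_zero 0 (Subtype.ext h)
  have hx0 : x ∈ U.ι ⁻¹ᵁ Proj.basicOpen (grading k) (s 0).1 :=
    mem_basicOpen_of_pointIdeal_eq_bot hx hs0
  obtain ⟨e, hconst, hcoord⟩ := id (hψ 0)
  let W : (U : Scheme.{u}).Opens :=
    U.ι ⁻¹ᵁ (Proj.basicOpen (grading k) (X 0) ⊓ Proj.basicOpen (grading k) (s 0).1)
  have hxW : x ∈ W := ⟨hxD, hx0⟩
  have hWX : W ≤ U.ι ⁻¹ᵁ Proj.basicOpen (grading k) (X 0) := fun y hy => hy.1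
  have hWs : W ≤ U.ι ⁻¹ᵁ Proj.basicOpen (grading k) (s 0).1 := fun y hy => hy.2
  let ι' := U.ι.stalkMap x
  have hbij : Function.Bijective ι' := bijective_stalkMap U.ι x
  have happ (t : Γ(plane k, Proj.basicOpen (grading k) (s 0).1)) :
      (U : Scheme.{u}).presheaf.germ _ x hx0 (U.ι.app _ t) =
        ι' ((plane k).presheaf.germ _ (U.ι x) hx0 t) :=
    (Scheme.Hom.germ_stalkMap_apply U.ι _ x hx0 t).symm
  have hκ : (ψ.stalkMap x).hom.comp (stalkConst hzD) = ι'.hom.comp (stalkConst hxD) := by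
    ext c : 1
    have h1 := congrArg ((U : Scheme.{u}).presheaf.germ _ x hx0) (hconst c)
    have h2 := congrArg ((U : Scheme.{u}).presheaf.germ _ x hxW)
      (appLE_const_eq U.ι (isHomogeneous_X k 0) (s 0).2.1 hWX hWs c)
    refine (germ_appLE ψ e hx0 _).symm.trans (h1.trans ((happ _).trans ?_))
    exact (germ_appLE U.ι hWs hxW _).symm.trans (h2.symm.trans (germ_appLE U.ι hWX hxW _))
  have heval (G : MvPolynomial (Fin 3) k) : eval₂ ((ψ.stalkMap x).hom.comp (stalkConst hzD))
      (fun i => ι' (stalkCoord hxD i)) G = ι' (eval₂ (stalkConst hxD) (stalkCoord hxD) G) := by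
    rw [hκ]
    exact (hom_eval₂ _ _ _ _).symm
  have hF : IsField ((U : Scheme.{u}).presheaf.stalk x) :=
    MulEquiv.isField (isField_stalk hx) (RingEquiv.ofBijective ι'.hom hbij).symm.toMulEquiv
  refine isPurelyInseparable_and_finrank_eq_of_isField (κ := stalkConst hzD) (u := stalkCoord hzD) hF
    (isField_stalk hz) s (exists_mul_eval₂_eq hzD) (a := fun i => ι' (stalkCoord hxD i)) ?_ ?_ ?_ ?_
  · rw [stalkCoord_zero, map_one]
  · intro y
    obtain ⟨y, rfl⟩ := hbij.2 y
    obtain ⟨G, H, hH, h⟩ := exists_mul_eval₂_eq hxD y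
    refine ⟨G, H, ?_, ?_⟩
    · rw [heval]
      exact hH.map ι'.hom
    · rw [heval, heval, ← map_mul, h]
  · intro G hG
    rw [hκ] at hG
    have h1 : ι' (eval₂ (stalkConst hxD) (fun i => stalkCoord hxD i.succ) G) = 0 :=
      (hom_eval₂ _ _ _ _).trans hG
    exact eq_zero_of_eval₂_stalkCoord_eq_zero hx hxD (hbij.1 (h1.trans (map_zero _).symm))
  · intro m
    have hloc (j : Fin 3) : (plane k).presheaf.germ _ (U.ι x) hxD
        (localEquation (fun i => (s i).2.1) 0 j) =
          eval₂ (stalkConst hxD) (stalkCoord hxD) (s j).1 := germ_fraction hxD _ _ _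
    have h1 := congrArg ((U : Scheme.{u}).presheaf.germ _ x hx0) (hcoord m)
    have h2 := congrArg ((U : Scheme.{u}).presheaf.germ _ x hxW)
      (appLE_localEquation (fun i => (s i).2.1) U.ι 0 0 m hWX hWs)
    have h2 := ((germ_appLE U.ι hWX hxW _).symm.trans h2).trans ((map_mul _ _ _).trans
      (congrArg₂ (· * ·) (germ_appLE U.ι hWX hxW _) (germ_appLE U.ι hWs hxW _)))
    rw [hloc, hloc] at h2
    have h3 : (ψ.stalkMap x).hom (stalkCoord hzD m) = ι' ((plane k).presheaf.germ _ (U.ι x) hx0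
        (ratio (fun i => (s i).2.1) 0 m)) := 
      (germ_appLE ψ e hx0 _).symm.trans (h1.trans (happ _))
    rw [h3, heval, heval, mul_comm]
    exact h2.symm

end GenericPoint

/-! ### The complement of the rational points -/

section

variable {k : Type u} [Field k] [Finite k]

variable (k) in
lemma planeMinusZ_eq_iSup (s : Module.Basis (Fin 3) k (formsThroughZ k k (Nat.card k + 1))) :
    planeMinusZ k = ⨆ j, Proj.basicOpen (grading k) (s j).1 := by
  obtain ⟨A, N, hA, hN, -⟩ := exists_changeOfBasis s
  refine TopologicalSpace.Opens.ext (Set.ext fun x => ?_)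
  have h1 : x ∈ rationalPoints k ↔ ∀ j, (s j).1 ∈ pointIdeal x := by
    refine (mem_rationalPoints_iff x).trans ⟨fun h j => ?_, fun h j => ?_⟩
    · exact (forall_mem_formsThroughZ_iff (pointIdeal x)).2 h _ (s j).2
    · rw [hN]
      exact Ideal.sum_mem _ fun i _ => Submodule.smul_of_tower_mem _ _ (h i)
  rw [TopologicalSpace.Opens.coe_iSup, Set.mem_iUnion]
  exact (not_congr h1).trans not_forall

variable (k) in
lemma coe_planeMinusZ : (planeMinusZ k : Set (plane k)) = ((idealZ k).support : Set (plane k))ᶜ := by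
  rw [idealZ, Scheme.IdealSheafData.coe_support_vanishingIdeal]
  rfl

variable (k) in
lemma quasiCompact_planeMinusZ_ι : QuasiCompact (planeMinusZ k).ι := by
  have hU : IsCompact (planeMinusZ k : Set (plane k)) := by
    let s := (Pi.basisFun k (Fin 3)).map (crossFormEquiv k k)
    rw [planeMinusZ_eq_iSup k s, TopologicalSpace.Opens.coe_iSup]
    exact isCompact_iUnion fun j => IsAffineOpen.isCompact
      (Proj.isAffineOpen_basicOpen (grading k) _ (s j).2.1 (Nat.succ_pos _))
  have : CompactSpace (planeMinusZ k : Scheme.{u}) := isCompact_iff_compactSpace.1 hU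
  have : QuasiSeparatedSpace (plane k) := inferInstance
  exact quasiCompact_of_compactSpace _

lemma isGeneratedBy_idealZ (s : Module.Basis (Fin 3) k (formsThroughZ k k (Nat.card k + 1))) :
    IsGeneratedBy (fun i => (s i).2.1) (idealZ k) := by
  intro i
  refine (isBaseIdeal_idealZ i).trans (le_antisymm (Ideal.span_le.2 ?_) (Ideal.span_mono ?_))
  · rintro _ ⟨F, hF, hFd, rfl⟩
    have h1 := congrArg Subtype.val (s.sum_repr ⟨F, hF⟩)
    simp only [Submodule.coe_sum, Submodule.coe_smul, smul_eq_C_mul] at h1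
    have h2 : fraction (X i) (isHomogeneous_X k i) (Nat.card k + 1) F hFd =
        ∑ m, const (X i) (isHomogeneous_X k i) (s.repr ⟨F, hF⟩ m) *
          localEquation (fun i => (s i).2.1) i m := by
      refine (fraction_X_eq_eval₂ _ rfl hFd).trans ((congrArg (eval₂ _ _) h1.symm).trans ?_)
      rw [eval₂_sum]
      refine Finset.sum_congr rfl fun m _ => ?_
      rw [eval₂_mul, eval₂_C]
      exact congrArg (_ * ·) (fraction_X_eq_eval₂ _ rfl _).symm
    rw [h2]
    exact Ideal.sum_mem _ fun m _ => Ideal.mul_mem_left _ _ (Ideal.subset_span ⟨m, rfl⟩)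
  · rintro _ ⟨m, rfl⟩
    exact ⟨(s m).1, (s m).2, _, rfl⟩

variable (k) in
lemma exists_genericPoint : ∃ x : planeMinusZ k, pointIdeal ((planeMinusZ k).ι x) = ⊥ := by
  obtain ⟨x, hx⟩ := exists_pointIdeal_eq_bot k
  refine ⟨⟨x, fun h => ?_⟩, hx⟩
  have h1 := (mem_rationalPoints_iff x).1 h 0
  rw [hx, Ideal.mem_bot, ← crossForm_single] at h1
  have h2 := congrFun (crossForm_eq_zero h1) 0
  simp at h2

lemma isPurelyInseparableOfDegree
    {s : Module.Basis (Fin 3) k (formsThroughZ k k (Nat.card k + 1))}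
    {ψ : (planeMinusZ k : Scheme.{u}) ⟶ plane k}
    (hψ : IsGivenBy (fun i => (s i).2.1) (planeMinusZ k) ψ) :
    IsPurelyInseparableOfDegree ψ (Nat.card k) := by
  obtain ⟨x, hx⟩ := exists_genericPoint k
  refine ⟨x, ?_, isGenericPoint_of_pointIdeal_eq_bot (pointIdeal_apply_eq_bot hψ hx),
    isPurelyInseparable_stalkMap hψ hx⟩
  have h1 := (planeMinusZ k).ι.isOpenEmbedding.isInducing.closure_eq_preimage_closure_image {x}
  refine h1.trans ?_
  refine (congrArg (fun A => (planeMinusZ k).ι ⁻¹' closure A) Set.image_singleton).trans ?_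
  exact congrArg ((planeMinusZ k).ι ⁻¹' ·) (isGenericPoint_of_pointIdeal_eq_bot hx)

end

end SerrePlane

end

theorem proposition4p1 (k : Type u) [Field k] [Finite k] (q : ℕ) (hq : q = Nat.card k) :
    -- the linear system has projective dimension 2, and its base locus is exactly `Z`,
    -- as a set and as a closed subscheme
    (Module.finrank k (SerrePlane.formsThroughZ k k (q + 1)) = 2 + 1 ∧
      SerrePlane.baseLocus (SerrePlane.formsThroughZ k k (q + 1)) =
        (SerrePlane.rationalPoints k : Set (SerrePlane.plane k)) ∧
      SerrePlane.IsBaseIdeal (q + 1) (SerrePlane.formsThroughZ k k (q + 1))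
        (SerrePlane.idealZ k)) ∧
    -- it determines a morphism `ψ : ℙ² - Z ⟶ ℙ²`, purely inseparable of degree `q`, which extends
    -- to the blow-up of `ℙ²` along `Z`
    (∀ s : Module.Basis (Fin 3) k (SerrePlane.formsThroughZ k k (q + 1)),
      ∃ ψ : (SerrePlane.planeMinusZ k : Scheme.{u}) ⟶ SerrePlane.plane k,
        SerrePlane.IsMorphismOfForms (fun i => (s i).1) (fun i => (s i).2.1)
          (SerrePlane.planeMinusZ k) ψ ∧
        (∀ ψ' : (SerrePlane.planeMinusZ k : Scheme.{u}) ⟶ SerrePlane.plane k,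
          SerrePlane.IsMorphismOfForms (fun i => (s i).1) (fun i => (s i).2.1)
            (SerrePlane.planeMinusZ k) ψ' → ψ' = ψ) ∧
        SerrePlane.IsPurelyInseparableOfDegree ψ q ∧
        ∃ (B : Scheme.{u}) (π : B ⟶ SerrePlane.plane k),
          SerrePlane.IsBlowup π (SerrePlane.idealZ k) ∧
          ∃ ψB : B ⟶ SerrePlane.plane k,
            (π ⁻¹ᵁ SerrePlane.planeMinusZ k).ι ≫ ψB = (π ∣_ SerrePlane.planeMinusZ k) ≫ ψ) ∧
    -- over the algebraic closure, each member has exactly one singular point, and this gives a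
    -- bijection between the members and the points of the plane
    (Module.finrank (AlgebraicClosure k)
        (SerrePlane.formsThroughZ k (AlgebraicClosure k) (q + 1)) = 2 + 1 ∧
      ∃ σ : Projectivization (AlgebraicClosure k)
            (SerrePlane.formsThroughZ k (AlgebraicClosure k) (q + 1)) ≃
          Projectivization (AlgebraicClosure k) (Fin 3 → AlgebraicClosure k),
        ∀ D P, SerrePlane.IsSingularAt D.rep.1 P ↔ P = σ D) := by
  subst hq
  refine ⟨⟨SerrePlane.finrank_formsThroughZ k k, SerrePlane.baseLocus_formsThroughZ,
    SerrePlane.isBaseIdeal_idealZ⟩, fun s => ?_, SerrePlane.finrank_formsThroughZ k _,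
    SerrePlane.exists_singularPoint_equiv k _⟩
  have hU := (SerrePlane.planeMinusZ_eq_iSup k s).le
  have hZ := SerrePlane.coe_planeMinusZ k
  have hI := SerrePlane.isGeneratedBy_idealZ s
  have := SerrePlane.quasiCompact_planeMinusZ_ι k
  obtain ⟨ψ, hψ⟩ := SerrePlane.exists_isGivenBy (fun i => (s i).2.1) hU
  exact ⟨ψ, hψ.isMorphismOfForms hU, fun ψ' h => hψ.eq hU h.isGivenBy,
    SerrePlane.isPurelyInseparableOfDegree hψ,
    SerrePlane.exists_isBlowup _ _ hZ ψ (SerrePlane.exists_extension _ hI hZ hU hψ)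
      (SerrePlane.isInvertibleIdeal_comap_of_extension _ hI hU hψ)⟩
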